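/- Theorem. Let $\mathbf{BGen}$ be a generator of bilinear groups: on input $1^k$ it outputs, according to some probability law, $(q,\mathbb G,\mathbb G_1,g,\hat e)$ with $\mathbb G,\mathbb G_1$ groups of prime order $q\le 2^{\mathrm{poly}(k)}$, $g$ a generator of $\mathbb G$, and $\hat e:\mathbb G\times\mathbb G\to\mathbb G_1$ with $\hat e(g^a,g^b)=\hat e(g,g)^{ab}$ and $\hat e(g,g)$ a generator of $\mathbb G_1$. The parameters and the group elements are represented by bit strings of length $\mathrm{poly}(k)$, and the group operations and $\hat e$ are computable in time $\mathrm{poly}(k)$. Write $x\leftarrow S$ for a uniform choice. Algorithms may draw uniformly from $\{0,\dots,n\}$ for a given $n$, and a PPT algorithm is one that always halts within $\mathrm{poly}(k)$ steps. Consider the following identity-based key encapsulation mechanism (IBKEM) with identities in $\{0,1\}^*$. The master secret key is $s\leftarrow\mathbb Z_q^*$ and the master public key is $(q,\mathbb G,\mathbb G_1,g,\hat e,P=g^s)$ together with a hash function $H:\{0,1\}^*\to\mathbb G$. The decryption key of $ID$ is $H(ID)^s$. For $r\in\mathbb Z_q^*$, encapsulation for $ID$ outputs the key $\hat K=\hat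 e(P,H(ID))^r$ and the encapsulation $\hat C=g^r$. Decapsulation of $\hat C$ with a decryption key $\hat S$ outputs $\hat e(\hat C,\hat S)$. The function $H$ is modelled as a random oracle, whose values are independent elements $g^x$ with $x\leftarrow\mathbb Z_q^*$. Then: 1. The mechanism is consistent: decapsulating an encapsulation for $ID$ with the decryption key of $ID$ returns the encapsulated key. 2. If the expectation of $1/q$ over $\mathbf{BGen}(1^k)$ is negligible in $k$, the mechanism is collision-free full-identity malleable. That is, there is a function $\mathbf{FIM}(ID,r)$, computable from the public key, $ID$ and $r$ with access to $H$ in time polynomial in $k$ and the length of $ID$, such that (a) for all $H$, $ID$, $ID'$, $r$, if $\hat C$ is the encapsulation output for $(ID,r)$, then decapsulating $\hat C$ with the decryption key of $ID'$ gives $\mathbf{FIM}(ID',r)$; and (b) there is a negligible function $\nu$ such that for all $k$ and all $(ID,r)$, $(ID',r')$, which may depend on the public key but not on the values of $H$, the probability, over the master keys and $H$, that $(ID,r)\ne(ID',r')$ and $\mathbf{FIM}(ID,r)=\mathbf{FIM}(ID',r')$ is at most $\nu(k)$. 3. In the Anon-SS-ID-CPA game the adversary gets $1^k$ and the public key, may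 query $H$ and the decryption keys of identities of its choice, and once, at a time of its choice, submits two identities $ID_0^*,ID_1^*$. The challenger, which holds a uniform bit $d$, then chooses $r_0,r_1\leftarrow\mathbb Z_q^*$ independently, computes $(\hat K_i,\hat C_i)$ for $ID_i^*$ with $r_i$ $(i=0,1)$, and returns $(\hat K_d,\hat C_0)$. The adversary may never, before or after the challenge, query the decryption key of $ID_0^*$ or of $ID_1^*$. Its advantage is the probability that it outputs $d$, minus $\frac12$. Let $q_p:\mathbb N\to\mathbb N$ be such that $1^k\mapsto 1^{q_p(k)}$ is computable in polynomial time, and let $\mathcal A$ be a PPT adversary that obeys these rules and makes at most $q_p(k)$ decryption key queries (for all its random choices and all answers of the right form). Then there is a PPT algorithm $\mathcal B$ whose advantage $$Adv^{DBDH}_{\mathcal B}(1^k)=\Pr[\mathcal B(g^a,g^b,g^c,\hat e(g,g)^{abc})=1]-\Pr[\mathcal B(g^a,g^b,g^c,\hat e(g,g)^{y})=1],\qquad (a,b,c,y)\leftarrow(\mathbb Z_q^*)^4,$$ in the decisional bilinear Diffie-Hellman problem for $\mathbf{BGen}(1^k)$ satisfies, for every $k$, $$Adv^{DBDH}_{\mathcal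 B}(1^k)=\rho(q_p(k))\cdot Adv^{\text{Anon-SS-ID-CPA}}_{\mathcal A}(1^k),\qquad \rho(n)=\Big(1-\tfrac{2}{n+2}\Big)^{n}\Big(\tfrac{2}{n+2}\Big)^{2},$$ where $\rho(n)\sim\frac{4}{(e\,n)^2}$ as $n\to\infty$, and $e=\exp(1)$ is the base of natural logarithms. -/

import Mathlib

noncomputable section

/-! ## The machine model: a one-variable WHILE language on binary trees, with random sampling and
oracle calls, unit cost per executed atomic instruction -/

/-- Data are binary trees; `nil` is the empty list and also the Boolean `false`. -/
inductive Val : Type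
  | nil : Val
  | cons : Val → Val → Val

namespace Val

def fst : Val → Val
  | nil => nil
  | cons a _ => a

def snd : Val → Val
  | nil => nil
  | cons _ b => b

def isCons : Val → Bool
  | nil => false
  | cons _ _ => true

/-- The bit string that a tree stands for: the Boolean values of the entries on its right spine. -/
def toBits : Val → List Bool
  | nil => []
  | cons a b => a.isCons :: b.toBits

def ofBool : Bool → Val
  | false => nil
  | true => cons nil nil

def ofBits : List Bool → Val
  | [] => nil
  | b :: l => cons (ofBool b) (ofBits l)

/-- Natural numbers in binary, least significant bit first. -/
def ofNat (n : ℕ) : Val := ofBits n.bits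

def toNat (v : Val) : ℕ := v.toBits.foldr Nat.bit 0

/-- The string `1 ⋯ 1` of length `n`. -/
def unary (n : ℕ) : Val := ofBits (List.replicate n true)

end Val

/-- Interaction trees: the possible runs of a randomized computation that calls oracles named by
`O`. The node `rand n` draws uniformly from `{0, …, n}`. -/
inductive Comp (O α : Type) : Type
  | ret : α → Comp O α
  | rand : (n : ℕ) → (Fin (n + 1) → Comp O α) → Comp O α
  | call : O → Val → (Val → Comp O α) → Comp O α

namespace Comp

def bind {O α β : Type} : Comp O α → (α → Comp O β) → Comp O β
  | ret a, f => f a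
  | rand n c, f => rand n fun i => (c i).bind f
  | call o q c, f => call o q fun v => (c v).bind f

/-- The law of the result, the calls being answered by the (randomized, stateful) oracles `h`. -/
def run {O α σ : Type} (h : O → Val → σ → PMF (Val × σ)) : Comp O α → σ → PMF (α × σ)
  | ret a, s => PMF.pure (a, s)
  | rand n c, s => (PMF.uniformOfFintype (Fin (n + 1))).bind fun i => (c i).run h s
  | call o q c, s => (h o q s).bind fun y => (c y.1).run h y.2

/-- `post` holds at the end of every run in which each answer to a call is allowed by `ok`; `post`
is given the list of the calls made (after those in the list passed in) and the result. -/
def Always {O α : Type} (ok : O → Val → Val → Prop) (post : List (O × Val) → α → Prop) :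
    List (O × Val) → Comp O α → Prop
  | log, ret a => post log a
  | log, rand _ c => ∀ i, Always ok post log (c i)
  | log, call o q c => ∀ v, ok o q v → Always ok post (log ++ [(o, q)]) (c v)

end Comp

/-- Programs. Each one transforms a tree. -/
inductive Prog (O : Type) : Type
  /-- atomic instructions: the constant `nil`, the identity, the two components -/
  | nil : Prog O
  | id : Prog O
  | fst : Prog O
  | snd : Prog O
  /-- atomic: read the input as a binary number `n`, draw a number uniformly from `{0, …, n}` -/
  | rand : Prog O
  /-- atomic: call the oracle `o` on the input -/
  | call (o : O) : Prog O
  /-- first `p`, then `r` on the result of `p` -/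
  | seq (p r : Prog O) : Prog O
  /-- `cons` of the results of `p` and of `r`, both run on the input -/
  | pair (p r : Prog O) : Prog O
  /-- run `p` if the result of `c` on the input is not `nil`, otherwise `r` -/
  | ite (c p r : Prog O) : Prog O
  /-- repeat `p` as long as the result of `c` is not `nil` -/
  | loop (c p : Prog O) : Prog O

/-- Run on an input with a number of time units; the result is the output and the time left, or
`none` if the time did not suffice. -/
abbrev Exec (O : Type) : Type := Val → ℕ → Comp O (Option (Val × ℕ))

namespace Exec

variable {O : Type}

/-- An atomic instruction takes one unit of time. -/
def atom (f : Val → Comp O Val) : Exec O := fun v t =>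
  match t with
  | 0 => .ret none
  | t + 1 => (f v).bind fun w => .ret (some (w, t))

def andThen (x : Comp O (Option (Val × ℕ))) (f : Exec O) : Comp O (Option (Val × ℕ)) :=
  x.bind fun
    | none => .ret none
    | some (w, t) => f w t

/-- At most `n` iterations. Each evaluation of the test `c` executes an atomic instruction, so `t`
iterations are never exceeded within time `t`. -/
def loop (c p : Exec O) : ℕ → Exec O
  | 0 => fun _ _ => .ret none
  | n + 1 => fun v t =>
      andThen (c v t) fun b t' =>
        match b with
        | .nil => .ret (some (v, t'))
        | .cons _ _ => andThen (p v t') (loop c p n)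

end Exec

/-- The semantics of programs. -/
def Prog.eval {O : Type} : Prog O → Exec O
  | .nil => Exec.atom fun _ => .ret .nil
  | .id => Exec.atom fun v => .ret v
  | .fst => Exec.atom fun v => .ret v.fst
  | .snd => Exec.atom fun v => .ret v.snd
  | .rand => Exec.atom fun v => .rand v.toNat fun i => .ret (Val.ofNat i)
  | .call o => Exec.atom fun v => .call o v .ret
  | .seq p r => fun v t => Exec.andThen (p.eval v t) r.eval
  | .pair p r => fun v t => Exec.andThen (p.eval v t) fun a t' =>
      Exec.andThen (r.eval v t') fun b t'' => .ret (some (.cons a b, t''))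
  | .ite c p r => fun v t => Exec.andThen (c.eval v t) fun b t' =>
      match b with
      | .nil => r.eval v t'
      | .cons _ _ => p.eval v t'
  | .loop c p => fun v t => Exec.loop c.eval p.eval t v t

/-- The output bit of a run: `1` if the output is not `nil`. -/
def outBit : Option (Val × ℕ) → Bool
  | some (v, _) => v.isCons
  | none => false

/-- The program (without oracles) outputs `w` on input `v` within time `t`, whatever it draws. -/
def Prog.Computes (p : Prog Empty) (v w : Val) (t : ℕ) : Prop :=
  (p.eval v t).Always (fun o => o.elim) (fun _ x => ∃ t', x = some (w, t')) []

/-- `1^k ↦ 1^(f k)` is computable in polynomial time. -/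
def UnaryPolyTime (f : ℕ → ℕ) : Prop :=
  ∃ (p : Prog Empty) (T : Polynomial ℕ), ∀ k, p.Computes (Val.unary k) (Val.unary (f k)) (T.eval k)

/-- Negligible functions of the security parameter. -/
def Negligible (f : ℕ → ℝ) : Prop :=
  Asymptotics.SuperpolynomialDecay Filter.atTop (fun k : ℕ => (k : ℝ)) f

/-! ## Bilinear groups -/

/-- A generator of bilinear groups: on `1^k` it outputs (with the law `gen k`) parameters `pp`
that stand for `(q, G, G₁, g, e)`; parameters and group elements are represented by bit strings. -/
structure BilinearGen where
  Param : Type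
  gen : ℕ → PMF Param
  q : Param → ℕ
  q_prime : ∀ pp, Fact (q pp).Prime
  G : Param → Type
  G₁ : Param → Type
  commGroupG : ∀ pp, CommGroup (G pp)
  commGroupG₁ : ∀ pp, CommGroup (G₁ pp)
  card_G : ∀ pp, Nat.card (G pp) = q pp
  card_G₁ : ∀ pp, Nat.card (G₁ pp) = q pp
  g : ∀ pp, G pp
  g_generates : ∀ pp (x : G pp), x ∈ Subgroup.zpowers (g pp)
  e : ∀ pp, G pp → G pp → G₁ pp
  e_bilinear : ∀ pp (a b : ℕ), e pp (g pp ^ a) (g pp ^ b) = e pp (g pp) (g pp) ^ (a * b)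
  e_generates : ∀ pp (x : G₁ pp), x ∈ Subgroup.zpowers (e pp (g pp) (g pp))
  desc : Param → List Bool
  encG : ∀ pp, G pp → List Bool
  encG_injective : ∀ pp, Function.Injective (encG pp)
  encG₁ : ∀ pp, G₁ pp → List Bool
  encG₁_injective : ∀ pp, Function.Injective (encG₁ pp)

attribute [instance] BilinearGen.q_prime BilinearGen.commGroupG BilinearGen.commGroupG₁

/-- The exponent in `{1, …, q - 1}` that an element of `Z_q^*` stands for. -/
def expo {n : ℕ} (x : (ZMod n)ˣ) : ℕ := (x : ZMod n).val

namespace BilinearGen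

variable (B : BilinearGen)

/-- The output of the generator on `1^k`, together with `1^k`, as it is given to programs. -/
def header (k : ℕ) (pp : B.Param) : Val :=
  .cons (.unary k) (.cons (.ofNat (B.q pp))
    (.cons (.ofBits (B.desc pp)) (.ofBits (B.encG pp (B.g pp)))))

/-- Representations have polynomial length, and the group operations and the bilinear map are
computable in polynomial time. (That `gen` can be sampled efficiently is not needed.) -/
structure Efficient : Prop where
  size : ∃ T : Polynomial ℕ, ∀ k, ∀ pp ∈ (B.gen k).support,
    B.q pp ≤ 2 ^ T.eval k ∧ (B.desc pp).length ≤ T.eval k ∧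
    (∀ x, (B.encG pp x).length ≤ T.eval k) ∧ (∀ x, (B.encG₁ pp x).length ≤ T.eval k)
  mul_G : ∃ (p : Prog Empty) (T : Polynomial ℕ), ∀ k, ∀ pp ∈ (B.gen k).support, ∀ x y : B.G pp,
    p.Computes (.cons (B.header k pp) (.cons (.ofBits (B.encG pp x)) (.ofBits (B.encG pp y))))
      (.ofBits (B.encG pp (x * y))) (T.eval k)
  mul_G₁ : ∃ (p : Prog Empty) (T : Polynomial ℕ), ∀ k, ∀ pp ∈ (B.gen k).support, ∀ x y : B.G₁ pp,
    p.Computes (.cons (B.header k pp) (.cons (.ofBits (B.encG₁ pp x)) (.ofBits (B.encG₁ pp y))))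
      (.ofBits (B.encG₁ pp (x * y))) (T.eval k)
  pairing : ∃ (p : Prog Empty) (T : Polynomial ℕ), ∀ k, ∀ pp ∈ (B.gen k).support, ∀ x y : B.G pp,
    p.Computes (.cons (B.header k pp) (.cons (.ofBits (B.encG pp x)) (.ofBits (B.encG pp y))))
      (.ofBits (B.encG₁ pp (B.e pp x y))) (T.eval k)

/-- The expectation of `1 / q` is negligible in `k`. -/
def LargeOrder : Prop :=
  Negligible fun k => (∑' pp, B.gen k pp * (B.q pp : ENNReal)⁻¹).toReal

/-! ### The decisional bilinear Diffie-Hellman problem -/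

/-- The uniform law on `Z_q^*`. -/
def unitLaw (pp : B.Param) : PMF (ZMod (B.q pp))ˣ := PMF.uniformOfFintype _

/-- The input `(g^a, g^b, g^c, Z)`, after the parameters. -/
def dbdhInput (k : ℕ) (pp : B.Param) (a b c : (ZMod (B.q pp))ˣ) (Z : B.G₁ pp) : Val :=
  .cons (B.header k pp)
    (.cons (.ofBits (B.encG pp (B.g pp ^ expo a)))
      (.cons (.ofBits (B.encG pp (B.g pp ^ expo b)))
        (.cons (.ofBits (B.encG pp (B.g pp ^ expo c)))
          (.ofBits (B.encG₁ pp Z)))))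

/-- The law of the output bit of `D`, run for time `t`. -/
def outputLaw (D : Prog Empty) (v : Val) (t : ℕ) : PMF Bool :=
  ((D.eval v t).run (σ := Unit) (fun o => o.elim) ()).map fun y => outBit y.1

/-- The output of `D` on `(g^a, g^b, g^c, e(g,g)^(abc))`. -/
def dbdhReal (D : Prog Empty) (T : Polynomial ℕ) (k : ℕ) : PMF Bool :=
  (B.gen k).bind fun pp => (B.unitLaw pp).bind fun a => (B.unitLaw pp).bind fun b =>
    (B.unitLaw pp).bind fun c =>
      outputLaw D (B.dbdhInput k pp a b c
        (B.e pp (B.g pp) (B.g pp) ^ (expo a * expo b * expo c))) (T.eval k)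

/-- The output of `D` on `(g^a, g^b, g^c, e(g,g)^y)`. -/
def dbdhRandom (D : Prog Empty) (T : Polynomial ℕ) (k : ℕ) : PMF Bool :=
  (B.gen k).bind fun pp => (B.unitLaw pp).bind fun a => (B.unitLaw pp).bind fun b =>
    (B.unitLaw pp).bind fun c => (B.unitLaw pp).bind fun y =>
      outputLaw D (B.dbdhInput k pp a b c (B.e pp (B.g pp) (B.g pp) ^ expo y)) (T.eval k)

/-- The advantage of `D` in the DBDH problem. -/
def dbdhAdvantage (D : Prog Empty) (T : Polynomial ℕ) (k : ℕ) : ℝ :=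
  (B.dbdhReal D T k true).toReal - (B.dbdhRandom D T k true).toReal

/-- `D` halts within time `T(k)` on every input of the DBDH problem, whatever it draws. -/
def IsPPTSolver (D : Prog Empty) (T : Polynomial ℕ) : Prop :=
  ∀ k, ∀ pp ∈ (B.gen k).support, ∀ a b c y : (ZMod (B.q pp))ˣ,
    (D.eval (B.dbdhInput k pp a b c (B.e pp (B.g pp) (B.g pp) ^ expo y)) (T.eval k)).Always
      (fun o => o.elim) (fun _ x => x.isSome = true) []

end BilinearGen

/-! ## Identity-based key encapsulation in the random oracle model; identities are bit strings -/

/-- Computations that may query a hash function `{0,1}^* → R`. -/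
inductive ROM (R α : Type) : Type
  | ret : α → ROM R α
  | hash : List Bool → (R → ROM R α) → ROM R α

/-- The values of a random oracle that have been determined so far. -/
abbrev Table (R : Type) : Type := List (List Bool × R)

/-- A random oracle: a new query gets a fresh value of the given law, an old one its old value. -/
def lazyHash {R : Type} (law : PMF R) (id : List Bool) (t : Table R) : PMF (R × Table R) :=
  match t.lookup id with
  | some h => PMF.pure (h, t)
  | none => law.bind fun h => PMF.pure (h, (id, h) :: t)

namespace ROM

/-- The result for a given hash function. -/
def eval {R α : Type} (H : List Bool → R) : ROM R α → α
  | ret a => a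
  | hash id c => (c (H id)).eval H

/-- The law of the result when the hash function is a random oracle. -/
def run {R α : Type} (law : PMF R) : ROM R α → Table R → PMF (α × Table R)
  | ret a, t => PMF.pure (a, t)
  | hash id c, t => (lazyHash law id t).bind fun y => (c y.1).run law y.2

end ROM

/-- Identity-based key encapsulation mechanisms with a hash function: the spaces of master keys,
hash values, random values, decryption keys, encapsulated keys and encapsulations, the law of a hash
value (as a random oracle) and of a random value, the four algorithms, and the representations. -/
structure IBKEM where
  PK : Type
  SK : PK → Type
  Rng : PK → Type
  Rnd : PK → Type
  DKey : PK → Type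
  Key : PK → Type
  Cap : PK → Type
  hashLaw : ∀ pk, PMF (Rng pk)
  rndLaw : ∀ pk, PMF (Rnd pk)
  setup : ℕ → PMF (Σ pk, SK pk)
  extract : ∀ pk, SK pk → List Bool → ROM (Rng pk) (DKey pk)
  encaps : ∀ pk, List Bool → Rnd pk → ROM (Rng pk) (Key pk × Cap pk)
  decaps : ∀ pk, DKey pk → Cap pk → Option (Key pk)
  encPK : ℕ → PK → Val
  encRng : ∀ pk, Rng pk → List Bool
  encRnd : ∀ pk, Rnd pk → List Bool
  encDKey : ∀ pk, DKey pk → List Bool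
  encKey : ∀ pk, Key pk → List Bool
  encCap : ∀ pk, Cap pk → List Bool

/-- The oracles of an adversary. -/
inductive AdvOracle : Type
  | hash : AdvOracle
  | extract : AdvOracle
  | challenge : AdvOracle
  deriving DecidableEq

namespace IBKEM

variable (S : IBKEM)

/-- Consistency: an encapsulation is decapsulated correctly. -/
def Consistent : Prop :=
  ∀ k, ∀ x ∈ (S.setup k).support, ∀ (H : List Bool → S.Rng x.1) (id : List Bool) (r : S.Rnd x.1),
    S.decaps x.1 ((S.extract x.1 x.2 id).eval H) ((S.encaps x.1 id r).eval H).2 =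
      some ((S.encaps x.1 id r).eval H).1

/-- `F` is computable in time polynomial in `k` and the length of the identity, from the public
key, with access to the hash function. -/
def EfficientFIM (F : ∀ pk, List Bool → S.Rnd pk → ROM (S.Rng pk) (S.Key pk)) : Prop :=
  ∃ (p : Prog Unit) (T : Polynomial ℕ), ∀ k, ∀ x ∈ (S.setup k).support,
    ∀ (H : List Bool → S.Rng x.1) (id : List Bool) (r : S.Rnd x.1),
      (p.eval (.cons (S.encPK k x.1) (.cons (.ofBits id) (.ofBits (S.encRnd x.1 r))))
        (T.eval (k + id.length))).Always
          (fun _ v a => a = .ofBits (S.encRng x.1 (H v.toBits)))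
          (fun _ y => ∃ t, y = some (.ofBits (S.encKey x.1 ((F x.1 id r).eval H)), t)) []

/-- Full-identity malleability. -/
def Malleable (F : ∀ pk, List Bool → S.Rnd pk → ROM (S.Rng pk) (S.Key pk)) : Prop :=
  ∀ k, ∀ x ∈ (S.setup k).support, ∀ (H : List Bool → S.Rng x.1) (id id' : List Bool)
    (r : S.Rnd x.1),
    S.decaps x.1 ((S.extract x.1 x.2 id').eval H) ((S.encaps x.1 id r).eval H).2 =
      some ((F x.1 id' r).eval H)

open Classical in
/-- The event that the pairs `(id, r)` and `(id', r')`, which may be chosen depending on the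
public key, are distinct and have the same value under `F`, over the choice of the master keys and
of the random oracle. -/
def collisionLaw (F : ∀ pk, List Bool → S.Rnd pk → ROM (S.Rng pk) (S.Key pk))
    (id id' : S.PK → List Bool) (r r' : ∀ pk, S.Rnd pk) (k : ℕ) : PMF Bool :=
  (S.setup k).bind fun x =>
    ((F x.1 (id x.1) (r x.1)).run (S.hashLaw x.1) []).bind fun y =>
      ((F x.1 (id' x.1) (r' x.1)).run (S.hashLaw x.1) y.2).map fun y' =>
        decide ((id x.1 ≠ id' x.1 ∨ r x.1 ≠ r' x.1) ∧ y.1 = y'.1)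

/-- Collision-freeness, except with negligible probability. -/
def CollisionFree (F : ∀ pk, List Bool → S.Rnd pk → ROM (S.Rng pk) (S.Key pk)) : Prop :=
  ∃ ν : ℕ → ℝ, Negligible ν ∧ ∀ k (id id' : S.PK → List Bool) (r r' : ∀ pk, S.Rnd pk),
    (S.collisionLaw F id id' r r' k true).toReal ≤ ν k

/-- `S` is collision-free full-identity malleable. -/
def IsCollisionFreeFIM : Prop :=
  ∃ F : ∀ pk, List Bool → S.Rnd pk → ROM (S.Rng pk) (S.Key pk),
    S.EfficientFIM F ∧ S.Malleable F ∧ S.CollisionFree F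

/-! ### The Anon-SS-ID-CPA game -/

/-- The challenger with challenge bit `d`; its state is the table of the random oracle. The
challenge is the key of the identity number `d` with the encapsulation of the identity number 0, the
two pairs being computed with independent random values. -/
def challenger (pk : S.PK) (sk : S.SK pk) (d : Bool) :
    AdvOracle → Val → Table (S.Rng pk) → PMF (Val × Table (S.Rng pk))
  | .hash, v, t => (lazyHash (S.hashLaw pk) v.toBits t).map fun y =>
      (.ofBits (S.encRng pk y.1), y.2)
  | .extract, v, t => ((S.extract pk sk v.toBits).run (S.hashLaw pk) t).map fun y =>
      (.ofBits (S.encDKey pk y.1), y.2)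
  | .challenge, v, t =>
      (S.rndLaw pk).bind fun r₀ => (S.rndLaw pk).bind fun r₁ =>
        ((S.encaps pk v.fst.toBits r₀).run (S.hashLaw pk) t).bind fun y₀ =>
          ((S.encaps pk v.snd.toBits r₁).run (S.hashLaw pk) y₀.2).map fun y₁ =>
            (.cons (.ofBits (S.encKey pk (if d then y₁.1.1 else y₀.1.1)))
              (.ofBits (S.encCap pk y₀.1.2)), y₁.2)

/-- The event that the adversary `A`, run for time `T(k)`, guesses the challenge bit. -/
def game (A : Prog AdvOracle) (T : Polynomial ℕ) (k : ℕ) : PMF Bool :=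
  (S.setup k).bind fun x => (PMF.uniformOfFintype Bool).bind fun d =>
    ((A.eval (S.encPK k x.1) (T.eval k)).run (S.challenger x.1 x.2 d) []).map fun y =>
      decide (outBit y.1 = d)

/-- The advantage of `A` in the Anon-SS-ID-CPA game. -/
def advantage (A : Prog AdvOracle) (T : Polynomial ℕ) (k : ℕ) : ℝ :=
  (S.game A T k true).toReal - 1 / 2

/-- The answers of an oracle that have the right form. -/
def Answer (pk : S.PK) : AdvOracle → Val → Val → Prop
  | .hash, _, a => ∃ h ∈ (S.hashLaw pk).support, a = .ofBits (S.encRng pk h)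
  | .extract, _, a => ∃ s, a = .ofBits (S.encDKey pk s)
  | .challenge, _, a => ∃ K C, a = .cons (.ofBits (S.encKey pk K)) (.ofBits (S.encCap pk C))

end IBKEM

/-- The rules of the game, for the list of the calls in a run: there is exactly one challenge, there
are at most `n` decryption key queries, and none of them is for a challenge identity. -/
def ObeysRules (n : ℕ) (log : List (AdvOracle × Val)) : Prop :=
  log.countP (fun x => x.1 = .extract) ≤ n ∧
  ∃ v, log.filter (fun x => x.1 = .challenge) = [(.challenge, v)] ∧
    ∀ w, (AdvOracle.extract, w) ∈ log → w.toBits ≠ v.fst.toBits ∧ w.toBits ≠ v.snd.toBits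

/-- `A` is an adversary that halts within time `T(k)`, obeys the rules of the game and makes at most
`qp k` decryption key queries, whatever it draws and whatever answers of the right form it gets. -/
def IBKEM.IsPPTAdversary (S : IBKEM) (A : Prog AdvOracle) (T : Polynomial ℕ) (qp : ℕ → ℕ) : Prop :=
  ∀ k, ∀ x ∈ (S.setup k).support,
    (A.eval (S.encPK k x.1) (T.eval k)).Always (S.Answer x.1)
      (fun log y => y.isSome = true ∧ ObeysRules (qp k) log) []

/-! ## The mechanism -/

/-- Public keys: the parameters and `P = g^s`. -/
structure PubKey (B : BilinearGen) where
  pp : B.Param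
  P : B.G pp

/-- The mechanism: `P = g^s`, the decryption key of `ID` is `H(ID)^s`, the encapsulated key and the
encapsulation are `e(P, H(ID))^r` and `g^r`, and `C` is decapsulated to `e(C, H(ID)^s)`. The random
oracle `H` has uniformly distributed values `g^x` with `x` in `Z_q^*`. -/
def roIBKEM (B : BilinearGen) : IBKEM where
  PK := PubKey B
  SK pk := (ZMod (B.q pk.pp))ˣ
  Rng pk := B.G pk.pp
  Rnd pk := (ZMod (B.q pk.pp))ˣ
  DKey pk := B.G pk.pp
  Key pk := B.G₁ pk.pp
  Cap pk := B.G pk.pp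
  hashLaw pk := (B.unitLaw pk.pp).map fun x => B.g pk.pp ^ expo x
  rndLaw pk := B.unitLaw pk.pp
  setup k := (B.gen k).bind fun pp => (B.unitLaw pp).map fun s => ⟨⟨pp, B.g pp ^ expo s⟩, s⟩
  extract _ s id := .hash id fun h => .ret (h ^ expo s)
  encaps pk id r := .hash id fun h => .ret (B.e pk.pp pk.P h ^ expo r, B.g pk.pp ^ expo r)
  decaps pk S C := some (B.e pk.pp C S)
  encPK k pk := .cons (B.header k pk.pp) (.ofBits (B.encG pk.pp pk.P))
  encRng pk := B.encG pk.pp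
  encRnd _ r := (expo r).bits
  encDKey pk := B.encG pk.pp
  encKey pk := B.encG₁ pk.pp
  encCap pk := B.encG pk.pp

/-- The factor `(1 - σ)^n σ^2` with `σ = 2 / (n + 2)`. -/
def lossFactor (n : ℕ) : ℝ := (1 - 2 / ((n : ℝ) + 2)) ^ n * (2 / ((n : ℝ) + 2)) ^ 2

end

noncomputable section
open scoped ENNReal

/-! ## Couplings and expectations -/

namespace PMF

variable {α β γ δ : Type}

/-! Consistency and malleability are one computation: every element of the cyclic group is a power
of `g`, so `e(g^r, h^s) = e(g^s, h)^r` (`e_decaps`), and the right side can be computed without the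
master secret. For collisions, `e(P, H(ID))` generates a group of prime order. Hence equal
identities with different exponents never collide, and for different identities a collision forces
the exponent of the second hash value to one element of `Z_q^*`, an event of probability `1/(q-1) ≤
2/q` (`collision_le`).

The reduction plays the game with `P = g^a`. Put `n = q_p(k)`. Each identity gets a hidden coin,
which shows `true` with probability `σ = 2/(n+2)`, and a uniform exponent `i` in `Z_q^*`. Its hash
value is `g^i` if the coin shows `false`, and then `(g^a)^i` is its decryption key; it is `(g^b)^i`
if the coin shows `true`, and then `Z^i = e(P, H(ID))^c'`, where `Z = e(g,g)^(abc')`. The challenge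
is answered by the `Z^i` of the first identity together with `g^c`. For `c' = c` this is the
challenge with bit 0. For independent `c'` the key is a uniform generator of the target group,
independent of the encapsulation, as is the key of the second identity in the challenge with bit 1
(`ev_keyLaw`). The run is useless if a decryption key query meets the coin `true` or a challenge
identity meets `false`. Hash values have the same law for both sides of the coin, so the coins
remain independent of what the adversary sees.

An equality of advantages requires that the probability of a useful run be the same number whatever
the adversary does. Repeated queries, equal challenge identities and fewer than `n` decryption key
queries would spoil this. Therefore a coin is tossed afresh after each use, while the stored keys
stay (the only one that the rules still allow to be needed is already correct), and the missing
tosses are made up for at the end. Exactly `n` independent coins must then show `false` and two must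
show `true`, which has probability `(1-σ)^n σ^2`. A last fair coin supplies the factor `1/2` by
which the advantage differs from the difference of the probabilities of output 0 under the two
challenge bits (`advantage_eq`). The heart of the argument is `avg_run`, an induction on the
interaction tree of the adversary in which the simulation is averaged over the coins and over `(c,
c')`.

It remains to write the reduction as a program of polynomial running time. `Sem` specifies the law
of the output of a program together with a time bound. `Prog.compile` replaces oracle calls by code
acting on a stored state, and `Prog.imitates` couples the compiled program with the run that calls
oracles. `coupled_solver` puts these together. -/

theorem bind_congr_support (p : PMF α) {f g : α → PMF β} (h : ∀ a ∈ p.support, f a = g a) :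
    p.bind f = p.bind g := by
  ext b
  simp only [bind_apply]
  refine tsum_congr fun a => ?_
  by_cases ha : p a = 0
  · simp [ha]
  · rw [h a ((p.mem_support_iff a).2 ha)]

/-- `μ` and `ν` have a joint law under which `R` holds surely. -/
def Coupled (R : α → β → Prop) (μ : PMF α) (ν : PMF β) : Prop :=
  ∃ π : PMF (α × β), π.map Prod.fst = μ ∧ π.map Prod.snd = ν ∧ ∀ x ∈ π.support, R x.1 x.2

theorem Coupled.pure {R : α → β → Prop} {a : α} {b : β} (h : R a b) :
    Coupled R (PMF.pure a) (PMF.pure b) :=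
  ⟨PMF.pure (a, b), by simp [pure_map], by simp [pure_map], by
    intro x hx
    simp only [support_pure, Set.mem_singleton_iff] at hx
    subst hx
    exact h⟩

theorem Coupled.refl {R : α → α → Prop} (μ : PMF α) (h : ∀ a ∈ μ.support, R a a) :
    Coupled R μ μ := by
  refine ⟨μ.map fun a => (a, a), ?_, ?_, ?_⟩
  · rw [map_comp]; exact map_id μ
  · rw [map_comp]; exact map_id μ
  · intro x hx
    rw [mem_support_map_iff] at hx
    obtain ⟨a, ha, rfl⟩ := hx
    exact h a ha

/-- Draw a pair from the coupling of the first stage, then continue with a coupling chosen for that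
pair. -/
theorem Coupled.bind {R : α → β → Prop} {R' : γ → δ → Prop} {μ : PMF α} {ν : PMF β}
    {f : α → PMF γ} {g : β → PMF δ} (h : Coupled R μ ν)
    (hf : ∀ a ∈ μ.support, ∀ b ∈ ν.support, R a b → Coupled R' (f a) (g b)) :
    Coupled R' (μ.bind f) (ν.bind g) := by
  classical
  obtain ⟨π, rfl, rfl, hR⟩ := h
  have key : ∀ x ∈ π.support, Coupled R' (f x.1) (g x.2) := fun x hx =>
    hf x.1 ((mem_support_map_iff _ _ _).2 ⟨x, hx, rfl⟩) x.2
      ((mem_support_map_iff _ _ _).2 ⟨x, hx, rfl⟩) (hR x hx)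
  choose K h1 h2 h3 using key
  -- Outside the support of `π` no coupling is at hand; the independent product only makes `L`
  -- total.
  let L : α × β → PMF (γ × δ) := fun x =>
    if hx : x ∈ π.support then K x hx else (f x.1).bind fun a => (g x.2).map fun b => (a, b)
  have hL : ∀ x (hx : x ∈ π.support), L x = K x hx := fun x hx => dif_pos hx
  refine ⟨π.bind L, ?_, ?_, ?_⟩
  · rw [map_bind, bind_map]
    exact bind_congr_support _ fun x hx => by rw [hL x hx, h1 x hx]; rfl
  · rw [map_bind, bind_map]
    exact bind_congr_support _ fun x hx => by rw [hL x hx, h2 x hx]; rfl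
  · intro y hy
    rw [mem_support_bind_iff] at hy
    obtain ⟨x, hx, hy⟩ := hy
    rw [hL x hx] at hy
    exact h3 x hx y hy

theorem Coupled.mono {R R' : α → β → Prop} {μ : PMF α} {ν : PMF β} (h : Coupled R μ ν)
    (hR : ∀ a ∈ μ.support, ∀ b ∈ ν.support, R a b → R' a b) : Coupled R' μ ν := by
  have := h.bind (R' := R') (f := PMF.pure) (g := PMF.pure)
    fun a ha b hb hab => Coupled.pure (hR a ha b hb hab)
  simpa using this

theorem Coupled.exists_left {R : α → β → Prop} {μ : PMF α} {ν : PMF β} (h : Coupled R μ ν)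
    {b : β} (hb : b ∈ ν.support) : ∃ a ∈ μ.support, R a b := by
  obtain ⟨π, rfl, rfl, hR⟩ := h
  obtain ⟨x, hx, rfl⟩ := (mem_support_map_iff _ _ _).1 hb
  exact ⟨x.1, (mem_support_map_iff _ _ _).2 ⟨x, hx, rfl⟩, hR x hx⟩

/-- Expectation. -/
def ev (μ : PMF α) (f : α → ℝ≥0∞) : ℝ≥0∞ := ∑' a, μ a * f a

@[simp] theorem ev_pure (a : α) (f : α → ℝ≥0∞) : ev (PMF.pure a) f = f a := by
  classical
  rw [ev, tsum_eq_single a]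
  · simp
  · intro b hb
    simp [pure_apply, hb]

theorem ev_bind (μ : PMF α) (k : α → PMF β) (f : β → ℝ≥0∞) :
    ev (μ.bind k) f = ev μ fun a => ev (k a) f := by
  simp only [ev, bind_apply, ← ENNReal.tsum_mul_right, ← ENNReal.tsum_mul_left]
  rw [ENNReal.tsum_comm]
  simp only [mul_assoc]

theorem ev_map (μ : PMF α) (k : α → β) (f : β → ℝ≥0∞) : ev (μ.map k) f = ev μ fun a => f (k a) := by
  rw [PMF.map, ev_bind]
  simp

theorem ev_congr {μ : PMF α} {f g : α → ℝ≥0∞} (h : ∀ a ∈ μ.support, f a = g a) :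
    ev μ f = ev μ g := by
  refine tsum_congr fun a => ?_
  by_cases ha : μ a = 0
  · simp [ha]
  · rw [h a ((μ.mem_support_iff a).2 ha)]

theorem ev_const (μ : PMF α) (x : ℝ≥0∞) : ev μ (fun _ => x) = x := by
  rw [ev, ENNReal.tsum_mul_right, μ.tsum_coe, one_mul]

theorem ev_mul_left (μ : PMF α) (x : ℝ≥0∞) (f : α → ℝ≥0∞) :
    ev μ (fun a => x * f a) = x * ev μ f := by
  rw [ev, ev, ← ENNReal.tsum_mul_left]
  exact tsum_congr fun a => by ring

theorem ev_add (μ : PMF α) (f g : α → ℝ≥0∞) :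
    ev μ (fun a => f a + g a) = ev μ f + ev μ g := by
  rw [ev, ev, ev, ← ENNReal.tsum_add]
  exact tsum_congr fun a => by ring

theorem ev_mono {μ : PMF α} {f g : α → ℝ≥0∞} (h : ∀ a ∈ μ.support, f a ≤ g a) :
    ev μ f ≤ ev μ g := by
  refine ENNReal.tsum_le_tsum fun a => ?_
  by_cases ha : μ a = 0
  · simp [ha]
  · exact mul_le_mul_right (h a ((μ.mem_support_iff a).2 ha)) _

theorem ev_comm (μ : PMF α) (ν : PMF β) (f : α → β → ℝ≥0∞) :
    ev μ (fun a => ev ν (f a)) = ev ν fun b => ev μ fun a => f a b := by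
  simp only [ev, ← ENNReal.tsum_mul_left]
  rw [ENNReal.tsum_comm]
  exact tsum_congr fun a => tsum_congr fun b => by ring

theorem ev_bool (μ : PMF Bool) (f : Bool → ℝ≥0∞) :
    ev μ f = μ true * f true + μ false * f false := by
  rw [ev, tsum_fintype]
  simp

theorem apply_eq_ev [DecidableEq α] (μ : PMF α) (a : α) :
    μ a = ev μ fun x => if x = a then 1 else 0 := by
  rw [ev, tsum_eq_single a]
  · simp
  · intro b hb
    simp [hb]

theorem map_true_eq_ev (μ : PMF α) (f : α → Bool) :
    μ.map f true = ev μ fun x => if f x then 1 else 0 := by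
  rw [apply_eq_ev, ev_map]

theorem uniformOfFintype_map_equiv {α β : Type} [Fintype α] [Nonempty α] [Fintype β] [Nonempty β]
    (e : α ≃ β) : (uniformOfFintype α).map e = uniformOfFintype β := by
  classical
  ext b
  rw [map_apply, tsum_eq_single (e.symm b)]
  · simp [Fintype.card_congr e]
  · intro a ha
    rw [if_neg]
    rintro rfl
    simp at ha

end PMF

/-! ## Laws of computations -/

namespace Comp

variable {O α β σ : Type}

/-- The law of the result, the calls being answered independently with the laws `h`. -/
def law (h : O → Val → PMF Val) : Comp O α → PMF α
  | ret a => PMF.pure a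
  | rand n c => (PMF.uniformOfFintype (Fin (n + 1))).bind fun i => (c i).law h
  | call o q c => (h o q).bind fun y => (c y).law h

theorem law_bind (h : O → Val → PMF Val) (c : Comp O α) (f : α → Comp O β) :
    (c.bind f).law h = (c.law h).bind fun a => (f a).law h := by
  induction c with
  | ret a => simp [bind, law]
  | rand n c ih => simp [bind, law, ih]
  | call o q c ih => simp [bind, law, ih]

theorem run_bind (h : O → Val → σ → PMF (Val × σ)) (c : Comp O α) (f : α → Comp O β) (s : σ) :
    (c.bind f).run h s = (c.run h s).bind fun y => (f y.1).run h y.2 := by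
  induction c generalizing s with
  | ret a => simp [bind, run]
  | rand n c ih => simp [bind, run, ih]
  | call o q c ih => simp [bind, run, ih]

theorem run_map_fst {h : O → Val → Unit → PMF (Val × Unit)} {h' : O → Val → PMF Val}
    (hh : ∀ o q, h o q () = (h' o q).map fun v => (v, ())) (c : Comp O α) :
    (c.run h ()).map Prod.fst = c.law h' := by
  induction c with
  | ret a => simp [run, law, PMF.pure_map]
  | rand n c ih => simp only [run, law, PMF.map_bind, ih]
  | call o q c ih =>
    simp only [run, law, PMF.map_bind, hh, PMF.bind_map]
    congr 1
    funext v
    exact ih v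

/-- Every admissible answer has positive probability under `h`, so no run escapes the support of the
law. This leads from laws back to the worst-case statements about running time. -/
theorem always_of_law {ok : O → Val → Val → Prop} {post : α → Prop} {h : O → Val → PMF Val}
    (hok : ∀ o q a, ok o q a → a ∈ (h o q).support) (log : List (O × Val)) (c : Comp O α)
    (hc : ∀ a ∈ (c.law h).support, post a) : c.Always ok (fun _ => post) log := by
  induction c generalizing log with
  | ret a => exact hc a (by simp [law])
  | rand n c ih =>
    intro i
    refine ih i _ fun a ha => hc a ?_
    rw [law, PMF.mem_support_bind_iff]
    exact ⟨i, by simp, ha⟩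
  | call o q c ih =>
    intro v hv
    refine ih v _ fun a ha => hc a ?_
    rw [law, PMF.mem_support_bind_iff]
    exact ⟨v, hok o q v hv, ha⟩

/-- Guarantees of the adversary carry over to any stateful oracles, provided an invariant of the
state keeps the answers admissible. -/
theorem post_of_always {ok : O → Val → Val → Prop} {post : List (O × Val) → α → Prop}
    {h : O → Val → σ → PMF (Val × σ)} {Inv : σ → Prop}
    (hInv : ∀ o q s, Inv s → ∀ y ∈ (h o q s).support, ok o q y.1 ∧ Inv y.2) (log : List (O × Val))
    (c : Comp O α) (hc : c.Always ok post log) (s : σ) (hs : Inv s) :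
    ∀ y ∈ (c.run h s).support, ∃ log', post log' y.1 := by
  induction c generalizing log s with
  | ret a =>
    intro y hy
    rw [run, PMF.support_pure, Set.mem_singleton_iff] at hy
    subst hy
    exact ⟨log, hc⟩
  | rand n c ih =>
    intro y hy
    rw [run, PMF.mem_support_bind_iff] at hy
    obtain ⟨i, -, hy⟩ := hy
    exact ih i log (hc i) s hs y hy
  | call o q c ih =>
    intro y hy
    rw [run, PMF.mem_support_bind_iff] at hy
    obtain ⟨z, hz, hy⟩ := hy
    obtain ⟨h1, h2⟩ := hInv o q s hs z hz
    exact ih z.1 _ (hc z.1 h1) z.2 h2 y hy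

theorem law_post_of_always {ok : O → Val → Val → Prop} {post : List (O × Val) → α → Prop}
    {h : O → Val → PMF Val} (hok : ∀ o q, ∀ a ∈ (h o q).support, ok o q a) (log : List (O × Val))
    (c : Comp O α) (hc : c.Always ok post log) : ∀ y ∈ (c.law h).support, ∃ log', post log' y := by
  induction c generalizing log with
  | ret a =>
    intro y hy
    rw [law, PMF.support_pure, Set.mem_singleton_iff] at hy
    subst hy
    exact ⟨log, hc⟩
  | rand n c ih =>
    intro y hy
    rw [law, PMF.mem_support_bind_iff] at hy
    obtain ⟨i, -, hy⟩ := hy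
    exact ih i log (hc i) y hy
  | call o q c ih =>
    intro y hy
    rw [law, PMF.mem_support_bind_iff] at hy
    obtain ⟨z, hz, hy⟩ := hy
    exact ih z _ (hc z (hok o q z hz)) y hy

/-- Admissible answers always exist, so each partial log is a prefix of a complete one. Rules that
are imposed at the end of a run thereby restrict the run at every moment. -/
theorem exists_post_of_always {ok : O → Val → Val → Prop} {post : List (O × Val) → α → Prop}
    (hok : ∀ o q, ∃ a, ok o q a) (log : List (O × Val)) (c : Comp O α)
    (hc : c.Always ok post log) : ∃ l a, post (log ++ l) a := by
  induction c generalizing log with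
  | ret a => exact ⟨[], a, by simpa [Always] using hc⟩
  | rand n c ih => exact ih 0 log (hc 0)
  | call o q c ih =>
    obtain ⟨a, ha⟩ := hok o q
    obtain ⟨l, b, hb⟩ := ih a _ (hc a ha)
    exact ⟨(o, q) :: l, b, by simpa using hb⟩

end Comp

/-! ## Laws of program runs -/

theorem PMF.Coupled.pure_left {α β : Type} {R : α → β → Prop} {a : α} {ν : PMF β}
    (h : ∀ b ∈ ν.support, R a b) : PMF.Coupled R (PMF.pure a) ν := by
  refine ⟨ν.map fun b => (a, b), ?_, ?_, ?_⟩
  · rw [PMF.map_comp]; exact PMF.map_const ν a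
  · rw [PMF.map_comp]; exact PMF.map_id ν
  · intro x hx
    rw [PMF.mem_support_map_iff] at hx
    obtain ⟨b, hb, rfl⟩ := hx
    exact h b hb

/-- Continue with `f` unless the time has run out. -/
def optBind {α : Type} (f : Val → ℕ → PMF (Option α)) : Option (Val × ℕ) → PMF (Option α)
  | none => PMF.pure none
  | some (w, t) => f w t

/-- The law of a run of `p`. -/
def Prog.exec {O : Type} (h : O → Val → PMF Val) (p : Prog O) (v : Val) (t : ℕ) :
    PMF (Option (Val × ℕ)) := (p.eval v t).law h

section exec

variable {O : Type} {h : O → Val → PMF Val}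

theorem Exec.law_andThen (x : Comp O (Option (Val × ℕ))) (f : Exec O) :
    (Exec.andThen x f).law h = (x.law h).bind (optBind fun w t => (f w t).law h) := by
  rw [Exec.andThen, Comp.law_bind]
  congr 1
  funext y
  rcases y with _ | ⟨w, t⟩ <;> rfl

theorem Exec.law_atom_succ (f : Val → Comp O Val) (v : Val) (t : ℕ) :
    (Exec.atom f v (t + 1)).law h = ((f v).law h).map fun w => some (w, t) := by
  rw [Exec.atom, Comp.law_bind]
  rfl

theorem mem_support_optBind {α : Type} {μ : PMF (Option (Val × ℕ))} {f : Val → ℕ → PMF (Option α)}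
    {y : α} (hy : some y ∈ (μ.bind (optBind f)).support) :
    ∃ w t, some (w, t) ∈ μ.support ∧ some y ∈ (f w t).support := by
  rw [PMF.mem_support_bind_iff] at hy
  obtain ⟨z, hz, hy⟩ := hy
  rcases z with _ | ⟨w, t⟩
  · simp [optBind] at hy
  · exact ⟨w, t, hz, hy⟩

theorem Exec.loop_lt {c p : Exec O}
    (hc : ∀ v t w t', some (w, t') ∈ ((c v t).law h).support → t' < t)
    (hp : ∀ v t w t', some (w, t') ∈ ((p v t).law h).support → t' < t) (n : ℕ) :
    ∀ v t w t', some (w, t') ∈ ((Exec.loop c p n v t).law h).support → t' < t := by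
  induction n with
  | zero => intro v t w t' hy; simp [Exec.loop, Comp.law] at hy
  | succ n ih =>
    intro v t w t' hy
    rw [Exec.loop, Exec.law_andThen] at hy
    obtain ⟨b, t1, h1, hy⟩ := mem_support_optBind hy
    have h1 := hc _ _ _ _ h1
    cases b with
    | nil =>
      simp only [Comp.law, PMF.support_pure, Set.mem_singleton_iff, Option.some.injEq,
        Prod.mk.injEq] at hy
      omega
    | cons b1 b2 =>
      simp only at hy
      rw [Exec.law_andThen] at hy
      obtain ⟨b, t2, h2, hy⟩ := mem_support_optBind hy
      have h2 := hp _ _ _ _ h2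
      have h3 := ih _ _ _ _ hy
      omega

/-- Even the shortest program executes an atomic instruction. The strict decrease of the time makes
the fuel of loops harmless. -/
theorem Prog.eval_lt (p : Prog O) :
    ∀ v t w t', some (w, t') ∈ ((p.eval v t).law h).support → t' < t := by
  have hatom : ∀ (f : Val → Comp O Val) v t w t',
      some (w, t') ∈ ((Exec.atom f v t).law h).support → t' < t := by
    intro f v t w t' hy
    cases t with
    | zero => simp [Exec.atom, Comp.law] at hy
    | succ t =>
      rw [Exec.law_atom_succ, PMF.mem_support_map_iff] at hy
      obtain ⟨a, -, ha⟩ := hy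
      simp only [Option.some.injEq, Prod.mk.injEq] at ha
      omega
  induction p with
  | nil => exact hatom _
  | id => exact hatom _
  | fst => exact hatom _
  | snd => exact hatom _
  | rand => exact hatom _
  | call o => exact hatom _
  | seq p r ihp ihr =>
    intro v t w t' hy
    rw [Prog.eval, Exec.law_andThen] at hy
    obtain ⟨b, t1, h1, hy⟩ := mem_support_optBind hy
    exact (ihr _ _ _ _ hy).trans (ihp _ _ _ _ h1)
  | pair p r ihp ihr =>
    intro v t w t' hy
    rw [Prog.eval, Exec.law_andThen] at hy
    obtain ⟨b, t1, h1, hy⟩ := mem_support_optBind hy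
    rw [Exec.law_andThen] at hy
    obtain ⟨b, t2, h2, hy⟩ := mem_support_optBind hy
    simp only [Comp.law, PMF.support_pure, Set.mem_singleton_iff, Option.some.injEq,
      Prod.mk.injEq] at hy
    have := ihp _ _ _ _ h1
    have := ihr _ _ _ _ h2
    omega
  | ite c p r ihc ihp ihr =>
    intro v t w t' hy
    rw [Prog.eval, Exec.law_andThen] at hy
    obtain ⟨b, t1, h1, hy⟩ := mem_support_optBind hy
    replace h1 := ihc _ _ _ _ h1
    cases b with
    | nil => exact (ihr _ _ _ _ hy).trans h1
    | cons b1 b2 => exact (ihp _ _ _ _ hy).trans h1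
  | loop c p ihc ihp => exact fun v t => Exec.loop_lt ihc ihp t v t

theorem Exec.loop_fuel {c p : Exec O}
    (hc : ∀ v t w t', some (w, t') ∈ ((c v t).law h).support → t' < t)
    (hp : ∀ v t w t', some (w, t') ∈ ((p v t).law h).support → t' < t) (n : ℕ) :
    ∀ v t, t ≤ n → (Exec.loop c p (n + 1) v t).law h = (Exec.loop c p n v t).law h := by
  induction n with
  | zero =>
    intro v t ht
    obtain rfl : t = 0 := by omega
    -- With no time left the test cannot halt, so the extra round fails just as the loop without
    -- fuel does.
    rw [Exec.loop.eq_2, Exec.law_andThen]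
    refine (PMF.bind_congr_support _ (g := fun _ => PMF.pure none) fun y hy => ?_).trans ?_
    · rcases y with _ | ⟨w, t⟩
      · rfl
      · exact absurd (hc _ _ _ _ hy) (by omega)
    · rw [PMF.bind_const]; rfl
  | succ n ih =>
    intro v t ht
    rw [Exec.loop, Exec.loop, Exec.law_andThen, Exec.law_andThen]
    refine PMF.bind_congr_support _ fun y hy => ?_
    rcases y with _ | ⟨w, t1⟩
    · rfl
    · have h1 := hc _ _ _ _ hy
      cases w with
      | nil => rfl
      | cons w1 w2 =>
        simp only [optBind]
        rw [Exec.law_andThen, Exec.law_andThen]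
        refine PMF.bind_congr_support _ fun y hy => ?_
        rcases y with _ | ⟨w, t2⟩
        · rfl
        · have h2 := hp _ _ _ _ hy
          exact ih w t2 (by omega)

theorem Exec.loop_fuel_le {c p : Exec O}
    (hc : ∀ v t w t', some (w, t') ∈ ((c v t).law h).support → t' < t)
    (hp : ∀ v t w t', some (w, t') ∈ ((p v t).law h).support → t' < t) {n t : ℕ} (ht : t ≤ n)
    (v : Val) : (Exec.loop c p n v t).law h = (Exec.loop c p t v t).law h := by
  induction n, ht using Nat.le_induction with
  | base => rfl
  | succ n hn ih => rw [Exec.loop_fuel hc hp n v t hn, ih]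

namespace Prog

theorem exec_seq (p r : Prog O) (v : Val) (t : ℕ) :
    (seq p r).exec h v t = (p.exec h v t).bind (optBind (r.exec h)) :=
  Exec.law_andThen _ _

theorem exec_pair (p r : Prog O) (v : Val) (t : ℕ) :
    (pair p r).exec h v t = (p.exec h v t).bind (optBind fun a t' =>
      (r.exec h v t').bind (optBind fun b t'' => PMF.pure (some (.cons a b, t'')))) := by
  rw [exec, eval, Exec.law_andThen]
  congr 1
  congr 1
  funext a t'
  rw [Exec.law_andThen]
  rfl

theorem exec_ite (c p r : Prog O) (v : Val) (t : ℕ) :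
    (ite c p r).exec h v t = (c.exec h v t).bind (optBind fun b t' =>
      match b with
      | .nil => r.exec h v t'
      | .cons _ _ => p.exec h v t') := by
  rw [exec, eval, Exec.law_andThen]
  congr 1
  congr 1
  funext b t'
  cases b <;> rfl

/-- The unrolling equation no longer mentions fuel. One extra unit of fuel exposes the first round,
and the surplus fuel of the remaining loop is removed because time has passed. -/
theorem exec_loop (c p : Prog O) (v : Val) (t : ℕ) :
    (loop c p).exec h v t = (c.exec h v t).bind (optBind fun b t' =>
      match b with
      | .nil => PMF.pure (some (v, t'))
      | .cons _ _ => (p.exec h v t').bind (optBind ((loop c p).exec h))) := by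
  rw [exec, eval]
  have hc := c.eval_lt (h := h)
  have hp := p.eval_lt (h := h)
  rw [← Exec.loop_fuel hc hp t v t le_rfl, Exec.loop, Exec.law_andThen]
  refine PMF.bind_congr_support _ fun y hy => ?_
  rcases y with _ | ⟨w, t1⟩
  · rfl
  · have h1 := hc _ _ _ _ hy
    cases w with
    | nil => rfl
    | cons w1 w2 =>
      simp only [optBind]
      rw [Exec.law_andThen]
      refine PMF.bind_congr_support _ fun y hy => ?_
      rcases y with _ | ⟨w, t2⟩
      · rfl
      · have h2 := hp _ _ _ _ hy
        exact Exec.loop_fuel_le hc hp (by omega) w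

end Prog

/-! ### Monotonicity in the available time -/

/-- With more time, a run that halts has the same result. -/
def MoreTime (d : ℕ) (y z : Option (Val × ℕ)) : Prop :=
  ∀ w t, y = some (w, t) → z = some (w, t + d)

theorem MoreTime.optBind {d : ℕ} {μ ν : PMF (Option (Val × ℕ))}
    {f g : Val → ℕ → PMF (Option (Val × ℕ))} (hμ : PMF.Coupled (MoreTime d) μ ν)
    (hf : ∀ w t, PMF.Coupled (MoreTime d) (f w t) (g w (t + d))) :
    PMF.Coupled (MoreTime d) (μ.bind (_root_.optBind f)) (ν.bind (_root_.optBind g)) := by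
  refine hμ.bind fun y _ z _ hyz => ?_
  rcases y with _ | ⟨w, t⟩
  · exact PMF.Coupled.pure_left fun b _ w t hw => by simp at hw
  · rw [hyz w t rfl]
    exact hf w t

theorem Exec.loop_moreTime {c p : Exec O} {d : ℕ}
    (hc : ∀ v t, PMF.Coupled (MoreTime d) ((c v t).law h) ((c v (t + d)).law h))
    (hp : ∀ v t, PMF.Coupled (MoreTime d) ((p v t).law h) ((p v (t + d)).law h)) (n n' : ℕ)
    (hn : n ≤ n') (v : Val) (t : ℕ) : PMF.Coupled (MoreTime d) ((Exec.loop c p n v t).law h)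
      ((Exec.loop c p n' v (t + d)).law h) := by
  induction n generalizing n' v t with
  | zero => exact PMF.Coupled.pure_left fun b _ w t hw => by simp at hw
  | succ n ih =>
    obtain ⟨n', rfl⟩ : ∃ m, n' = m + 1 := ⟨n' - 1, by omega⟩
    rw [Exec.loop, Exec.loop, Exec.law_andThen, Exec.law_andThen]
    refine MoreTime.optBind (hc v t) fun w t => ?_
    cases w with
    | nil => exact PMF.Coupled.pure fun w t hw => by simp_all
    | cons w1 w2 =>
      simp only
      rw [Exec.law_andThen, Exec.law_andThen]
      exact MoreTime.optBind (hp v t) fun w t => ih n' (by omega) w t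

theorem Prog.exec_moreTime (p : Prog O) (d : ℕ) (v : Val) (t : ℕ) :
    PMF.Coupled (MoreTime d) (p.exec h v t) (p.exec h v (t + d)) := by
  have hatom : ∀ (f : Val → Comp O Val) v t, PMF.Coupled (MoreTime d)
      ((Exec.atom f v t).law h) ((Exec.atom f v (t + d)).law h) := by
    intro f v t
    cases t with
    | zero => exact PMF.Coupled.pure_left fun b _ w t hw => by simp at hw
    | succ t =>
      rw [show t + 1 + d = (t + d) + 1 by omega, Exec.law_atom_succ, Exec.law_atom_succ]
      refine (PMF.Coupled.refl (R := fun a b => a = b) _ fun _ _ => rfl).bind fun a _ b _ hab => ?_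
      subst hab
      exact PMF.Coupled.pure fun w t hw => by simp_all
  induction p generalizing v t with
  | nil => exact hatom _ _ _
  | id => exact hatom _ _ _
  | fst => exact hatom _ _ _
  | snd => exact hatom _ _ _
  | rand => exact hatom _ _ _
  | call o => exact hatom _ _ _
  | seq p r ihp ihr =>
    rw [exec_seq, exec_seq]
    exact MoreTime.optBind (ihp v t) ihr
  | pair p r ihp ihr =>
    rw [exec_pair, exec_pair]
    refine MoreTime.optBind (ihp v t) fun w t => MoreTime.optBind (ihr v t) fun w' t => ?_
    exact PMF.Coupled.pure fun w t hw => by simp_all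
  | ite c p r ihc ihp ihr =>
    rw [exec_ite, exec_ite]
    refine MoreTime.optBind (ihc v t) fun w t => ?_
    cases w with
    | nil => exact ihr _ _
    | cons w1 w2 => exact ihp _ _
  | loop c p ihc ihp => exact Exec.loop_moreTime ihc ihp t (t + d) (by omega) v t

/-! ## Program specifications -/

/-- On input `v`, the program `p` halts within time `n`, and its output has the law `μ`. -/
def Sem (h : O → Val → PMF Val) (p : Prog O) (v : Val) (n : ℕ) (μ : PMF Val) : Prop :=
  ∀ t, n ≤ t → PMF.Coupled (fun w y => ∃ t', y = some (w, t') ∧ t ≤ t' + n) μ (p.exec h v t)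

namespace Sem

variable {p r c : Prog O} {v w : Val} {n m l : ℕ} {μ ν : PMF Val}

theorem mono (hp : Sem h p v n μ) (hn : n ≤ m) : Sem h p v m μ := fun t ht =>
  (hp t (hn.trans ht)).mono fun w _ y _ ⟨t', h1, h2⟩ => ⟨t', h1, by omega⟩

theorem congr (hp : Sem h p v n μ) (hμ : μ = ν) : Sem h p v n ν := hμ ▸ hp

theorem of_atom {f : Val → Comp O Val} (hp : p.eval = Exec.atom f) :
    Sem h p v 1 ((f v).law h) := by
  intro t ht
  obtain ⟨t, rfl⟩ : ∃ s, t = s + 1 := ⟨t - 1, by omega⟩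
  rw [Prog.exec, hp, Exec.law_atom_succ]
  have := (PMF.Coupled.refl (R := fun a b => a = b) ((f v).law h) fun _ _ => rfl).bind
    (R' := fun w y => ∃ t', y = some (w, t') ∧ t + 1 ≤ t' + 1) (f := PMF.pure)
    (g := fun w => PMF.pure (some (w, t))) fun a _ b _ hab => by
      subst hab
      exact PMF.Coupled.pure ⟨t, rfl, le_rfl⟩
  rwa [PMF.bind_pure] at this

theorem nil : Sem h (.nil : Prog O) v 1 (PMF.pure .nil) :=
  of_atom (f := fun _ => .ret .nil) rfl
theorem id : Sem h (.id : Prog O) v 1 (PMF.pure v) :=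
  of_atom (f := fun v => .ret v) rfl
theorem fst : Sem h (.fst : Prog O) v 1 (PMF.pure v.fst) :=
  of_atom (f := fun v => .ret v.fst) rfl
theorem snd : Sem h (.snd : Prog O) v 1 (PMF.pure v.snd) :=
  of_atom (f := fun v => .ret v.snd) rfl
theorem rand : Sem h (.rand : Prog O) v 1
    ((PMF.uniformOfFintype (Fin (v.toNat + 1))).map fun i : Fin _ => Val.ofNat (i : ℕ)) :=
  of_atom (f := fun v => .rand v.toNat fun i => .ret (Val.ofNat i)) rfl
theorem call (o : O) : Sem h (.call o : Prog O) v 1 (h o v) :=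
  (of_atom (f := fun v => .call o v .ret) rfl).congr (by simp only [Comp.law]; exact PMF.bind_pure _)

theorem seq {κ : Val → PMF Val} (hp : Sem h p v n μ)
    (hr : ∀ w ∈ μ.support, Sem h r w m (κ w)) : Sem h (.seq p r) v (n + m) (μ.bind κ) := by
  intro t ht
  rw [Prog.exec_seq]
  refine (hp t (by omega)).bind fun w hw y _ ⟨t', h1, h2⟩ => ?_
  subst h1
  exact (hr w hw t' (by omega)).mono fun w _ y _ ⟨t', h1, h2⟩ => ⟨t', h1, by omega⟩

theorem pair (hp : Sem h p v n μ) (hr : Sem h r v m ν) :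
    Sem h (.pair p r) v (n + m) (μ.bind fun a => ν.map fun b => .cons a b) := by
  intro t ht
  rw [Prog.exec_pair]
  refine (hp t (by omega)).bind fun a _ y _ ⟨t', h1, h2⟩ => ?_
  subst h1
  refine (hr t' (by omega)).bind fun b _ y _ ⟨t'', h1, h3⟩ => ?_
  subst h1
  exact PMF.Coupled.pure ⟨t'', rfl, by omega⟩

theorem ite {κ : Val → PMF Val} (hc : Sem h c v n μ)
    (hr : Val.nil ∈ μ.support → Sem h r v m (κ .nil))
    (hp : ∀ a b, Val.cons a b ∈ μ.support → Sem h p v m (κ (.cons a b))) :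
    Sem h (.ite c p r) v (n + m) (μ.bind κ) := by
  intro t ht
  rw [Prog.exec_ite]
  refine (hc t (by omega)).bind fun w hw y _ ⟨t', h1, h2⟩ => ?_
  subst h1
  cases w with
  | nil => exact (hr hw t' (by omega)).mono fun w _ y _ ⟨t', h1, h2⟩ => ⟨t', h1, by omega⟩
  | cons a b => exact (hp a b hw t' (by omega)).mono fun w _ y _ ⟨t', h1, h2⟩ => ⟨t', h1, by omega⟩

theorem loop_done (hc : Sem h c v n (PMF.pure .nil)) : Sem h (.loop c p) v n (PMF.pure v) := by
  intro t ht
  rw [Prog.exec_loop, ← PMF.pure_bind (Val.nil) (fun _ => PMF.pure v)]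
  refine (hc t (by omega)).bind fun w hw y _ ⟨t', h1, h2⟩ => ?_
  simp only [PMF.support_pure, Set.mem_singleton_iff] at hw
  subst h1 hw
  exact PMF.Coupled.pure ⟨t', rfl, by omega⟩

theorem loop_step {a b : Val} {κ : Val → PMF Val} (hc : Sem h c v n (PMF.pure (.cons a b)))
    (hp : Sem h p v m μ) (hl : ∀ w ∈ μ.support, Sem h (.loop c p) w l (κ w)) :
    Sem h (.loop c p) v (n + m + l) (μ.bind κ) := by
  intro t ht
  rw [Prog.exec_loop, ← PMF.pure_bind (Val.cons a b) (fun _ => μ.bind κ)]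
  refine (hc t (by omega)).bind fun w hw y _ ⟨t', h1, h2⟩ => ?_
  simp only [PMF.support_pure, Set.mem_singleton_iff] at hw
  subst h1 hw
  refine (hp t' (by omega)).bind fun w hw y _ ⟨t'', h1, h3⟩ => ?_
  subst h1
  exact (hl w hw t'' (by omega)).mono fun w _ y _ ⟨t', h1, h2⟩ => ⟨t', h1, by omega⟩

theorem seq' {w : Val} (hp : Sem h p v n (PMF.pure w)) (hr : Sem h r w m μ) :
    Sem h (.seq p r) v (n + m) μ := by
  refine (hp.seq (κ := fun _ => μ) (m := m) fun w' hw => ?_).congr (PMF.pure_bind _ _)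
  simp only [PMF.support_pure, Set.mem_singleton_iff] at hw
  exact hw ▸ hr

theorem pair' {a b : Val} (hp : Sem h p v n (PMF.pure a)) (hr : Sem h r v m (PMF.pure b)) :
    Sem h (.pair p r) v (n + m) (PMF.pure (.cons a b)) :=
  (hp.pair hr).congr (by simp [PMF.pure_map])

theorem ite_nil (hc : Sem h c v n (PMF.pure .nil)) (hr : Sem h r v m μ) :
    Sem h (.ite c p r) v (n + m) μ := by
  refine (hc.ite (κ := fun _ => μ) (m := m) (fun _ => hr) fun a b hab => ?_).congr
    (PMF.pure_bind _ _)
  simp at hab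

theorem ite_cons {a b : Val} (hc : Sem h c v n (PMF.pure (.cons a b))) (hp : Sem h p v m μ) :
    Sem h (.ite c p r) v (n + m) μ := by
  refine (hc.ite (κ := fun _ => μ) (m := m) (fun hn => ?_) fun a b _ => hp).congr
    (PMF.pure_bind _ _)
  simp at hn

theorem loop_step' {a b : Val} (hc : Sem h c v n (PMF.pure (.cons a b)))
    (hp : Sem h p v m (PMF.pure w)) (hl : Sem h (.loop c p) w l μ) :
    Sem h (.loop c p) v (n + m + l) μ := by
  refine (hc.loop_step hp (κ := fun _ => μ) (l := l) fun w' hw => ?_).congr (PMF.pure_bind _ _)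
  simp only [PMF.support_pure, Set.mem_singleton_iff] at hw
  exact hw ▸ hl

/-- `Prog.Computes` speaks of a single time budget and `Sem` of all larger ones; the coupling of
runs with different budgets bridges the two. -/
theorem of_computes {p : Prog Empty} (hp : p.Computes v w n) (h : Empty → Val → PMF Val) :
    Sem h p v n (PMF.pure w) := by
  intro t ht
  obtain ⟨d, rfl⟩ := Nat.exists_eq_add_of_le ht
  refine PMF.Coupled.pure_left fun z hz => ?_
  obtain ⟨y, hy, hyz⟩ := (p.exec_moreTime (h := h) d v n).exists_left hz
  obtain ⟨log, t', rfl⟩ := Comp.law_post_of_always (h := h) (fun o => o.elim) [] _ hp y hy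
  exact ⟨t' + d, hyz w t' rfl, by omega⟩

end Sem

end exec

/-! ## Programs without calls -/

namespace Prog

/-- A program without oracles, as a program with oracles. -/
def lift {O : Type} : Prog Empty → Prog O
  | nil => nil
  | id => id
  | fst => fst
  | snd => snd
  | rand => rand
  | call o => o.elim
  | seq p r => seq p.lift r.lift
  | pair p r => pair p.lift r.lift
  | ite c p r => ite c.lift p.lift r.lift
  | loop c p => loop c.lift p.lift

theorem law_eval_lift {O : Type} (h : O → Val → PMF Val) (h' : Empty → Val → PMF Val)
    (p : Prog Empty) (v : Val) (t : ℕ) :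
    ((lift p : Prog O).eval v t).law h = (p.eval v t).law h' := by
  have hatom : ∀ (f : Val → Comp O Val) (f' : Val → Comp Empty Val) v t,
      (f v).law h = (f' v).law h' → (Exec.atom f v t).law h = (Exec.atom f' v t).law h' := by
    intro f f' v t hf
    cases t with
    | zero => rfl
    | succ t => rw [Exec.law_atom_succ, Exec.law_atom_succ, hf]
  induction p generalizing v t with
  | nil => exact hatom _ _ _ _ rfl
  | id => exact hatom _ _ _ _ rfl
  | fst => exact hatom _ _ _ _ rfl
  | snd => exact hatom _ _ _ _ rfl
  | rand => exact hatom _ _ _ _ rfl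
  | call o => exact o.elim
  | seq p r ihp ihr =>
    simp only [lift, eval, Exec.law_andThen, ihp, ihr]
  | pair p r ihp ihr =>
    simp only [lift, eval, Exec.law_andThen, ihp, ihr, Comp.law]
  | ite c p r ihc ihp ihr =>
    simp only [lift, eval, Exec.law_andThen, ihc]
    congr 1
    congr 1
    funext b t
    cases b with
    | nil => exact ihr _ _
    | cons b1 b2 => exact ihp _ _
  | loop c p ihc ihp =>
    simp only [lift, eval]
    suffices ∀ n v t, (Exec.loop c.lift.eval p.lift.eval n v t).law h =
        (Exec.loop c.eval p.eval n v t).law h' from this t v t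
    intro n
    induction n with
    | zero => intros; rfl
    | succ n ih =>
      intro v t
      simp only [Exec.loop, Exec.law_andThen, ihc]
      congr 1
      congr 1
      funext b t
      cases b with
      | nil => rfl
      | cons b1 b2 =>
        simp only [Exec.law_andThen, ihp]
        congr 1
        congr 1
        funext w t
        exact ih _ _

end Prog

theorem Sem.lift {O : Type} {h : O → Val → PMF Val} {h' : Empty → Val → PMF Val} {p : Prog Empty}
    {v : Val} {n : ℕ} {μ : PMF Val} (hp : Sem h' p v n μ) : Sem h (p.lift : Prog O) v n μ := by
  intro t ht
  rw [Prog.exec, Prog.law_eval_lift h h' p v t]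
  exact hp t ht

/-- The straight-line programs. -/
def Prog.straight {O : Type} : Prog O → Bool
  | .nil => true
  | .id => true
  | .fst => true
  | .snd => true
  | .seq p r => p.straight && r.straight
  | .pair p r => p.straight && r.straight
  | _ => false

/-- The function that a straight-line program computes. -/
def Prog.den {O : Type} : Prog O → Val → Val
  | .nil, _ => .nil
  | .fst, v => v.fst
  | .snd, v => v.snd
  | .seq p r, v => r.den (p.den v)
  | .pair p r, v => .cons (p.den v) (r.den v)
  | _, v => v

/-- The number of the atomic instructions in a straight-line program. -/
def Prog.cost {O : Type} : Prog O → ℕ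
  | .seq p r => p.cost + r.cost
  | .pair p r => p.cost + r.cost
  | _ => 1

/-- Instructions that only rearrange trees can be evaluated definitionally, so that later
specifications of such code are closed by `rfl`. -/
theorem Sem.straight {O : Type} {h : O → Val → PMF Val} {p : Prog O} (v : Val)
    (hp : p.straight = true) : Sem h p v p.cost (PMF.pure (p.den v)) := by
  induction p generalizing v with
  | nil => exact Sem.nil
  | id => exact Sem.id
  | fst => exact Sem.fst
  | snd => exact Sem.snd
  | seq p r ihp ihr =>
    rw [Prog.straight, Bool.and_eq_true] at hp
    exact (ihp v hp.1).seq' (ihr _ hp.2)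
  | pair p r ihp ihr =>
    rw [Prog.straight, Bool.and_eq_true] at hp
    exact (ihp v hp.1).pair' (ihr v hp.2)
  | rand => simp [Prog.straight] at hp
  | call o => simp [Prog.straight] at hp
  | ite c p r => simp [Prog.straight] at hp
  | loop c p => simp [Prog.straight] at hp

/-! ## Subroutines -/

namespace Val

theorem toBits_ofBits (l : List Bool) : (ofBits l).toBits = l := by
  induction l with
  | nil => rfl
  | cons b l ih => cases b <;> simp [ofBits, toBits, ofBool, isCons, ih]

theorem toNat_ofNat (n : ℕ) : (ofNat n).toNat = n := by
  rw [toNat, ofNat, toBits_ofBits]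
  induction n using Nat.binaryRec' with
  | zero => rfl
  | bit b n h ih => rw [Nat.bits_append_bit n b h, List.foldr_cons, ih]

/-- A list of `n` entries. -/
def count : ℕ → Val
  | 0 => nil
  | n + 1 => cons nil (count n)

theorem isCons_ofBool (b : Bool) : (ofBool b).isCons = b := by cases b <;> rfl

end Val

namespace Prog

variable {O : Type}

infixl:65 " ⨾ " => Prog.seq

/-- The constant `true`. -/
def tt : Prog O := .pair .nil .nil

/-- The constant `b`. -/
def bool : Bool → Prog O
  | true => tt
  | false => .nil

/-- Negation. -/
def not (p : Prog O) : Prog O := .ite p .nil tt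

/-- Whether the result of `p` represents `b`. -/
def test : Bool → Prog O → Prog O
  | true, p => p
  | false, p => not p

/-- Replace the leading bits `b ⋯ b b'` with `b' ≠ b` by `b' ⋯ b' b`: increment a binary number if
`b` is `true`, decrement it if `b` is `false`. -/
def carry (b : Bool) : Prog O :=
  .pair .id .nil ⨾ .loop (test b (.fst ⨾ .fst)) (.pair (.fst ⨾ .snd) (.pair .nil .snd)) ⨾
    .pair (.pair (bool b) (.fst ⨾ .snd)) .snd ⨾
    .loop .snd (.pair (.pair (bool !b) .fst) (.snd ⨾ .snd)) ⨾ .fst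

/-- From the unary representation of `n` to the binary representation of `n + 1`. -/
def toBinary : Prog O :=
  .pair .id (.pair tt .nil) ⨾ .loop .fst (.pair (.fst ⨾ .snd) (.snd ⨾ carry true)) ⨾ .snd

/-- Compare two bit strings. -/
def eqBits : Prog O :=
  .loop (.ite .fst (.ite .snd
      (.ite (.fst ⨾ .fst) (.snd ⨾ .fst) (not (.snd ⨾ .fst))) .nil) .nil)
    (.pair (.fst ⨾ .snd) (.snd ⨾ .snd)) ⨾
  .ite .fst .nil (not .snd)

/-- The first entry of a table whose key represents a given bit string; `nil` if there is none. -/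
def lookup : Prog O :=
  .loop (.ite .snd (not (.pair .fst (.snd ⨾ .fst ⨾ .fst) ⨾ eqBits)) .nil)
    (.pair .fst (.snd ⨾ .snd)) ⨾ .snd ⨾ .fst

/-- From `(hd, (x, n))` to `x ^ (n + 1)`, by repeated squaring. -/
def pow (mul : Prog O) : Prog O :=
  .pair (.snd ⨾ .snd) (.pair (.snd ⨾ .fst) (.pair (.snd ⨾ .fst) .fst)) ⨾
  .loop .fst
    (.pair (.fst ⨾ .snd) (.pair
      (.ite (.fst ⨾ .fst)
        (.pair (.snd ⨾ .snd ⨾ .snd) (.pair (.snd ⨾ .fst) (.snd ⨾ .snd ⨾ .fst)) ⨾ mul)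
        (.snd ⨾ .fst))
      (.pair (.pair (.snd ⨾ .snd ⨾ .snd) (.pair (.snd ⨾ .snd ⨾ .fst) (.snd ⨾ .snd ⨾ .fst)) ⨾ mul)
        (.snd ⨾ .snd ⨾ .snd)))) ⨾ .snd ⨾ .fst

end Prog

/-! ### Correctness and running time of the subroutines -/

section

variable {O : Type} {h : O → Val → PMF Val}

namespace Sem

variable {p c r : Prog O} {v w : Val} {n m : ℕ} {μ ν : PMF Val}

/-- The result of a straight-line program. -/
theorem straight' {k : ℕ} (hp : p.straight = true) (hw : p.den v = w) (hk : p.cost.ble k = true) :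
    Sem h p v k (PMF.pure w) := hw ▸ (Sem.straight v hp).mono (Nat.le_of_ble_eq_true hk)

theorem bool (b : Bool) : Sem h (Prog.bool b) v 2 (PMF.pure (Val.ofBool b)) := by
  cases b
  · exact straight' rfl rfl rfl
  · exact straight' rfl rfl rfl

theorem not (hp : Sem h p v n (PMF.pure w)) :
    Sem h p.not v (n + 2) (PMF.pure (Val.ofBool !w.isCons)) := by
  cases w with
  | nil => exact hp.ite_nil (straight' rfl rfl rfl)
  | cons a b => exact hp.ite_cons (straight' rfl rfl rfl)

theorem ite' {k : ℕ} {f : Bool → PMF Val} (hc : Sem h c v n (PMF.pure w))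
    (hp : w.isCons = true → Sem h p v k (f true)) (hr : w.isCons = false → Sem h r v k (f false)) :
    Sem h (.ite c p r) v (n + k) (f w.isCons) := by
  cases w with
  | nil => exact hc.ite_nil (hr rfl)
  | cons a b => exact hc.ite_cons (hp rfl)

/-- The result of `p` is a Boolean, represented by some tree. -/
theorem test (b : Bool) (hp : Sem h p v n (PMF.pure w)) :
    ∃ u : Val, Sem h (Prog.test b p) v (n + 2) (PMF.pure u) ∧ u.isCons = (w.isCons == b) := by
  cases b
  · exact ⟨_, hp.not, by cases w <;> rfl⟩
  · exact ⟨w, hp.mono (by omega), by cases w <;> rfl⟩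

theorem loop_end (hc : Sem h c v n (PMF.pure w)) (hw : w.isCons = false) :
    Sem h (.loop c p) v n (PMF.pure v) := by
  cases w with
  | nil => exact loop_done hc
  | cons a b => simp [Val.isCons] at hw

theorem loop_next {w' : Val} {l : ℕ} (hc : Sem h c v n (PMF.pure w)) (hw : w.isCons = true)
    (hp : Sem h p v m (PMF.pure w')) (hl : Sem h (.loop c p) w' l μ) :
    Sem h (.loop c p) v (n + m + l) μ := by
  cases w with
  | nil => simp [Val.isCons] at hw
  | cons a b => exact loop_step' hc hp hl

end Sem

/-- The effect of `Prog.carry` on bits. -/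
def carryBits (b : Bool) : List Bool → List Bool
  | [] => [b]
  | x :: l => if x = b then (!b) :: carryBits b l else b :: l

theorem carryBits_true (l : List Bool) :
    (carryBits true l).foldr Nat.bit 0 = l.foldr Nat.bit 0 + 1 := by
  induction l with
  | nil => rfl
  | cons x l ih =>
    cases x <;> simp only [carryBits, if_pos, List.foldr_cons, ih, Bool.not_true, reduceCtorEq,
      if_false, Nat.bit_val, Bool.toNat_true, Bool.toNat_false]
    omega

theorem carryBits_false (l : List Bool) (hl : 0 < l.foldr Nat.bit 0) :
    (carryBits false l).foldr Nat.bit 0 + 1 = l.foldr Nat.bit 0 := by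
  induction l with
  | nil => simp at hl
  | cons x l ih =>
    cases x
    · simp only [List.foldr_cons, Nat.bit_val, Bool.toNat_false] at hl
      have := ih (by omega)
      simp only [carryBits, if_pos, List.foldr_cons, Bool.not_false, Nat.bit_val, Bool.toNat_true,
        Bool.toNat_false]
      omega
    · simp [carryBits, Nat.bit_val]

theorem length_carryBits (b : Bool) (l : List Bool) : (carryBits b l).length ≤ l.length + 1 := by
  induction l with
  | nil => simp [carryBits]
  | cons x l ih => by_cases hx : x = b <;> simp [carryBits, hx, ih]

namespace Sem

/-- The bits equal to `b` are traded for entries of a counter that already holds `n`. Positivity is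
needed for `b = false`: both components of `nil` are `nil`, which reads as the bit `false`, so the
scan of an all-zero string would never stop. -/
theorem carry_scan (b : Bool) (v : Val) (n : ℕ) (hv : b = true ∨ 0 < v.toNat) :
    ∃ i v', Sem h (.loop (Prog.test b (.fst ⨾ .fst)) (.pair (.fst ⨾ .snd) (.pair .nil .snd)))
      (.cons v (.count n)) (8 * v.toBits.length + 4) (PMF.pure (.cons v' (.count (n + i)))) ∧
      carryBits b v.toBits = List.replicate i (!b) ++ b :: v'.snd.toBits ∧
      i ≤ v.toBits.length := by
  induction v generalizing n with
  | nil =>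
    obtain rfl : b = true := hv.resolve_right (by simp [Val.toNat, Val.toBits])
    exact ⟨0, .nil, (loop_end (n := 4) (w := .nil) (straight' rfl rfl rfl) rfl).mono (by omega),
      rfl, by simp⟩
  | cons x v _ ih =>
    obtain ⟨u, hu, hu'⟩ := test (h := h) b (p := .fst ⨾ .fst) (v := .cons (.cons x v) (.count n))
      (w := x) (n := 2) (straight' rfl rfl rfl)
    by_cases hx : x.isCons = b
    · have hv' : b = true ∨ 0 < v.toNat := by
        cases b with
        | true => exact Or.inl rfl
        | false => simpa [Val.toNat, Val.toBits, hx, Nat.bit_val] using hv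
      obtain ⟨i, v', h1, h2, h3⟩ := ih (n + 1) hv'
      refine ⟨i + 1, v', ?_, ?_, ?_⟩
      · rw [show n + (i + 1) = n + 1 + i by omega]
        refine (loop_next hu (by simp [hu', hx]) (m := 4) (straight' rfl rfl rfl) h1).mono ?_
        simp only [Val.toBits, List.length_cons]
        omega
      · simp [Val.toBits, carryBits, hx, h2, List.replicate_succ]
      · simpa [Val.toBits] using h3
    · refine ⟨0, .cons x v, ?_, ?_, by simp⟩
      · refine (loop_end hu (by simp [hu', hx])).mono ?_
        omega
      · simp [Val.toBits, carryBits, hx, Val.snd]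

theorem carry_push (b : Bool) (n : ℕ) (v : Val) :
    ∃ w, Sem h (.loop .snd (.pair (.pair (Prog.bool b) .fst) (.snd ⨾ .snd)))
      (.cons v (.count n)) (8 * n + 1) (PMF.pure (.cons w .nil)) ∧
      w.toBits = List.replicate n b ++ v.toBits := by
  induction n generalizing v with
  | zero => exact ⟨v, loop_end (w := .nil) (straight' rfl rfl rfl) rfl, rfl⟩
  | succ n ih =>
    obtain ⟨w, h1, h2⟩ := ih (.cons (.ofBool b) v)
    refine ⟨w, ?_, ?_⟩
    · refine (loop_next (w := .count (n + 1)) (straight' rfl rfl (k := 1) rfl) rfl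
        (((bool b).pair' (straight' (w := v) rfl rfl (k := 1) rfl)).pair'
          (straight' (w := .count n) rfl rfl (k := 2) rfl)) h1).mono ?_
      omega
    · rw [h2, List.replicate_succ', Val.toBits, Val.isCons_ofBool, List.append_assoc]
      rfl

theorem carry (b : Bool) (v : Val) (hv : b = true ∨ 0 < v.toNat) :
    ∃ w, Sem h (Prog.carry b) v (16 * v.toBits.length + 20) (PMF.pure w) ∧
      w.toBits = carryBits b v.toBits := by
  obtain ⟨i, v', h1, h2, h3⟩ := carry_scan (h := h) b v 0 hv
  obtain ⟨w, h4, h5⟩ := carry_push (h := h) (!b) i (.cons (.ofBool b) v'.snd)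
  rw [Nat.zero_add] at h1
  refine ⟨w, ?_, ?_⟩
  · refine (((((straight' (p := .pair .id .nil) (w := .cons v (.count 0)) rfl rfl (k := 2)
      rfl).seq' h1).seq' (((bool b).pair' (straight' (p := .fst ⨾ .snd) (w := v'.snd) rfl rfl (k := 2)
      rfl)).pair' (straight' (p := .snd) (w := .count i) rfl rfl (k := 1) rfl))).seq' h4).seq'
      (straight' (p := .fst) (w := w) rfl rfl (k := 1) rfl)).mono ?_
    omega
  · rw [h5, h2, Val.toBits, Val.isCons_ofBool]

theorem increment (v : Val) : ∃ w, Sem h (Prog.carry true) v (16 * v.toBits.length + 20)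
    (PMF.pure w) ∧ w.toNat = v.toNat + 1 ∧ w.toBits.length ≤ v.toBits.length + 1 := by
  obtain ⟨w, h1, h2⟩ := carry (h := h) true v (Or.inl rfl)
  exact ⟨w, h1, by rw [Val.toNat, h2, carryBits_true]; rfl, h2 ▸ length_carryBits _ _⟩

theorem decrement (v : Val) (hv : 0 < v.toNat) :
    ∃ w, Sem h (Prog.carry false) v (16 * v.toBits.length + 20)
      (PMF.pure w) ∧ w.toNat + 1 = v.toNat ∧ w.toBits.length ≤ v.toBits.length + 1 := by
  obtain ⟨w, h1, h2⟩ := carry (h := h) false v (Or.inr hv)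
  exact ⟨w, h1, by rw [Val.toNat, h2, carryBits_false _ hv]; rfl, h2 ▸ length_carryBits _ _⟩

theorem toBinary_loop (n : ℕ) (v : Val) :
    ∃ w, Sem h (.loop .fst (.pair (.fst ⨾ .snd) (.snd ⨾ Prog.carry true))) (.cons (.unary n) v)
      (n * (16 * (v.toBits.length + n) + 30) + 1) (PMF.pure (.cons .nil w)) ∧
      w.toNat = v.toNat + n := by
  induction n generalizing v with
  | zero => exact ⟨v, (loop_end (n := 1) (w := .nil) (straight' rfl rfl rfl) rfl).mono (by omega),
      rfl⟩
  | succ n ih =>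
    obtain ⟨v', h1, h2, h3⟩ := increment (h := h) v
    obtain ⟨w, h4, h5⟩ := ih v'
    refine ⟨w, ?_, by omega⟩
    refine (loop_next (w := .unary (n + 1)) (straight' rfl rfl (k := 1) rfl) rfl
      ((straight' (w := .unary n) rfl rfl (k := 2) rfl).pair'
        ((straight' (w := v) rfl rfl (k := 1) rfl).seq' h1)) h4).mono ?_
    -- An increment lengthens the number by at most one bit while `n` drops by one, so the cost per
    -- round stays bounded by its initial value.
    have : n * (16 * (v'.toBits.length + n) + 30) ≤ n * (16 * (v.toBits.length + (n + 1)) + 30) := by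
      gcongr n * (16 * ?_ + 30)
      omega
    have := Nat.add_one_mul n (16 * (v.toBits.length + (n + 1)) + 30)
    omega

theorem toBinary (n : ℕ) : ∃ w, Sem h Prog.toBinary (.unary n) (n * (16 * (1 + n) + 30) + 6)
    (PMF.pure w) ∧ w.toNat = n + 1 := by
  obtain ⟨w, h1, h2⟩ := toBinary_loop (h := h) n (.cons (.ofBool true) .nil)
  refine ⟨w, ?_, ?_⟩
  · refine (((straight' (p := .pair .id (.pair Prog.tt .nil)) rfl rfl (k := 4) rfl).seq' h1).seq'
      (straight' (p := .snd) (w := w) rfl rfl (k := 1) rfl)).mono ?_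
    simp only [Val.toBits, List.length_cons, List.length_nil, Nat.zero_add]
    omega
  · rw [h2, add_comm]; rfl

/-- The loop strips the common prefix; the strings agree exactly if nothing is left of either. -/
theorem eqBits (u v : Val) : ∃ w, Sem h Prog.eqBits (.cons u v) (30 * u.toBits.length + 30)
    (PMF.pure w) ∧ w.isCons = decide (u.toBits = v.toBits) := by
  suffices ∃ u' v' : Val, Sem h (.loop (.ite .fst (.ite .snd
      (.ite (.fst ⨾ .fst) (.snd ⨾ .fst) (Prog.not (.snd ⨾ .fst))) .nil) .nil)
      (.pair (.fst ⨾ .snd) (.snd ⨾ .snd))) (.cons u v) (30 * u.toBits.length + 20)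
      (PMF.pure (.cons u' v')) ∧
      (!u'.isCons && !v'.isCons) = decide (u.toBits = v.toBits) by
    obtain ⟨u', v', h1, h2⟩ := this
    have h3 : ∃ w, Sem h (.ite .fst .nil (Prog.not .snd)) (.cons u' v') 5 (PMF.pure w) ∧
        w.isCons = (!u'.isCons && !v'.isCons) := by
      cases u' with
      | nil => exact ⟨_, (ite_nil (n := 1) (m := 3) (straight' rfl rfl rfl)
          (not (straight' rfl rfl rfl))).mono (by omega), by cases v' <;> rfl⟩
      | cons a b => exact ⟨.nil, (ite_cons (n := 1) (m := 3) (a := a) (b := b)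
          (straight' rfl rfl rfl) (straight' rfl rfl rfl)).mono (by omega), rfl⟩
    obtain ⟨w, h3, h4⟩ := h3
    exact ⟨w, (h1.seq' h3).mono (by omega), h4.trans h2⟩
  induction u generalizing v with
  | nil =>
    refine ⟨.nil, v, (loop_done (n := 2) (ite_nil (n := 1) (m := 1) (straight' rfl rfl rfl)
      (straight' rfl rfl rfl))).mono (by omega), ?_⟩
    cases v <;> simp [Val.isCons, Val.toBits]
  | cons x u _ ih =>
    cases v with
    | nil =>
      exact ⟨.cons x u, .nil, (loop_done (n := 3) (ite_cons (n := 1) (m := 2) (a := x) (b := u)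
        (straight' rfl rfl rfl) (ite_nil (n := 1) (m := 1) (straight' rfl rfl rfl)
        (straight' rfl rfl rfl)))).mono (by omega), by simp [Val.isCons, Val.toBits]⟩
    | cons y v =>
      have hc : ∃ w, Sem h (.ite .fst (.ite .snd
          (.ite (.fst ⨾ .fst) (.snd ⨾ .fst) (Prog.not (.snd ⨾ .fst))) .nil) .nil)
          (.cons (.cons x u) (.cons y v)) 10 (PMF.pure w) ∧ w.isCons = (x.isCons == y.isCons) := by
        have h1 : ∃ w, Sem h (.ite (.fst ⨾ .fst) (.snd ⨾ .fst) (Prog.not (.snd ⨾ .fst)))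
            (.cons (.cons x u) (.cons y v)) 6 (PMF.pure w) ∧
            w.isCons = (x.isCons == y.isCons) := by
          cases x with
          | nil => exact ⟨_, ite_nil (n := 2) (m := 4) (straight' rfl rfl rfl)
              (not (straight' (k := 2) (w := y) rfl rfl rfl)), by cases y <;> rfl⟩
          | cons a b => exact ⟨y, ite_cons (n := 2) (m := 4) (a := a) (b := b)
              (straight' rfl rfl rfl) (straight' rfl rfl rfl), by cases y <;> rfl⟩
        obtain ⟨w, h1, h2⟩ := h1
        exact ⟨w, (ite_cons (n := 1) (a := x) (b := u) (straight' rfl rfl rfl)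
          (ite_cons (n := 1) (a := y) (b := v) (straight' rfl rfl rfl) h1)).mono (by omega), h2⟩
      obtain ⟨w, hw, hw'⟩ := hc
      by_cases hxy : x.isCons = y.isCons
      · obtain ⟨u', v', h1, h2⟩ := ih v
        refine ⟨u', v', (loop_next hw (by simp [hw', hxy]) (m := 4)
          (straight' rfl rfl rfl) h1).mono ?_, ?_⟩
        · simp only [Val.toBits, List.length_cons]
          omega
        · rw [h2]
          simp [Val.toBits, hxy]
      · refine ⟨.cons x u, .cons y v, (loop_end hw (by simp [hw', hxy])).mono (by omega), ?_⟩
        have : (Val.cons x u).toBits ≠ (Val.cons y v).toBits := fun he => hxy (List.cons.inj he).1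
        simp [this, Val.isCons]

/-- A table, the first component of each entry being its key. -/
theorem lookup {α : Type} (key val : α → Val) (v : Val) (l : List α)
    (enc : List α → Val) (henc : enc [] = .nil)
    (henc' : ∀ a l, enc (a :: l) = .cons (.cons (key a) (val a)) (enc l)) :
    Sem h Prog.lookup (.cons v (enc l)) ((30 * v.toBits.length + 50) * (l.length + 1))
      (PMF.pure (match l.find? fun a => (key a).toBits = v.toBits with
        | some a => .cons (key a) (val a)
        | none => .nil)) := by
  suffices ∃ l' : List α, Sem h (.loop (.ite .snd
      (Prog.not (.pair .fst (.snd ⨾ .fst ⨾ .fst) ⨾ Prog.eqBits)) .nil) (.pair .fst (.snd ⨾ .snd)))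
      (.cons v (enc l)) ((30 * v.toBits.length + 45) * (l.length + 1)) (PMF.pure (.cons v (enc l'))) ∧
      l'.head? = l.find? fun a => (key a).toBits = v.toBits by
    obtain ⟨l', h1, h2⟩ := this
    rw [← h2]
    refine (h1.seq' (straight' (k := 1) rfl rfl rfl)).seq' (straight' (k := 1) rfl rfl rfl)
      |>.mono ?_ |>.congr ?_
    · rw [Nat.mul_succ, Nat.mul_succ]
      have : (30 * v.toBits.length + 45) * l.length ≤ (30 * v.toBits.length + 50) * l.length := by
        gcongr
        omega
      omega
    · cases l' with
      | nil => simp [henc, Prog.den, Val.snd, Val.fst]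
      | cons a l' => simp [henc', Prog.den, Val.snd, Val.fst]
  induction l with
  | nil =>
    refine ⟨[], (loop_done (n := 2) (ite_nil (n := 1) (m := 1) ?_
      (straight' rfl rfl rfl))).mono (by simp only [List.length_nil]; omega), rfl⟩
    exact straight' rfl henc rfl
  | cons a l ih =>
    obtain ⟨w, hw, hw'⟩ := eqBits (h := h) v (key a)
    have hc := (ite_cons (r := .nil) (n := 1)
      (straight' (p := .snd) (v := .cons v (enc (a :: l))) rfl (henc' a l) rfl)
      (not ((straight' (p := .pair .fst (.snd ⨾ .fst ⨾ .fst)) (w := .cons v (key a)) (k := 4)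
        rfl (by simp [Prog.den, henc', Val.fst, Val.snd]) rfl).seq' hw)))
    by_cases hk : (key a).toBits = v.toBits
    · refine ⟨a :: l, (loop_end hc ?_).mono ?_, ?_⟩
      · simp [hw', hk, Val.isCons_ofBool]
      · rw [List.length_cons, Nat.mul_succ]
        omega
      · simp [hk]
    · obtain ⟨l', h1, h2⟩ := ih
      refine ⟨l', (loop_next hc ?_ (m := 3) (straight' rfl ?_ rfl) h1).mono ?_, ?_⟩
      · simp [hw', Ne.symm hk, Val.isCons_ofBool]
      · simp [henc', Prog.den, Val.snd, Val.fst]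
      · rw [List.length_cons, Nat.mul_succ _ (l.length + 1)]
        omega
      · simp [hk, h2]

/-- The exponent is `n + 1` because no program is given for the neutral element: the accumulator
starts at `x` itself. -/
theorem pow {M : Type} [Monoid M] (enc : M → Val) (hd : Val) (mul : Prog O) (N : ℕ)
    (hmul : ∀ x y : M, Sem h mul (.cons hd (.cons (enc x) (enc y))) N (PMF.pure (enc (x * y))))
    (x : M) (v : Val) : Sem h (Prog.pow mul) (.cons hd (.cons (enc x) v))
      ((2 * N + 50) * (v.toBits.length + 1)) (PMF.pure (enc (x ^ (v.toNat + 1)))) := by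
  -- The invariant of repeated squaring: `y * x ^ v` is preserved when a bit of `v` is consumed, `x`
  -- is squared and, for a bit 1, `y` is multiplied by `x`.
  have key : ∀ (v : Val) (y x : M), ∃ w, Sem h (.loop .fst
    (.pair (.fst ⨾ .snd) (.pair
      (.ite (.fst ⨾ .fst)
        (.pair (.snd ⨾ .snd ⨾ .snd) (.pair (.snd ⨾ .fst) (.snd ⨾ .snd ⨾ .fst)) ⨾ mul)
        (.snd ⨾ .fst))
      (.pair (.pair (.snd ⨾ .snd ⨾ .snd) (.pair (.snd ⨾ .snd ⨾ .fst) (.snd ⨾ .snd ⨾ .fst)) ⨾ mul)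
        (.snd ⨾ .snd ⨾ .snd))))) (.cons v (.cons (enc y) (.cons (enc x) hd)))
      ((2 * N + 35) * v.toBits.length + 1) (PMF.pure (.cons .nil (.cons (enc (y * x ^ v.toNat)) w))) := by
    intro v
    induction v with
    | nil =>
      intro y x
      exact ⟨.cons (enc x) hd, (loop_end (w := .nil) (n := 1) (straight' rfl rfl rfl) rfl).mono
        (by omega) |>.congr (by simp [Val.toNat, Val.toBits])⟩
    | cons b v _ ih =>
      intro y x
      obtain ⟨w, h1⟩ := ih (if b.isCons then y * x else y) (x * x)
      refine ⟨w, ?_⟩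
      have h2 : Sem h (.ite (.fst ⨾ .fst)
        (.pair (.snd ⨾ .snd ⨾ .snd) (.pair (.snd ⨾ .fst) (.snd ⨾ .snd ⨾ .fst)) ⨾ mul)
        (.snd ⨾ .fst)) (.cons (.cons b v) (.cons (enc y) (.cons (enc x) hd))) (2 + (8 + N))
        (PMF.pure (enc (if b.isCons then y * x else y))) := by
        refine ite' (f := fun b => PMF.pure (enc (if b = true then y * x else y))) (w := b)
          (straight' rfl rfl rfl) (fun _ => ?_) (fun _ => ?_)
        · exact (straight' (w := .cons hd (.cons (enc y) (enc x))) rfl rfl rfl).seq' (hmul y x)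
        · exact (straight' (k := 2) rfl rfl rfl).mono (by omega)
      have h3 : Sem h (.pair (.snd ⨾ .snd ⨾ .snd)
        (.pair (.snd ⨾ .snd ⨾ .fst) (.snd ⨾ .snd ⨾ .fst)) ⨾ mul)
        (.cons (.cons b v) (.cons (enc y) (.cons (enc x) hd))) (9 + N) (PMF.pure (enc (x * x))) :=
        (straight' (w := .cons hd (.cons (enc x) (enc x))) rfl rfl rfl).seq' (hmul x x)
      refine (loop_next (w := .cons b v) (n := 1) (straight' rfl rfl rfl) rfl
        ((straight' (w := v) (k := 2) rfl rfl rfl).pair' (h2.pair' (h3.pair'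
          (straight' (w := hd) (k := 3) rfl rfl rfl)))) h1).mono ?_ |>.congr ?_
      · rw [Val.toBits, List.length_cons, Nat.mul_succ]
        omega
      · have : (if b.isCons then y * x else y) * (x * x) ^ v.toNat =
            y * x ^ (Val.cons b v).toNat := by
          have h4 : (Val.cons b v).toNat = 2 * v.toNat + b.isCons.toNat := by
            rw [Val.toNat, Val.toBits, List.foldr_cons, Nat.bit_val]; rfl
          rw [h4, ← pow_two, ← pow_mul]
          cases b.isCons
          · simp
          · simp only [if_true, Bool.toNat_true, mul_assoc]
            rw [pow_succ']
        rw [this]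
  obtain ⟨w, h1⟩ := key v x x
  refine ((((straight' (k := 8) rfl rfl rfl).seq' h1).seq' (straight' (k := 1) rfl rfl rfl)).seq'
    (straight' (k := 1) rfl rfl rfl)).mono ?_ |>.congr ?_
  · rw [Nat.mul_succ]
    have : (2 * N + 35) * v.toBits.length ≤ (2 * N + 50) * v.toBits.length := by
      gcongr
      omega
    omega
  · rw [← pow_succ']
    rfl

end Sem
end

/-! ## Gluing -/

namespace PMF

variable {α β γ : Type}

open Classical in
/-- The law of the second component, given the value of the first one. -/
def condSnd (π : PMF (α × β)) (a : α) : PMF β :=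
  if h : ∃ x ∈ {x : α × β | x.1 = a}, x ∈ π.support then (π.filter _ h).map Prod.snd
  else π.map Prod.snd

/-- Disintegration: a joint law is recovered by drawing the first component and then the second from
its conditional law. -/
theorem bind_condSnd (π : PMF (α × β)) :
    ((π.map Prod.fst).bind fun a => (π.condSnd a).map fun b => (a, b)) = π := by
  classical
  ext ⟨a, b⟩
  rw [bind_apply, tsum_eq_single a]
  · rw [map_apply]
    have hS : (∑' x, if a = Prod.fst x then π x else 0) =
        ∑' x, Set.indicator {x : α × β | x.1 = a} π x :=
      tsum_congr fun x => by simp [Set.indicator_apply, eq_comm]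
    rw [hS, condSnd]
    split_ifs with h
    · have h1 : ((π.filter {x : α × β | x.1 = a} h).map Prod.snd).map (fun b => (a, b)) (a, b) =
          π.filter {x : α × β | x.1 = a} h (a, b) := by
        rw [map_comp, map_apply, tsum_eq_single (a, b)]
        · simp
        · rintro ⟨a', b'⟩ hx
          by_cases hb : b = b'
          · subst hb
            rw [filter_apply, Set.indicator_of_notMem, zero_mul, ite_self]
            rintro rfl
            exact hx rfl
          · simp [hb]
      rw [h1, filter_apply, Set.indicator_of_mem (by rfl), mul_comm, mul_assoc,
        ENNReal.inv_mul_cancel, mul_one]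
      · obtain ⟨x, hx, hx'⟩ := h
        intro h0
        rw [ENNReal.tsum_eq_zero] at h0
        have := h0 x
        rw [Set.indicator_of_mem hx] at this
        exact (π.mem_support_iff x).1 hx' this
      · exact π.tsum_coe_indicator_ne_top _
    · have h0 : ∀ x : α × β, x.1 = a → π x = 0 := fun x hx => by
        by_contra hc
        exact h ⟨x, hx, (π.mem_support_iff x).2 hc⟩
      rw [h0 (a, b) rfl, ENNReal.tsum_eq_zero.2 fun x => ?_, zero_mul]
      by_cases hx : x ∈ {x : α × β | x.1 = a}
      · rw [Set.indicator_of_mem hx, h0 x hx]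
      · rw [Set.indicator_of_notMem hx]
  · intro a' ha'
    rw [map_apply (p := π.condSnd a'), ENNReal.tsum_eq_zero.2 fun x => ?_, mul_zero]
    rw [if_neg]
    intro he
    exact ha' (Prod.mk.inj he).1.symm

/-- Given `a`, the partner is drawn from the conditional law given `g a`. A specification in terms
of encodings can thus be used for the encoded data, without injectivity of the encoding. -/
theorem Coupled.of_map {R : γ → β → Prop} {μ : PMF α} {g : α → γ} {ν : PMF β}
    (h : Coupled R (μ.map g) ν) : Coupled (fun a b => R (g a) b) μ ν := by
  obtain ⟨π, h1, rfl, hR⟩ := h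
  refine ⟨μ.bind fun a => (π.condSnd (g a)).map fun b => (a, b), ?_, ?_, ?_⟩
  · rw [map_bind]
    refine Eq.trans ?_ (bind_pure μ)
    congr 1
    funext a
    rw [map_comp]
    exact map_const _ a
  · rw [map_bind]
    conv_rhs => rw [← bind_condSnd π, h1, map_bind, bind_map]
    congr 1
    funext a
    simp only [Function.comp_apply, map_comp]
    rfl
  · intro x hx
    rw [mem_support_bind_iff] at hx
    obtain ⟨a, ha, hx⟩ := hx
    rw [mem_support_map_iff] at hx
    obtain ⟨b, hb, rfl⟩ := hx
    refine hR (g a, b) ?_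
    rw [← bind_condSnd π, h1, mem_support_bind_iff]
    exact ⟨g a, (mem_support_map_iff _ _ _).2 ⟨a, ha, rfl⟩,
      (mem_support_map_iff _ _ _).2 ⟨b, hb, rfl⟩⟩

end PMF

/-! ## Replacing oracles by code with a state -/

namespace Val

def height : Val → ℕ
  | nil => 0
  | cons a b => max a.height b.height + 1

theorem length_toBits_le (v : Val) : v.toBits.length ≤ v.height := by
  induction v with
  | nil => simp [toBits, height]
  | cons a b _ ih =>
    simp only [toBits, List.length_cons, height]
    omega

theorem height_ofBits_le (l : List Bool) : (ofBits l).height ≤ l.length + 1 := by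
  induction l with
  | nil => simp [ofBits, height]
  | cons b l ih => cases b <;> simp [ofBits, ofBool, height, ih]

theorem foldr_bit_lt (l : List Bool) : l.foldr Nat.bit 0 < 2 ^ l.length := by
  induction l with
  | nil => simp
  | cons b l ih =>
    have := b.toNat_lt
    rw [List.foldr_cons, Nat.bit_val, List.length_cons, pow_succ]
    omega

theorem length_bits_le {n k : ℕ} (h : n < 2 ^ k) : n.bits.length ≤ k := by
  rw [Nat.size_eq_bits_len]
  exact Nat.size_le.2 h

theorem height_ofNat_le {i : ℕ} {v : Val} (h : i ≤ v.toNat) : (ofNat i).height ≤ v.height + 1 := by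
  have h1 : i.bits.length ≤ v.toBits.length :=
    length_bits_le (h.trans_lt (foldr_bit_lt v.toBits))
  have h2 := height_ofBits_le i.bits
  have h3 := length_toBits_le v
  rw [ofNat]
  omega

theorem height_fst_le (v : Val) : v.fst.height ≤ v.height := by
  cases v <;> simp only [fst, height] <;> omega

theorem height_snd_le (v : Val) : v.snd.height ≤ v.height := by
  cases v <;> simp only [snd, height] <;> omega

end Val

namespace Prog

/-- The program that acts like `p` on the first component and keeps the state of the oracles, whose
code is `code`, in the second component. -/
def compile {O O' : Type} (code : O → Prog O') : Prog O → Prog O'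
  | .nil => .pair .nil .snd
  | .id => .id
  | .fst => .pair (.fst ⨾ .fst) .snd
  | .snd => .pair (.fst ⨾ .snd) .snd
  | .rand => .pair (.fst ⨾ .rand) .snd
  | .call o => code o
  | .seq p r => p.compile code ⨾ r.compile code
  | .pair p r => .pair (p.compile code) .fst ⨾
      .pair (.fst ⨾ .fst) (.pair .snd (.fst ⨾ .snd) ⨾ r.compile code) ⨾
      .pair (.pair .fst (.snd ⨾ .fst)) (.snd ⨾ .snd)
  | .ite c p r => .pair (c.compile code) .fst ⨾
      .ite (.fst ⨾ .fst) (.pair .snd (.fst ⨾ .snd) ⨾ p.compile code)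
        (.pair .snd (.fst ⨾ .snd) ⨾ r.compile code)
  | .loop c p => .pair (c.compile code) .fst ⨾
      .loop (.fst ⨾ .fst)
        (.pair .snd (.fst ⨾ .snd) ⨾ p.compile code ⨾ .pair (c.compile code) .fst) ⨾
      .pair .snd (.fst ⨾ .snd)

/-- The cost of the compiled program per instruction of `p`, if the code of the oracles runs in time
`N`. -/
def overhead {O : Type} (N : ℕ) : Prog O → ℕ
  | .seq p r => p.overhead N + r.overhead N + 20
  | .pair p r => p.overhead N + r.overhead N + 20
  | .ite c p r => c.overhead N + (p.overhead N + r.overhead N) + 20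
  | .loop c p => c.overhead N + p.overhead N + 20
  | _ => N + 20

/-- The number of nodes of a program. -/
def nodes {O : Type} : Prog O → ℕ
  | .seq p r => p.nodes + r.nodes + 1
  | .pair p r => p.nodes + r.nodes + 1
  | .ite c p r => c.nodes + (p.nodes + r.nodes) + 1
  | .loop c p => c.nodes + p.nodes + 1
  | _ => 1

/-- The overhead grows linearly in the cost `N` of the oracle code, with a factor that depends on
the program alone; hence polynomial bounds survive compilation. -/
theorem overhead_le {O : Type} (N : ℕ) (p : Prog O) : p.overhead N ≤ p.nodes * (N + 20) := by
  induction p with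
  | seq p r ihp ihr => simp only [overhead, nodes, add_mul, one_mul] at *; omega
  | pair p r ihp ihr => simp only [overhead, nodes, add_mul, one_mul] at *; omega
  | ite c p r ihc ihp ihr => simp only [overhead, nodes, add_mul, one_mul] at *; omega
  | loop c p ihc ihp => simp only [overhead, nodes, add_mul, one_mul] at *; omega
  | _ => simp [overhead, nodes]

end Prog

section

variable {O O' σ : Type} {h : O → Val → σ → PMF (Val × σ)} {h' : O' → Val → PMF Val}

/-- Continue a run with `f` unless the time has run out. -/
def optRun {α : Type} (f : Val → ℕ → σ → PMF (Option α × σ)) :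
    Option (Val × ℕ) × σ → PMF (Option α × σ)
  | (none, s) => PMF.pure (none, s)
  | (some (w, t), s) => f w t s

theorem Exec.run_andThen (x : Comp O (Option (Val × ℕ))) (f : Exec O) (s : σ) :
    (Exec.andThen x f).run h s = (x.run h s).bind (optRun fun w t s => (f w t).run h s) := by
  rw [Exec.andThen, Comp.run_bind]
  congr 1
  funext y
  rcases y with ⟨_ | ⟨w, t⟩, s⟩ <;> rfl

theorem bind_optRun_pure (μ : PMF (Option (Val × ℕ) × σ)) :
    μ.bind (optRun fun w t s => PMF.pure (some (w, t), s)) = μ := by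
  conv_rhs => rw [← PMF.bind_pure μ]
  congr 1
  funext y
  rcases y with ⟨_ | ⟨w, t⟩, s⟩ <;> rfl

/-- The run of `q` on `u` for time `τ` imitates the run with law `μ`, unless the latter exceeds its
time: the results and the remaining times are related by `Φ`. -/
def Imitates (h' : O' → Val → PMF Val) (μ : PMF (Option (Val × ℕ) × σ)) (q : Prog O') (u : Val)
    (τ : ℕ) (Φ : Val → ℕ → σ → Val → ℕ → Prop) : Prop :=
  PMF.Coupled (fun y z => ∀ w t, y.1 = some (w, t) → ∃ w' τ', z = some (w', τ') ∧ Φ w t y.2 w' τ')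
    μ (q.exec h' u τ)

namespace Imitates

variable {μ : PMF (Option (Val × ℕ) × σ)} {q q' r : Prog O'} {u a b : Val} {τ n : ℕ}
  {Φ Φ' : Val → ℕ → σ → Val → ℕ → Prop} {f : Val → ℕ → σ → PMF (Option (Val × ℕ) × σ)}

theorem none (s : σ) : Imitates h' (PMF.pure (none, s)) q u τ Φ :=
  PMF.Coupled.pure_left fun b _ w t hw => by simp at hw

theorem coupled_optBind {ν : PMF (Option (Val × ℕ))} {g : Val → ℕ → PMF (Option (Val × ℕ))}
    {R : (Option (Val × ℕ) × σ) → Option (Val × ℕ) → Prop}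
    (hμ : PMF.Coupled (fun y z => ∀ w t, y.1 = some (w, t) →
      ∃ w' τ', z = some (w', τ') ∧ Φ w t y.2 w' τ') μ ν)
    (hR : ∀ s z, R (.none, s) z)
    (hf : ∀ w t s w' τ', Φ w t s w' τ' → PMF.Coupled R (f w t s) (g w' τ')) :
    PMF.Coupled R (μ.bind (optRun f)) (ν.bind (optBind g)) := by
  refine hμ.bind fun y _ z _ hyz => ?_
  rcases y with ⟨_ | ⟨w, t⟩, s⟩
  · exact PMF.Coupled.pure_left fun b _ => hR s b
  · obtain ⟨w', τ', rfl, hΦ⟩ := hyz w t rfl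
    exact hf w t s w' τ' hΦ

theorem bind (hμ : Imitates h' μ q u τ Φ)
    (hf : ∀ w t s w' τ', Φ w t s w' τ' → Imitates h' (f w t s) q' w' τ' Φ') :
    Imitates h' (μ.bind (optRun f)) (q ⨾ q') u τ Φ' := by
  rw [Imitates, Prog.exec_seq]
  exact coupled_optBind hμ (fun s z w t hw => by simp at hw) hf

theorem mono (hμ : Imitates h' μ q u τ Φ) (hΦ : ∀ w t s w' τ', Φ w t s w' τ' → Φ' w t s w' τ') :
    Imitates h' μ q u τ Φ' :=
  PMF.Coupled.mono hμ fun y _ z _ hyz w t hw => by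
    obtain ⟨w', τ', h1, h2⟩ := hyz w t hw
    exact ⟨w', τ', h1, hΦ _ _ _ _ _ h2⟩

theorem of_sem {w : Val} {t : ℕ} {s : σ} (hq : Sem h' q u n (PMF.pure b)) (hn : n ≤ τ)
    (hΦ : ∀ τ', τ ≤ τ' + n → Φ w t s b τ') :
    Imitates h' (PMF.pure (some (w, t), s)) q u τ Φ := by
  have := (hq τ hn).bind (R' := fun y z => ∀ w t, y.1 = some (w, t) →
    ∃ w' τ', z = some (w', τ') ∧ Φ w t y.2 w' τ')
    (f := fun _ => PMF.pure (some (w, t), s)) (g := PMF.pure) (fun b' hb z _ hz => by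
      obtain ⟨τ', rfl, h1⟩ := hz
      simp only [PMF.support_pure, Set.mem_singleton_iff] at hb
      subst hb
      refine PMF.Coupled.pure fun w t hw => ⟨b', τ', rfl, ?_⟩
      simp only [Option.some.injEq, Prod.mk.injEq] at hw
      obtain ⟨rfl, rfl⟩ := hw
      exact hΦ τ' h1)
  rwa [PMF.bind_const, PMF.bind_pure] at this

theorem seq_sem (hμ : Imitates h' μ q u τ Φ)
    (hq : ∀ w t s w' τ', Φ w t s w' τ' → ∃ n b, Sem h' q' w' n (PMF.pure b) ∧ n ≤ τ' ∧
      ∀ τ'', τ' ≤ τ'' + n → Φ' w t s b τ'') : Imitates h' μ (q ⨾ q') u τ Φ' := by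
  rw [← bind_optRun_pure μ]
  refine hμ.bind fun w t s w' τ' hΦ => ?_
  obtain ⟨n, b, h1, h2, h3⟩ := hq w t s w' τ' hΦ
  exact of_sem h1 h2 h3

theorem sem_then {α : Type} {μ : PMF α} {g : Val → ℕ → PMF (Option (Val × ℕ))}
    {R : α → Option (Val × ℕ) → Prop} (hq : Sem h' q u n (PMF.pure b))
    (hn : n ≤ τ) (hg : ∀ τ', τ ≤ τ' + n → PMF.Coupled R μ (g b τ')) :
    PMF.Coupled R μ ((q.exec h' u τ).bind (optBind g)) := by
  have := (hq τ hn).bind (R' := R) (f := fun _ => μ) (g := optBind g) (fun b' hb z _ hz => by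
      obtain ⟨τ', rfl, h1⟩ := hz
      simp only [PMF.support_pure, Set.mem_singleton_iff] at hb
      subst hb
      exact hg τ' h1)
  rwa [PMF.bind_const] at this

theorem sem_seq (hq : Sem h' q u n (PMF.pure b)) (hn : n ≤ τ)
    (hμ : ∀ τ', τ ≤ τ' + n → Imitates h' μ q' b τ' Φ) : Imitates h' μ (q ⨾ q') u τ Φ := by
  rw [Imitates, Prog.exec_seq]
  exact sem_then hq hn hμ

theorem pair_sem (hμ : Imitates h' μ q u τ Φ) (hr : Sem h' r u n (PMF.pure b))
    (hΦ : ∀ w t s w' τ', Φ w t s w' τ' → n ≤ τ' ∧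
      ∀ τ'', τ' ≤ τ'' + n → Φ' w t s (.cons w' b) τ'') : Imitates h' μ (.pair q r) u τ Φ' := by
  rw [Imitates, Prog.exec_pair]
  conv => enter [2]; rw [← bind_optRun_pure μ]
  refine coupled_optBind hμ (fun s z w t hw => by simp at hw) fun w t s w' τ' h1 => ?_
  obtain ⟨h2, h3⟩ := hΦ w t s w' τ' h1
  refine sem_then hr h2 fun τ'' h4 => PMF.Coupled.pure fun w1 t1 hw => ?_
  simp only [Option.some.injEq, Prod.mk.injEq] at hw
  obtain ⟨rfl, rfl⟩ := hw
  exact ⟨_, _, rfl, h3 _ h4⟩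

theorem sem_pair (hr : Sem h' r u n (PMF.pure a)) (hn : n ≤ τ)
    (hμ : ∀ τ', τ ≤ τ' + n → Imitates h' μ q u τ' fun w t s b τ'' => Φ w t s (.cons a b) τ'') :
    Imitates h' μ (.pair r q) u τ Φ := by
  rw [Imitates, Prog.exec_pair]
  refine sem_then hr hn fun τ' h1 => ?_
  conv => enter [2]; rw [← bind_optRun_pure μ]
  refine coupled_optBind (Φ := fun w t s b τ'' => Φ w t s (.cons a b) τ'') (hμ τ' h1)
    (fun s z w t hw => by simp at hw) fun w t s w' τ' h1 => PMF.Coupled.pure fun w1 t1 hw => ?_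
  simp only [Option.some.injEq, Prod.mk.injEq] at hw
  obtain ⟨rfl, rfl⟩ := hw
  exact ⟨_, _, rfl, h1⟩

theorem ite {c : Prog O'} (hc : Sem h' c u n (PMF.pure b)) (hn : n ≤ τ)
    (hμ : ∀ τ', τ ≤ τ' + n → Imitates h' μ (match b with | .nil => r | .cons _ _ => q) u τ' Φ) :
    Imitates h' μ (.ite c q r) u τ Φ := by
  rw [Imitates, Prog.exec_ite]
  refine sem_then hc hn fun τ' h1 => ?_
  cases b <;> exact hμ τ' h1

theorem loop_done {c : Prog O'} {w : Val} {t : ℕ} {s : σ} (hc : Sem h' c u n (PMF.pure .nil))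
    (hn : n ≤ τ) (hΦ : ∀ τ', τ ≤ τ' + n → Φ w t s u τ') :
    Imitates h' (PMF.pure (some (w, t), s)) (.loop c q) u τ Φ := of_sem (Sem.loop_done hc) hn hΦ

theorem loop_step {c : Prog O'} (hc : Sem h' c u n (PMF.pure (.cons a b))) (hn : n ≤ τ)
    (hμ : ∀ τ', τ ≤ τ' + n → Imitates h' μ (q ⨾ .loop c q) u τ' Φ) :
    Imitates h' μ (.loop c q) u τ Φ := by
  rw [Imitates, Prog.exec_loop]
  refine sem_then hc hn fun τ' h1 => ?_
  have := hμ τ' h1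
  rwa [Imitates, Prog.exec_seq] at this

end Imitates

/-- The state of the imitation of a run that had time `t` at the beginning, and `t'` now. -/
def ImitationPost (Inv : ℕ → σ → Prop) (enc : σ → Val) (K m t τ : ℕ) (w : Val) (t' : ℕ) (s : σ)
    (w' : Val) (τ' : ℕ) : Prop :=
  ∃ d, 1 ≤ d ∧ t = t' + d ∧ Inv t' s ∧ w.height + 2 * t' + 1 ≤ m ∧ w' = .cons w (enc s) ∧
    τ ≤ τ' + K * d

variable {Inv : ℕ → σ → Prop} {enc : σ → Val} {code : O → Prog O'} {N M H : ℕ}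

theorem Imitates.map_left {μ : PMF (Option (Val × ℕ) × σ)} {q : Prog O'} {u : Val} {τ : ℕ}
    {Φ Φ' : Val → ℕ → σ → Val → ℕ → Prop} {g : Val → Val} (hμ : Imitates h' μ q u τ Φ)
    (hΦ : ∀ w t s w' τ', Φ w t s w' τ' → Φ' (g w) t s w' τ') :
    Imitates h' (μ.bind (optRun fun w t s => PMF.pure (some (g w, t), s))) q u τ Φ' := by
  rw [Imitates, ← PMF.bind_pure (q.exec h' u τ)]
  refine PMF.Coupled.bind hμ fun y _ z _ hyz => ?_
  rcases y with ⟨_ | ⟨w, t⟩, s⟩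
  · exact PMF.Coupled.pure fun w t hw => by simp at hw
  · obtain ⟨w', τ', rfl, h1⟩ := hyz w t rfl
    refine PMF.Coupled.pure fun w1 t1 hw => ?_
    simp only [Option.some.injEq, Prod.mk.injEq] at hw
    obtain ⟨rfl, rfl⟩ := hw
    exact ⟨w', τ', rfl, hΦ _ _ _ _ _ h1⟩

theorem Prog.exec_assoc (p q r : Prog O') (u : Val) (τ : ℕ) :
    (p ⨾ q ⨾ r).exec h' u τ = (p ⨾ (q ⨾ r)).exec h' u τ := by
  rw [exec_seq, exec_seq, exec_seq, PMF.bind_bind]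
  congr 1
  funext y
  rcases y with _ | ⟨w, t⟩
  · simp [optBind]
  · exact (exec_seq _ _ _ _).symm

theorem Imitates.assoc {μ : PMF (Option (Val × ℕ) × σ)} {p q r : Prog O'} {u : Val} {τ : ℕ}
    {Φ : Val → ℕ → σ → Val → ℕ → Prop} (hμ : Imitates h' μ (p ⨾ (q ⨾ r)) u τ Φ) :
    Imitates h' μ (p ⨾ q ⨾ r) u τ Φ := by
  rwa [Imitates, Prog.exec_assoc]

theorem Prog.imitates_atom {q : Prog O'} {K : ℕ} (v : Val) (f : Val → Comp O Val)
    (t : ℕ) (s : σ) (τ m : ℕ) (hτ : K * t ≤ τ)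
    (hq : ∀ t', t = t' + 1 →
      Sem h' q (.cons v (enc s)) K (((f v).run h s).map fun y => .cons y.1 (enc y.2)))
    (hf : ∀ t', t = t' + 1 →
      ∀ y ∈ ((f v).run h s).support, y.1.height + 2 * t' + 1 ≤ m ∧ Inv t' y.2) :
    Imitates h' ((Exec.atom f v t).run h s) q (.cons v (enc s)) τ
      (ImitationPost Inv enc K m t τ) := by
  cases t with
  | zero => exact Imitates.none s
  | succ t =>
    have h1 := (hq t rfl τ (le_trans (by rw [Nat.mul_succ]; omega) hτ)).of_map
    rw [Exec.atom, Comp.run_bind, Imitates]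
    rw [← PMF.bind_pure (q.exec h' _ τ)]
    refine h1.bind fun y hy x hx ⟨τ', h8, h9⟩ => ?_
    refine PMF.Coupled.pure fun w' t' hw' => ?_
    simp only [Option.some.injEq, Prod.mk.injEq] at hw'
    obtain ⟨rfl, rfl⟩ := hw'
    obtain ⟨h2, h3⟩ := hf t rfl y hy
    exact ⟨_, τ', h8, 1, le_rfl, rfl, h3, h2, rfl, by omega⟩

/-- After the evaluation of the test, the compiled loop imitates the loop. -/
theorem Prog.imitates_loop {c p : Prog O} {Kc Kp m : ℕ}
    (hc : ∀ v t s τ, Inv t s → v.height + 2 * t ≤ m → H + 2 * t ≤ m → Kc * t ≤ τ →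
      Imitates h' ((c.eval v t).run h s) (c.compile code) (.cons v (enc s)) τ
        (ImitationPost Inv enc Kc m t τ))
    (hp : ∀ v t s τ, Inv t s → v.height + 2 * t ≤ m → H + 2 * t ≤ m → Kp * t ≤ τ →
      Imitates h' ((p.eval v t).run h s) (p.compile code) (.cons v (enc s)) τ
        (ImitationPost Inv enc Kp m t τ)) (n : ℕ) :
    ∀ v b t s τ, Inv t s → v.height + 2 * t ≤ m → H + 2 * t ≤ m → (Kc + Kp + 20) * t + 10 ≤ τ →
      Imitates h' (Comp.run h (match b with
          | .nil => .ret (some (v, t))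
          | .cons _ _ => Exec.andThen (p.eval v t) (Exec.loop c.eval p.eval n)) s)
        (.loop (.fst ⨾ .fst)
          (.pair .snd (.fst ⨾ .snd) ⨾ p.compile code ⨾ .pair (c.compile code) .fst))
        (.cons (.cons b (enc s)) v) τ
        fun w t' s w' τ' => ∃ d b', t = t' + d ∧ Inv t' s ∧ w.height + 2 * t' ≤ m ∧
          w' = .cons (.cons b' (enc s)) w ∧ τ ≤ τ' + (Kc + Kp + 20) * d + 2 := by
  induction n with
  | zero =>
    intro v b t s τ hs hv hH hτ
    cases b with
    | nil =>
      exact Imitates.loop_done (n := 2) (Sem.straight' rfl rfl rfl) (by omega)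
        fun τ' hτ' => ⟨0, .nil, rfl, hs, hv, rfl, by omega⟩
    | cons b1 b2 =>
      refine Imitates.loop_step (n := 2) (a := b1) (b := b2) (Sem.straight' rfl rfl rfl) (by omega)
        fun τ1 h1 => ?_
      simp only [Exec.run_andThen]
      refine (Imitates.assoc (Imitates.sem_seq (n := 3) (b := .cons v (enc s))
        (Sem.straight' rfl rfl rfl) (by omega) fun τ2 h2 => ?_)).assoc
      -- Without fuel the imitated loop fails after this round, and nothing is claimed about failed
      -- runs.
      refine (hp v t s τ2 hs hv hH ?_).bind fun w t' s' w' τ' _ => Imitates.none s'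
      simp only [add_mul] at *
      omega
  | succ n ih =>
    intro v b t s τ hs hv hH hτ
    cases b with
    | nil =>
      exact Imitates.loop_done (n := 2) (Sem.straight' rfl rfl rfl) (by omega)
        fun τ' hτ' => ⟨0, .nil, rfl, hs, hv, rfl, by omega⟩
    | cons b1 b2 =>
      refine Imitates.loop_step (n := 2) (a := b1) (b := b2) (Sem.straight' rfl rfl rfl) (by omega)
        fun τ1 h1 => ?_
      simp only [Exec.run_andThen]
      refine (Imitates.assoc (Imitates.sem_seq (n := 3) (b := .cons v (enc s))
        (Sem.straight' rfl rfl rfl) (by omega) fun τ2 h2 => ?_)).assoc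
      refine (hp v t s τ2 hs hv hH ?_).bind fun w t' s' w' τ' h3 => ?_
      · simp only [add_mul] at *
        omega
      obtain ⟨d, hd, rfl, hs', hw, rfl, hτ'⟩ := h3
      rw [Exec.loop, Exec.run_andThen]
      refine ((hc w t' s' τ' hs' (by omega) (by omega) ?_).pair_sem (Sem.fst (v := .cons w (enc s')))
        (Φ' := fun b t'' s'' u τ'' => ∃ d', 1 ≤ d' ∧ t' = t'' + d' ∧ Inv t'' s'' ∧
          u = .cons (.cons b (enc s'')) w ∧ τ' ≤ τ'' + Kc * d' + 1) ?_).bind ?_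
      · simp only [add_mul, mul_add] at *
        omega
      · rintro b t'' s'' w'' τ'' ⟨d', hd', rfl, hs'', -, rfl, hτ''⟩
        refine ⟨?_, fun τ3 h4 => ⟨d', hd', rfl, hs'', rfl, by omega⟩⟩
        simp only [add_mul, mul_add] at *
        omega
      · rintro b t'' s'' w'' τ'' ⟨d', hd', rfl, hs'', rfl, hτ''⟩
        refine (ih w b t'' s'' τ'' hs'' (by omega) (by omega) ?_).mono ?_
        · simp only [add_mul, mul_add] at *
          omega
        · rintro w3 t3 s3 w4 τ3 ⟨d3, b3, rfl, hs3, hw3, rfl, hτ3⟩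
          refine ⟨d3 + d' + d, b3, by omega, hs3, hw3, rfl, ?_⟩
          simp only [add_mul, mul_add] at *
          omega

/-- The potential `height + 2 * time` controls the size of the data. An atomic instruction without a
call raises the height by at most one and spends one unit of time; a pair adds one node and spends
at least two units; answers of oracles have height at most `H`. So oracles are only called on trees
of height at most `M`, for which their code meets the time bound `N`. The invariant `Inv` may depend
on the time left, which lets it bound the growth of a table. -/
theorem Prog.imitates (hInv : ∀ t t' s, t' ≤ t → Inv t s → Inv t' s)
    (hcode : ∀ o v s t, Inv (t + 1) s → v.height ≤ M →
      Sem h' (code o) (.cons v (enc s)) N ((h o v s).map fun y => .cons y.1 (enc y.2)) ∧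
      ∀ y ∈ (h o v s).support, Inv t y.2 ∧ y.1.height ≤ H) (p : Prog O) :
    ∀ v t s τ m, Inv t s → v.height + 2 * t ≤ m → H + 2 * t ≤ m → m ≤ M → p.overhead N * t ≤ τ →
      Imitates h' ((p.eval v t).run h s) (p.compile code) (.cons v (enc s)) τ
        (ImitationPost Inv enc (p.overhead N) m t τ) := by
  have hInv' : ∀ t s, Inv (t + 1) s → Inv t s := fun t s => hInv _ _ s (by omega)
  have hdet : ∀ (f : Val → Val) (q : Prog O'), (∀ v, (f v).height ≤ v.height + 1) →
      (∀ v u, Sem h' q (.cons v u) 10 (PMF.pure (.cons (f v) u))) →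
      ∀ v t s τ m, Inv t s → v.height + 2 * t ≤ m → H + 2 * t ≤ m → m ≤ M → (N + 20) * t ≤ τ →
      Imitates h' ((Exec.atom (fun v => .ret (f v)) v t).run h s) q (.cons v (enc s)) τ
        (ImitationPost Inv enc (N + 20) m t τ) := by
    intro f q hf hq v t s τ m hs hv _ _ hτ
    refine Prog.imitates_atom v _ t s τ m hτ (fun t' _ => ?_) (fun t' ht y hy => ?_)
    · simp only [Comp.run, PMF.pure_map]
      exact (hq _ _).mono (by omega)
    · subst ht
      simp only [Comp.run, PMF.support_pure, Set.mem_singleton_iff] at hy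
      subst hy
      have := hf v
      exact ⟨by simp only; omega, hInv' _ _ hs⟩
  induction p with
  | nil => exact hdet _ _ (fun v => by simp [Val.height]) fun v u => Sem.straight' rfl rfl rfl
  | id => exact hdet _ _ (fun v => by simp) fun v u => Sem.straight' rfl rfl rfl
  | fst =>
    exact hdet _ _ (fun v => v.height_fst_le.trans (by omega)) fun v u => Sem.straight' rfl rfl rfl
  | snd =>
    exact hdet _ _ (fun v => v.height_snd_le.trans (by omega)) fun v u => Sem.straight' rfl rfl rfl
  | rand =>
    intro v t s τ m hs hv _ _ hτ
    refine Prog.imitates_atom v _ t s τ m hτ (fun t' _ => ?_) (fun t' ht y hy => ?_)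
    · refine (((Sem.straight' (k := 1) (w := v) rfl rfl rfl).seq' Sem.rand).pair
        (Sem.straight' (k := 1) (w := enc s) rfl rfl rfl)).mono ?_ |>.congr ?_
      · show _ ≤ N + 20
        omega
      · simp only [Comp.run, PMF.pure_map, PMF.bind_map, PMF.map_bind]
        rfl
    · subst ht
      simp only [Comp.run, PMF.mem_support_bind_iff, PMF.support_pure, Set.mem_singleton_iff] at hy
      obtain ⟨i, -, rfl⟩ := hy
      have := Val.height_ofNat_le (v := v) (i := i) (by omega)
      exact ⟨by simp only; omega, hInv' _ _ hs⟩
  | call o =>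
    intro v t s τ m hs hv hH hm hτ
    have hrun : (Comp.call (α := Val) o v .ret).run h s = h o v s := by
      simp only [Comp.run]
      exact PMF.bind_pure _
    refine Prog.imitates_atom v _ t s τ m hτ (fun t' ht => ?_) (fun t' ht y hy => ?_)
    · subst ht
      rw [hrun]
      refine (hcode o v s t' hs (by omega)).1.mono ?_
      show _ ≤ N + 20
      omega
    · subst ht
      rw [hrun] at hy
      obtain ⟨h1, h2⟩ := (hcode o v s t' hs (by omega)).2 y hy
      exact ⟨by omega, h1⟩
  | seq p r ihp ihr =>
    intro v t s τ m hs hv hH hm hτ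
    rw [show (seq p r).overhead N = p.overhead N + r.overhead N + 20 from rfl] at *
    rw [eval, Exec.run_andThen]
    refine (ihp v t s τ m hs hv hH hm ?_).bind ?_
    · simp only [add_mul] at *
      omega
    · rintro w t1 s1 w1 τ1 ⟨d, hd, rfl, hs1, hw, rfl, hτ1⟩
      refine (ihr w t1 s1 τ1 m hs1 (by omega) (by omega) hm ?_).mono ?_
      · simp only [add_mul, mul_add] at *
        omega
      · rintro w' t2 s2 w2 τ2 ⟨d2, hd2, rfl, hs2, hw2, rfl, hτ2⟩
        refine ⟨d2 + d, by omega, by omega, hs2, hw2, rfl, ?_⟩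
        simp only [add_mul, mul_add] at *
        omega
  | pair p r ihp ihr =>
    intro v t s τ m hs hv hH hm hτ
    rw [show (pair p r).overhead N = p.overhead N + r.overhead N + 20 from rfl] at *
    rw [eval, Exec.run_andThen]
    refine Imitates.seq_sem (Φ := fun w t2 s2 w' τ2 => ∃ d a b, 2 ≤ d ∧ t = t2 + d ∧ Inv t2 s2 ∧
      w = .cons a b ∧ a.height + 2 * t2 + 2 ≤ m ∧ b.height + 2 * t2 + 2 ≤ m ∧
      w' = .cons a (.cons b (enc s2)) ∧ τ ≤ τ2 + (p.overhead N + r.overhead N) * d + 10) ?_ ?_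
    · refine ((ihp v t s τ m hs hv hH hm ?_).pair_sem (Sem.fst (v := .cons v (enc s)))
        (Φ' := fun a t1 s1 u τ1 => ∃ d, 1 ≤ d ∧ t = t1 + d ∧ Inv t1 s1 ∧ a.height + 2 * t1 + 1 ≤ m ∧
          u = .cons (.cons a (enc s1)) v ∧ τ ≤ τ1 + p.overhead N * d + 1) ?_).bind ?_
      · simp only [add_mul] at *
        omega
      · rintro a t1 s1 w1 τ1 ⟨d, hd, rfl, hs1, hw, rfl, hτ1⟩
        refine ⟨?_, fun τ2 h2 => ⟨d, hd, rfl, hs1, hw, rfl, by omega⟩⟩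
        simp only [add_mul, mul_add] at *
        omega
      · rintro a t1 s1 w1 τ1 ⟨d, hd, rfl, hs1, hw, rfl, hτ1⟩
        rw [Exec.run_andThen]
        refine Imitates.sem_pair (n := 2) (a := a) (Sem.straight' rfl rfl rfl) ?_ fun τ2 h2 => ?_
        · simp only [add_mul, mul_add] at *
          omega
        refine Imitates.sem_seq (n := 3) (b := .cons v (enc s1)) (Sem.straight' rfl rfl rfl) ?_
          fun τ3 h3 => ?_
        · simp only [add_mul, mul_add] at *
          omega
        -- The first component has spent a unit of time, so the second one runs within `m - 2`; this
        -- leaves room for the new node.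
        refine (ihr v t1 s1 τ3 (m - 2) hs1 (by omega) (by omega) (by omega) ?_).map_left
          (g := fun b => .cons a b) ?_
        · simp only [add_mul, mul_add] at *
          omega
        · rintro b t2 s2 w2 τ4 ⟨d2, hd2, rfl, hs2, hw2, rfl, hτ4⟩
          refine ⟨d2 + d, a, b, by omega, by omega, hs2, rfl, by omega, by omega, rfl, ?_⟩
          simp only [add_mul, mul_add] at *
          omega
    · rintro w t2 s2 w' τ2 ⟨d, a, b, hd, rfl, hs2, rfl, ha, hb, rfl, hτ2⟩
      refine ⟨7, .cons (.cons a b) (enc s2), Sem.straight' rfl rfl rfl, ?_, fun τ3 h3 =>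
        ⟨d, by omega, rfl, hs2, ?_, rfl, ?_⟩⟩
      · simp only [add_mul, mul_add] at *
        omega
      · simp only [Val.height]
        omega
      · simp only [add_mul, mul_add] at *
        omega
  | ite c p r ihc ihp ihr =>
    intro v t s τ m hs hv hH hm hτ
    rw [show (ite c p r).overhead N = c.overhead N + (p.overhead N + r.overhead N) + 20 from rfl]
      at *
    rw [eval, Exec.run_andThen]
    refine ((ihc v t s τ m hs hv hH hm ?_).pair_sem (Sem.fst (v := .cons v (enc s)))
      (Φ' := fun b t1 s1 u τ1 => ∃ d, 1 ≤ d ∧ t = t1 + d ∧ Inv t1 s1 ∧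
        u = .cons (.cons b (enc s1)) v ∧ τ ≤ τ1 + c.overhead N * d + 1) ?_).bind ?_
    · simp only [add_mul] at *
      omega
    · rintro b t1 s1 w1 τ1 ⟨d, hd, rfl, hs1, hw, rfl, hτ1⟩
      refine ⟨?_, fun τ2 h2 => ⟨d, hd, rfl, hs1, rfl, by omega⟩⟩
      simp only [add_mul, mul_add] at *
      omega
    · rintro b t1 s1 w1 τ1 ⟨d, hd, rfl, hs1, rfl, hτ1⟩
      refine Imitates.ite (n := 2) (b := b) (Sem.straight' rfl rfl rfl) ?_ fun τ2 h2 => ?_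
      · simp only [add_mul, mul_add] at *
        omega
      cases b with
      | nil =>
        refine Imitates.sem_seq (n := 3) (b := .cons v (enc s1)) (Sem.straight' rfl rfl rfl) ?_
          fun τ3 h3 => (ihr v t1 s1 τ3 m hs1 (by omega) (by omega) hm ?_).mono ?_
        · simp only [add_mul, mul_add] at *
          omega
        · simp only [add_mul, mul_add] at *
          omega
        · rintro w' t2 s2 w2 τ2 ⟨d2, hd2, rfl, hs2, hw2, rfl, hτ2⟩
          refine ⟨d2 + d, by omega, by omega, hs2, hw2, rfl, ?_⟩
          simp only [add_mul, mul_add] at *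
          omega
      | cons b1 b2 =>
        refine Imitates.sem_seq (n := 3) (b := .cons v (enc s1)) (Sem.straight' rfl rfl rfl) ?_
          fun τ3 h3 => (ihp v t1 s1 τ3 m hs1 (by omega) (by omega) hm ?_).mono ?_
        · simp only [add_mul, mul_add] at *
          omega
        · simp only [add_mul, mul_add] at *
          omega
        · rintro w' t2 s2 w2 τ2 ⟨d2, hd2, rfl, hs2, hw2, rfl, hτ2⟩
          refine ⟨d2 + d, by omega, by omega, hs2, hw2, rfl, ?_⟩
          simp only [add_mul, mul_add] at *
          omega
  | loop c p ihc ihp =>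
    intro v t s τ m hs hv hH hm hτ
    rw [show (loop c p).overhead N = c.overhead N + p.overhead N + 20 from rfl] at *
    -- The first test spends a unit of time, so the rest fits into `m - 1`, which yields the `+ 1`
    -- in `ImitationPost`.
    have hloop := Prog.imitates_loop (Inv := Inv) (enc := enc) (H := H) (m := m - 1)
      (fun v t s τ hs hv hH hτ => ihc v t s τ (m - 1) hs hv hH (by omega) hτ)
      (fun v t s τ hs hv hH hτ => ihp v t s τ (m - 1) hs hv hH (by omega) hτ)
    rw [eval]
    suffices ∀ n, Imitates h' ((Exec.loop c.eval p.eval n v t).run h s) ((loop c p).compile code)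
        (.cons v (enc s)) τ (ImitationPost Inv enc (c.overhead N + p.overhead N + 20) m t τ) from
      this t
    intro n
    cases n with
    | zero => exact Imitates.none s
    | succ n =>
      rw [Exec.loop, Exec.run_andThen]
      refine Imitates.seq_sem (Φ := fun w t2 s2 w' τ2 => ∃ d b, 1 ≤ d ∧ t = t2 + d ∧ Inv t2 s2 ∧
        w.height + 2 * t2 + 1 ≤ m ∧ w' = .cons (.cons b (enc s2)) w ∧
        τ + 10 ≤ τ2 + (c.overhead N + p.overhead N + 20) * d) ?_ ?_
      · refine ((ihc v t s τ m hs hv hH hm ?_).pair_sem (Sem.fst (v := .cons v (enc s)))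
          (Φ' := fun b t1 s1 u τ1 => ∃ d, 1 ≤ d ∧ t = t1 + d ∧ Inv t1 s1 ∧
            u = .cons (.cons b (enc s1)) v ∧ τ ≤ τ1 + c.overhead N * d + 1) ?_).bind ?_
        · simp only [add_mul] at *
          omega
        · rintro b t1 s1 w1 τ1 ⟨d, hd, rfl, hs1, hw, rfl, hτ1⟩
          refine ⟨?_, fun τ2 h2 => ⟨d, hd, rfl, hs1, rfl, by omega⟩⟩
          simp only [add_mul, mul_add] at *
          omega
        · rintro b t1 s1 w1 τ1 ⟨d, hd, htd, hs1, rfl, hτ1⟩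
          refine (hloop n v b t1 s1 τ1 hs1 (by omega) (by omega) ?_).mono ?_
          · rw [htd] at hτ
            simp only [add_mul, mul_add] at *
            omega
          · rintro w' t2 s2 w2 τ2 ⟨d2, b2, rfl, hs2, hw2, rfl, hτ2⟩
            refine ⟨d2 + d, b2, by omega, by omega, hs2, by omega, rfl, ?_⟩
            simp only [add_mul, mul_add] at *
            omega
      · rintro w t2 s2 w' τ2 ⟨d, b, hd, htd, hs2, hw, rfl, hτ2⟩
        refine ⟨3, .cons w (enc s2), Sem.straight' rfl rfl rfl, ?_, fun τ3 h3 =>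
          ⟨d, hd, htd, hs2, hw, rfl, ?_⟩⟩
        · rw [htd] at hτ
          simp only [add_mul, mul_add] at *
          omega
        · simp only [add_mul] at *
          omega

end

/-! ## The simulated oracles -/

namespace Sem

variable {O : Type} {h : O → Val → PMF Val} {p r c : Prog O} {v : Val} {n m : ℕ} {α β : Type}

theorem seq_map {μ : PMF α} {f : α → Val} {κ : α → PMF Val} (hp : Sem h p v n (μ.map f))
    (hr : ∀ x ∈ μ.support, Sem h r (f x) m (κ x)) : Sem h (.seq p r) v (n + m) (μ.bind κ) := by
  intro t ht
  rw [Prog.exec_seq]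
  refine ((hp t (by omega)).of_map).bind fun x hx y _ ⟨t', h1, h2⟩ => ?_
  subst h1
  exact (hr x hx t' (by omega)).mono fun w _ y _ ⟨t', h1, h2⟩ => ⟨t', h1, by omega⟩

theorem pair_map {μ : PMF α} {ν : PMF β} {f : α → Val} {g : β → Val}
    (hp : Sem h p v n (μ.map f)) (hr : Sem h r v m (ν.map g)) :
    Sem h (.pair p r) v (n + m) (μ.bind fun a => ν.map fun b => .cons (f a) (g b)) :=
  (hp.pair hr).congr (by simp only [PMF.bind_map, PMF.map_comp]; rfl)

theorem pair_map_pure {μ : PMF α} {f : α → Val} {b : Val}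
    (hp : Sem h p v n (μ.map f)) (hr : Sem h r v m (PMF.pure b)) :
    Sem h (.pair p r) v (n + m) (μ.map fun a => .cons (f a) b) :=
  (hp.pair hr).congr (by simp only [PMF.bind_map, PMF.pure_map]; rfl)

theorem pair_pure_map {μ : PMF α} {f : α → Val} {b : Val}
    (hr : Sem h r v m (PMF.pure b)) (hp : Sem h p v n (μ.map f)) :
    Sem h (.pair r p) v (m + n) (μ.map fun a => .cons b (f a)) :=
  (hr.pair hp).congr (by simp only [PMF.pure_bind, PMF.map_comp]; rfl)

theorem seq_map_pure {μ : PMF α} {f g : α → Val} (hp : Sem h p v n (μ.map f))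
    (hr : ∀ x ∈ μ.support, Sem h r (f x) m (PMF.pure (g x))) :
    Sem h (.seq p r) v (n + m) (μ.map g) := hp.seq_map hr

end Sem

/-- A coin that shows `true` with probability `2 / (n + 2)`. -/
def coinLaw (n : ℕ) : PMF Bool :=
  (PMF.uniformOfFintype (Fin (n + 1 + 1))).map fun i : Fin _ => decide ((i : ℕ) < 2)

/-- The numbers below 2 are those with at most one binary digit, so a coin is read off from the tail
of the drawn number. -/
theorem Val.isCons_snd_ofNat (i : ℕ) : (ofNat i).snd.isCons = !decide (i < 2) := by
  have h1 : ∀ l : List Bool, (ofBits l).snd.isCons = decide (1 < l.length) := by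
    intro l
    rcases l with _ | ⟨a, _ | ⟨b, l⟩⟩ <;> simp [ofBits, snd, isCons]
  have h2 : 1 < i.size ↔ ¬i < 2 := by rw [Nat.lt_size, pow_one, not_lt]
  rw [ofNat, h1, Nat.size_eq_bits_len, decide_eq_decide.2 h2, decide_not]

/-! ### The simulation as a random process, apart from its code -/

namespace BilinearGen

variable (B : BilinearGen) (pp : B.Param)

/-- The elements `g^a`, `g^b`, `g^c` and `Z` of an input of the DBDH problem. -/
structure Challenge where
  ga : B.G pp
  gb : B.G pp
  gc : B.G pp
  Z : B.G₁ pp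

/-- What the simulation knows about an identity: its coin, its hash value, and the decryption key
and the challenge key to be given out if they are asked for. -/
structure Entry where
  id : Val
  coin : Bool
  hash : B.G pp
  dkey : B.G pp
  ckey : B.G₁ pp

/-- The state of the simulation: whether a coin was wrong, the number of the decryption key queries
left, the table of the entries. -/
structure State where
  bad : Bool
  cnt : ℕ
  tab : List (B.Entry pp)

variable {B pp}

def Entry.enc (e : B.Entry pp) : Val :=
  .cons e.id (.cons (.ofBool e.coin) (.cons (.ofBits (B.encG pp e.hash))
    (.cons (.ofBits (B.encG pp e.dkey)) (.ofBits (B.encG₁ pp e.ckey)))))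

def encTable : List (B.Entry pp) → Val
  | [] => .nil
  | e :: l => .cons e.enc (encTable l)

def State.enc (cst : Val) (s : B.State pp) : Val :=
  .cons cst (.cons (.ofBool s.bad) (.cons (.unary s.cnt) (encTable s.tab)))

def Challenge.enc (x : B.Challenge pp) (k : ℕ) : Val :=
  .cons (B.header k pp) (.cons (.ofBits (B.encG pp x.ga)) (.cons (.ofBits (B.encG pp x.gb))
    (.cons (.ofBits (B.encG pp x.gc)) (.ofBits (B.encG₁ pp x.Z)))))

/-- The visible entry for an identity. -/
def State.find (s : B.State pp) (id : List Bool) : Option (B.Entry pp) :=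
  s.tab.find? fun e => e.id.toBits = id

/-- The new entry for an identity. -/
def Challenge.entry (x : B.Challenge pp) (v : Val) (b : Bool) (i : ℕ) : B.Entry pp :=
  ⟨v, b, (if b then x.gb else B.g pp) ^ (i + 1), x.ga ^ (i + 1), x.Z ^ (i + 1)⟩

def State.push (s : B.State pp) (e : B.Entry pp) : B.State pp := { s with tab := e :: s.tab }

/-- Look up the entry for an identity, or create it. -/
def Challenge.ensure (x : B.Challenge pp) (n : ℕ) (v : Val) (s : B.State pp) :
    PMF (B.Entry pp × B.State pp) :=
  match s.find v.toBits with
  | some e => PMF.pure (e, s)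
  | none => (coinLaw n).bind fun b =>
      (PMF.uniformOfFintype (Fin (B.q pp - 2 + 1))).map fun i : Fin _ =>
        (x.entry v b i, s.push (x.entry v b i))

/-- Use an entry, whose coin should show `want`; afterwards its coin is tossed again. -/
def Entry.use (n : ℕ) (want : Bool) (y : B.Entry pp × B.State pp) :
    PMF (B.Entry pp × B.State pp) :=
  (coinLaw n).map fun b =>
    (y.1, { y.2 with
      bad := if y.1.coin = want then y.2.bad else true
      tab := { y.1 with coin := b } :: y.2.tab })

/-- The simulated oracles. -/
def Challenge.oracle (x : B.Challenge pp) (n : ℕ) :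
    AdvOracle → Val → B.State pp → PMF (Val × B.State pp)
  | .hash, v, s => (x.ensure n v s).map fun y => (.ofBits (B.encG pp y.1.hash), y.2)
  | .extract, v, s => ((x.ensure n v s).bind (Entry.use n false)).map fun y =>
      (.ofBits (B.encG pp y.1.dkey), { y.2 with cnt := y.2.cnt - 1 })
  | .challenge, v, s => ((x.ensure n v.fst s).bind (Entry.use n true)).bind fun y₀ =>
      ((x.ensure n v.snd y₀.2).bind (Entry.use n true)).map fun y₁ =>
        (.cons (.ofBits (B.encG₁ pp y₀.1.ckey)) (.ofBits (B.encG pp x.gc)), y₁.2)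

end BilinearGen

/-! ### The code of the simulated oracles -/

namespace Prog

variable {O : Type}

/-- The part of the table on the input `(v, st)`. -/
def ensureCode (mulG mulG₁ : Prog O) : Prog O :=
  .pair (.pair .fst (.snd ⨾ .snd ⨾ .snd ⨾ .snd) ⨾ lookup) .id ⨾
  .ite .fst (.pair .fst (.snd ⨾ .snd))
    (.snd ⨾
      .pair (.snd ⨾ .fst ⨾ .snd ⨾ .snd ⨾ .rand ⨾ not .snd)
        (.pair (.snd ⨾ .fst ⨾ .snd ⨾ .fst ⨾ .rand) .id) ⨾
      .pair
        (.pair (.snd ⨾ .snd ⨾ .fst) (.pair .fst (.pair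
          (.pair (.snd ⨾ .snd ⨾ .snd ⨾ .fst ⨾ .fst ⨾ .fst)
            (.pair (.ite .fst (.snd ⨾ .snd ⨾ .snd ⨾ .fst ⨾ .fst ⨾ .snd ⨾ .snd ⨾ .fst)
              (.snd ⨾ .snd ⨾ .snd ⨾ .fst ⨾ .fst ⨾ .fst ⨾ .snd ⨾ .snd ⨾ .snd)) (.snd ⨾ .fst)) ⨾
            pow mulG)
          (.pair
            (.pair (.snd ⨾ .snd ⨾ .snd ⨾ .fst ⨾ .fst ⨾ .fst)
              (.pair (.snd ⨾ .snd ⨾ .snd ⨾ .fst ⨾ .fst ⨾ .snd ⨾ .fst) (.snd ⨾ .fst)) ⨾ pow mulG)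
            (.pair (.snd ⨾ .snd ⨾ .snd ⨾ .fst ⨾ .fst ⨾ .fst)
              (.pair (.snd ⨾ .snd ⨾ .snd ⨾ .fst ⨾ .fst ⨾ .snd ⨾ .snd ⨾ .snd ⨾ .snd) (.snd ⨾ .fst)) ⨾
                pow mulG₁)))))
        (.snd ⨾ .snd ⨾ .snd) ⨾
      .pair .fst (.pair (.snd ⨾ .fst) (.pair (.snd ⨾ .snd ⨾ .fst) (.pair (.snd ⨾ .snd ⨾ .snd ⨾ .fst)
        (.pair .fst (.snd ⨾ .snd ⨾ .snd ⨾ .snd))))))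

def useCode (want : Bool) : Prog O :=
  .pair (.snd ⨾ .fst ⨾ .snd ⨾ .snd ⨾ .rand ⨾ not .snd) .id ⨾
  .pair (.snd ⨾ .fst) (.pair (.snd ⨾ .snd ⨾ .fst) (.pair
    (.ite (test want (.snd ⨾ .fst ⨾ .snd ⨾ .fst)) (.snd ⨾ .snd ⨾ .snd ⨾ .fst) tt)
    (.pair (.snd ⨾ .snd ⨾ .snd ⨾ .snd ⨾ .fst)
      (.pair (.pair (.snd ⨾ .fst ⨾ .fst) (.pair .fst (.snd ⨾ .fst ⨾ .snd ⨾ .snd)))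
        (.snd ⨾ .snd ⨾ .snd ⨾ .snd ⨾ .snd)))))

/-- The code of the simulated oracles. -/
def oracleCode (mulG mulG₁ : Prog O) : AdvOracle → Prog O
  | .hash => ensureCode mulG mulG₁ ⨾ .pair (.fst ⨾ .snd ⨾ .snd ⨾ .fst) .snd
  | .extract => ensureCode mulG mulG₁ ⨾ useCode false ⨾
      .pair (.fst ⨾ .snd ⨾ .snd ⨾ .snd ⨾ .fst) (.pair (.snd ⨾ .fst) (.pair (.snd ⨾ .snd ⨾ .fst)
        (.pair (.snd ⨾ .snd ⨾ .snd ⨾ .fst ⨾ .snd) (.snd ⨾ .snd ⨾ .snd ⨾ .snd))))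
  | .challenge =>
      .pair (.pair (.fst ⨾ .fst) .snd ⨾ (ensureCode mulG mulG₁ ⨾ useCode true)) (.fst ⨾ .snd) ⨾
      .pair (.fst ⨾ .fst) (.pair .snd (.fst ⨾ .snd) ⨾ (ensureCode mulG mulG₁ ⨾ useCode true)) ⨾
      .pair (.pair (.fst ⨾ .snd ⨾ .snd ⨾ .snd ⨾ .snd)
        (.snd ⨾ .snd ⨾ .fst ⨾ .fst ⨾ .snd ⨾ .snd ⨾ .snd ⨾ .fst)) (.snd ⨾ .snd)

end Prog

/-! ### The code realizes the simulated oracles within a time bound -/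

namespace BilinearGen

variable {O : Type} {h : O → Val → PMF Val} {mulG mulG₁ : Prog O} {B : BilinearGen} {pp : B.Param}
  {k n N l : ℕ} {Q R : Val}

/-- The constants of the simulation: `Q` and `R` are the ranges of the random exponents and of the
coins. -/
def Challenge.consts (x : B.Challenge pp) (k : ℕ) (Q R : Val) : Val :=
  .cons (x.enc k) (.cons Q R)

theorem sem_rand {p : Prog O} {v : Val} {m j : ℕ} (hp : Sem h p v m (PMF.pure Q))
    (hQ : Q.toNat = j) : Sem h (p ⨾ .rand) v (m + 1)
      ((PMF.uniformOfFintype (Fin (j + 1))).map fun i : Fin _ => Val.ofNat (i : ℕ)) := by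
  subst hQ
  exact hp.seq' Sem.rand

theorem sem_coin {p : Prog O} {v : Val} {m : ℕ} (hp : Sem h p v m (PMF.pure R))
    (hR : R.toNat = n + 1) :
    Sem h (p ⨾ .rand ⨾ .not .snd) v (m + 4) ((coinLaw n).map Val.ofBool) := by
  rw [coinLaw, PMF.map_comp]
  refine (sem_rand hp hR).seq_map_pure (m := 3) fun i _ => ?_
  refine (Sem.not (n := 1) (Sem.straight' rfl rfl rfl)).congr ?_
  rw [Function.comp_apply]
  congr 2
  simp [Prog.den, Val.isCons_snd_ofNat]

theorem sem_use (cst0 : Val) (hR : R.toNat = n + 1) (want : Bool) (y : B.Entry pp × B.State pp) :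
    Sem h (Prog.useCode want) (.cons y.1.enc (y.2.enc (.cons cst0 (.cons Q R)))) 100
      ((Entry.use n want y).map fun y => .cons y.1.enc (y.2.enc (.cons cst0 (.cons Q R)))) := by
  obtain ⟨e, s⟩ := y
  rw [Entry.use, PMF.map_comp]
  refine (((sem_coin (R := R) (Sem.straight' (k := 4) rfl rfl rfl) hR).pair_map_pure
    Sem.id).seq_map_pure (m := 70) fun b _ => ?_).mono (by omega)
  obtain ⟨u, hu, hu'⟩ := Sem.test (h := h) want (p := .snd ⨾ .fst ⨾ .snd ⨾ .fst)
    (v := .cons (.ofBool b) (.cons e.enc (s.enc (.cons cst0 (.cons Q R))))) (n := 4)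
    (Sem.straight' rfl rfl rfl)
  have h1 := Sem.ite' (p := .snd ⨾ .snd ⨾ .snd ⨾ .fst) (r := Prog.tt) (k := 4)
    (f := fun b => PMF.pure (.ofBool (if b = true then s.bad else true))) hu
    (fun _ => Sem.straight' rfl rfl rfl) (fun _ => Sem.straight' rfl rfl rfl)
  rw [hu'] at h1
  refine ((Sem.straight' (k := 2) (w := e.enc) rfl rfl rfl).pair'
    ((Sem.straight' (k := 3) (w := .cons cst0 (.cons Q R)) rfl rfl rfl).pair' (h1.pair'
    ((Sem.straight' (k := 5) (w := .unary s.cnt) rfl rfl rfl).pair'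
    (Sem.straight' (k := 20) (w := encTable ({ e with coin := b } :: s.tab)) rfl rfl rfl))))).mono
      (by omega) |>.congr ?_
  have h2 : (Val.ofBool e.coin).isCons = e.coin := Val.isCons_ofBool _
  simp only [Function.comp_apply, State.enc, Prog.den, Entry.enc, Val.fst, Val.snd, h2,
    beq_iff_eq]

/-- A bound for the time that the code of the simulated oracles takes. -/
def ensureTime (N l M L : ℕ) : ℕ := (30 * M + 50) * (L + 1) + 3 * ((2 * N + 50) * (l + 1)) + 200

theorem sem_ensure (x : B.Challenge pp)
    (hG : ∀ y z : B.G pp, Sem h mulG (.cons (B.header k pp) (.cons (.ofBits (B.encG pp y))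
      (.ofBits (B.encG pp z)))) N (PMF.pure (.ofBits (B.encG pp (y * z)))))
    (hG₁ : ∀ y z : B.G₁ pp, Sem h mulG₁ (.cons (B.header k pp) (.cons (.ofBits (B.encG₁ pp y))
      (.ofBits (B.encG₁ pp z)))) N (PMF.pure (.ofBits (B.encG₁ pp (y * z)))))
    (hQ : Q.toNat = B.q pp - 2) (hQl : Q.toBits.length ≤ l) (hR : R.toNat = n + 1) (v : Val)
    (s : B.State pp) :
    Sem h (Prog.ensureCode mulG mulG₁) (.cons v (s.enc (x.consts k Q R)))
      (ensureTime N l v.toBits.length s.tab.length)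
      ((x.ensure n v s).map fun y => .cons y.1.enc (y.2.enc (x.consts k Q R))) := by
  have hlook : Sem h Prog.lookup (.cons v (encTable s.tab))
      ((30 * v.toBits.length + 50) * (s.tab.length + 1))
      (PMF.pure (match s.find v.toBits with
        | some e => .cons e.id e.enc.snd
        | none => .nil)) :=
    (Sem.lookup Entry.id (fun e : B.Entry pp => e.enc.snd) v s.tab encTable rfl
      fun _ _ => rfl).congr (by
        rw [State.find]
        cases s.tab.find? fun e => e.id.toBits = v.toBits <;> rfl)
  have hlook' := (((Sem.straight' (k := 5) (p := .pair .fst (.snd ⨾ .snd ⨾ .snd ⨾ .snd))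
    (v := .cons v (s.enc (x.consts k Q R))) rfl rfl rfl).seq' hlook).pair' Sem.id)
  rw [Challenge.ensure]
  rcases hf : s.find v.toBits with _ | e
  · simp only [hf] at hlook' ⊢
    refine (hlook'.seq' (Sem.ite_nil (n := 1) (Sem.straight' rfl rfl rfl) ?_)).mono
      (n := 5 + (30 * v.toBits.length + 50) * (s.tab.length + 1) + 1 +
        (1 + (3 * ((2 * N + 50) * (l + 1)) + 170))) (by rw [ensureTime]; omega)
    have h1 := ((Sem.straight' (k := 1) (p := .snd)
      (v := .cons Val.nil (.cons v (s.enc (x.consts k Q R)))) rfl rfl rfl).seq'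
      ((sem_coin (h := h) (R := R) (Sem.straight' (k := 4) (p := .snd ⨾ .fst ⨾ .snd ⨾ .snd)
      rfl rfl rfl) hR).pair_map ((sem_rand (Q := Q) (Sem.straight' (k := 4)
      (p := .snd ⨾ .fst ⨾ .snd ⨾ .fst) rfl rfl rfl) hQ).pair_map_pure Sem.id)))
    -- Coin and exponent are regarded as a single draw, on which everything that follows depends
    -- deterministically.
    let μ : PMF (Bool × Fin (B.q pp - 2 + 1)) := (coinLaw n).bind fun b =>
      (PMF.uniformOfFintype (Fin (B.q pp - 2 + 1))).map fun i => (b, i)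
    let f : Bool × Fin (B.q pp - 2 + 1) → Val := fun z => .cons (.ofBool z.1)
      (.cons (.ofNat z.2) (.cons v (s.enc (x.consts k Q R))))
    have h2 := h1.congr (ν := μ.map f) (by
      simp only [μ, PMF.map_bind, PMF.map_comp]
      rfl)
    have h3 : ((coinLaw n).bind fun b =>
        (PMF.uniformOfFintype (Fin (B.q pp - 2 + 1))).map fun i : Fin _ =>
        (x.entry v b i, s.push (x.entry v b i))).map
        (fun y => .cons y.1.enc (y.2.enc (x.consts k Q R))) = μ.map fun z =>
        Val.cons (x.entry v z.1 z.2).enc ((s.push (x.entry v z.1 z.2)).enc (x.consts k Q R)) := by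
      simp only [μ, PMF.map_bind, PMF.map_comp]
      rfl
    rw [h3]
    refine Sem.mono (n := 15 + (3 * ((2 * N + 50) * (l + 1)) + 90) + 20) (Sem.seq_map_pure
      (f := fun z => .cons (x.entry v z.1 z.2).enc (s.enc (x.consts k Q R)))
      (Sem.seq_map_pure h2 fun z _ => ?_) fun z _ => Sem.straight' rfl rfl rfl) (by omega)
    obtain ⟨b, i⟩ := z
    -- The drawn exponent is at most the value of `Q`, so it has no more binary digits than `Q`.
    -- This bounds the cost of the three powers.
    have hi : (Val.ofNat i).toBits.length ≤ l := by
      rw [Val.ofNat, Val.toBits_ofBits]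
      refine (Val.length_bits_le ?_).trans hQl
      refine lt_of_le_of_lt ?_ (Val.foldr_bit_lt Q.toBits)
      have := i.2
      rw [← Val.toNat, hQ]
      omega
    have hc : (2 * N + 50) * ((Val.ofNat i).toBits.length + 1) ≤ (2 * N + 50) * (l + 1) := by gcongr
    have h4 := fun y => (Sem.pow (fun y => .ofBits (B.encG pp y)) (B.header k pp) mulG N hG y
      (Val.ofNat i)).mono hc
    have h5 := fun y => (Sem.pow (fun y => .ofBits (B.encG₁ pp y)) (B.header k pp) mulG₁ N hG₁ y
      (Val.ofNat i)).mono hc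
    rw [Val.toNat_ofNat] at h4 h5
    have h6 : Sem h (.ite .fst (.snd ⨾ .snd ⨾ .snd ⨾ .fst ⨾ .fst ⨾ .snd ⨾ .snd ⨾ .fst)
        (.snd ⨾ .snd ⨾ .snd ⨾ .fst ⨾ .fst ⨾ .fst ⨾ .snd ⨾ .snd ⨾ .snd)) (f (b, i)) (1 + 9)
        (PMF.pure (.ofBits (B.encG pp (if b then x.gb else B.g pp)))) := by
      have := Sem.ite' (h := h) (c := .fst) (v := f (b, i)) (n := 1)
        (p := .snd ⨾ .snd ⨾ .snd ⨾ .fst ⨾ .fst ⨾ .snd ⨾ .snd ⨾ .fst)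
        (r := .snd ⨾ .snd ⨾ .snd ⨾ .fst ⨾ .fst ⨾ .fst ⨾ .snd ⨾ .snd ⨾ .snd) (k := 9)
        (f := fun b => PMF.pure (.ofBits (B.encG pp (if b = true then x.gb else B.g pp))))
        (w := .ofBool b) (Sem.straight' rfl rfl rfl)
        (fun _ => Sem.straight' rfl rfl rfl) (fun _ => Sem.straight' rfl rfl rfl)
      rwa [Val.isCons_ofBool] at this
    have hhd : Sem h (.snd ⨾ .snd ⨾ .snd ⨾ .fst ⨾ .fst ⨾ .fst) (f (b, i)) 6
        (PMF.pure (B.header k pp)) := Sem.straight' rfl rfl rfl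
    have hr : Sem h (.snd ⨾ .fst) (f (b, i)) 2 (PMF.pure (.ofNat i)) := Sem.straight' rfl rfl rfl
    refine ((((Sem.straight' (k := 3) (w := v) rfl rfl rfl).pair'
      ((Sem.straight' (k := 1) (w := .ofBool b) rfl rfl rfl).pair'
      (((hhd.pair' (h6.pair' hr)).seq' (h4 _)).pair'
      (((hhd.pair' ((Sem.straight' (k := 7) (w := .ofBits (B.encG pp x.ga)) rfl rfl rfl).pair' hr)).seq'
        (h4 _)).pair'
      ((hhd.pair' ((Sem.straight' (k := 9) (w := .ofBits (B.encG₁ pp x.Z)) rfl rfl rfl).pair' hr)).seq'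
        (h5 _)))))).pair' (Sem.straight' (k := 3) rfl rfl rfl)).mono (by omega)).congr ?_
    rfl
  · simp only [hf] at hlook' ⊢
    refine (hlook'.seq' (Sem.ite_cons (n := 1) (a := e.id) (b := e.enc.snd)
      (Sem.straight' rfl rfl rfl) (Sem.straight' (k := 3) rfl rfl rfl))).mono ?_ |>.congr ?_
    · rw [ensureTime]
      omega
    · rw [PMF.pure_map]
      rfl

theorem State.length_ensure (x : B.Challenge pp) (v : Val) (s : B.State pp) :
    ∀ y ∈ (x.ensure n v s).support, y.2.tab.length ≤ s.tab.length + 1 ∧ y.2.cnt = s.cnt := by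
  intro y hy
  rw [Challenge.ensure] at hy
  rcases hf : s.find v.toBits with _ | e
  · rw [hf] at hy
    simp only [PMF.mem_support_bind_iff, PMF.mem_support_map_iff] at hy
    obtain ⟨b, -, i, -, rfl⟩ := hy
    simp [State.push]
  · rw [hf] at hy
    simp only [PMF.support_pure, Set.mem_singleton_iff] at hy
    subst hy
    simp

theorem State.length_use (want : Bool) (y : B.Entry pp × B.State pp) :
    ∀ z ∈ (Entry.use n want y).support,
      z.2.tab.length = y.2.tab.length + 1 ∧ z.2.cnt = y.2.cnt := by
  intro z hz
  rw [Entry.use, PMF.mem_support_map_iff] at hz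
  obtain ⟨b, -, rfl⟩ := hz
  simp

theorem State.length_ensure_use (want : Bool) (x : B.Challenge pp) (v : Val) (s : B.State pp) :
    ∀ y ∈ ((x.ensure n v s).bind (Entry.use n want)).support,
      y.2.tab.length ≤ s.tab.length + 2 ∧ y.2.cnt = s.cnt := by
  intro y hy
  rw [PMF.mem_support_bind_iff] at hy
  obtain ⟨z, hz, hy⟩ := hy
  have h1 := State.length_use want z y hy
  have h2 := State.length_ensure x v s z hz
  omega

/-- The code of the simulated oracles runs in polynomial time. -/
theorem sem_oracleCode (x : B.Challenge pp)
    (hG : ∀ y z : B.G pp, Sem h mulG (.cons (B.header k pp) (.cons (.ofBits (B.encG pp y))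
      (.ofBits (B.encG pp z)))) N (PMF.pure (.ofBits (B.encG pp (y * z)))))
    (hG₁ : ∀ y z : B.G₁ pp, Sem h mulG₁ (.cons (B.header k pp) (.cons (.ofBits (B.encG₁ pp y))
      (.ofBits (B.encG₁ pp z)))) N (PMF.pure (.ofBits (B.encG₁ pp (y * z)))))
    (hQ : Q.toNat = B.q pp - 2) (hQl : Q.toBits.length ≤ l) (hR : R.toNat = n + 1)
    (o : AdvOracle) (v : Val) (s : B.State pp) {M L : ℕ} (hv : v.height ≤ M)
    (hs : s.tab.length + 4 ≤ L) :
    Sem h (Prog.oracleCode mulG mulG₁ o) (.cons v (s.enc (x.consts k Q R)))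
      (2 * ensureTime N l M L + 300)
      ((x.oracle n o v s).map fun y => .cons y.1 (y.2.enc (x.consts k Q R))) := by
  have hens : ∀ (v : Val) (s : B.State pp), v.height ≤ M → s.tab.length ≤ L →
      Sem h (Prog.ensureCode mulG mulG₁) (.cons v (s.enc (x.consts k Q R))) (ensureTime N l M L)
      ((x.ensure n v s).map fun y => .cons y.1.enc (y.2.enc (x.consts k Q R))) := by
    intro v s hv hs
    refine (sem_ensure x hG hG₁ hQ hQl hR v s).mono ?_
    have := v.length_toBits_le.trans hv
    unfold ensureTime
    gcongr
  have hensuse : ∀ (want : Bool) (v : Val) (s : B.State pp), v.height ≤ M → s.tab.length ≤ L →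
      Sem h (Prog.ensureCode mulG mulG₁ ⨾ Prog.useCode want) (.cons v (s.enc (x.consts k Q R)))
      (ensureTime N l M L + 100) (((x.ensure n v s).bind (Entry.use n want)).map
        fun y => .cons y.1.enc (y.2.enc (x.consts k Q R))) := by
    intro want v s hv hs
    rw [PMF.map_bind]
    exact (hens v s hv hs).seq_map fun y _ => sem_use _ hR want y
  cases o with
  | hash =>
    rw [Challenge.oracle, PMF.map_comp]
    exact ((hens v s hv (by omega)).seq_map_pure (m := 5) fun y _ =>
      Sem.straight' rfl rfl rfl).mono (by omega)
  | extract =>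
    rw [Challenge.oracle, PMF.map_comp]
    refine ((hensuse false v s hv (by omega)).seq_map_pure (m := 22) fun y _ =>
      Sem.straight' rfl ?_ rfl).mono (by omega)
    simp only [Prog.den, State.enc, Val.snd, Val.fst, Entry.enc, Function.comp_apply]
    cases y.2.cnt <;> rfl
  | challenge =>
    rw [Challenge.oracle, PMF.map_bind]
    have h1 := ((Sem.straight' (h := h) (k := 3) (p := .pair (.fst ⨾ .fst) .snd)
      (v := .cons v (s.enc (x.consts k Q R))) (w := .cons v.fst (s.enc (x.consts k Q R)))
      rfl rfl rfl).seq' (hensuse true v.fst s (v.height_fst_le.trans hv) (by omega))).pair_map_pure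
      (Sem.straight' (k := 2) (p := .fst ⨾ .snd) (w := v.snd) rfl rfl rfl)
    have h2 := fun (y₀ : B.Entry pp × B.State pp) (hy₀ : y₀.2.tab.length ≤ L) =>
      (Sem.straight' (h := h) (k := 2) (p := .fst ⨾ .fst)
      (v := .cons (.cons y₀.1.enc (y₀.2.enc (x.consts k Q R))) v.snd) (w := y₀.1.enc)
      rfl rfl rfl).pair_pure_map ((Sem.straight' (k := 3) (p := .pair .snd (.fst ⨾ .snd))
      (w := .cons v.snd (y₀.2.enc (x.consts k Q R))) rfl rfl rfl).seq'
      (hensuse true v.snd y₀.2 (v.height_snd_le.trans hv) hy₀))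
    rw [Prog.oracleCode]
    have h3 := Sem.seq_map h1 fun y₀ hy₀ => (h2 y₀ (by
      have := State.length_ensure_use true x v.fst s y₀ hy₀
      omega)).seq_map_pure (m := 15) (r := .pair (.pair (.fst ⨾ .snd ⨾ .snd ⨾ .snd ⨾ .snd)
        (.snd ⨾ .snd ⨾ .fst ⨾ .fst ⨾ .snd ⨾ .snd ⨾ .snd ⨾ .fst)) (.snd ⨾ .snd))
        (g := fun y₁ => .cons (.cons (.ofBits (B.encG₁ pp y₀.1.ckey)) (.ofBits (B.encG pp x.gc)))
          (y₁.2.enc (x.consts k Q R))) fun y₁ _ => Sem.straight' rfl rfl rfl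
    have h4 := h3.mono (m := 2 * ensureTime N l M L + 300) (by omega)
    simp only [PMF.map_comp]
    intro t ht
    rw [Prog.exec_assoc]
    exact h4 t ht

end BilinearGen

/-! ## The solver of the DBDH problem -/

namespace Prog

variable {O : Type}

/-- From the challenge and the unary number of decryption key queries to the input of the adversary
and the initial state. -/
def initCode (queries : Prog O) : Prog O :=
  .pair .id (.fst ⨾ .fst ⨾ queries) ⨾
  .pair (.pair (.fst ⨾ .fst) (.fst ⨾ .snd ⨾ .fst))
    (.pair (.pair .fst (.pair (.fst ⨾ .fst ⨾ .snd ⨾ .fst ⨾ carry false ⨾ carry false)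
      (.snd ⨾ toBinary))) (.pair .nil (.pair .snd .nil)))

/-- Toss the coins that are left, and output a bit. -/
def finishCode : Prog O :=
  .loop (.snd ⨾ .snd ⨾ .snd ⨾ .fst)
    (.pair (.snd ⨾ .fst ⨾ .snd ⨾ .snd ⨾ .rand ⨾ not .snd) .id ⨾
      .pair (.snd ⨾ .fst) (.pair (.snd ⨾ .snd ⨾ .fst) (.pair
        (.ite .fst tt (.snd ⨾ .snd ⨾ .snd ⨾ .fst))
        (.pair (.snd ⨾ .snd ⨾ .snd ⨾ .snd ⨾ .fst ⨾ .snd) (.snd ⨾ .snd ⨾ .snd ⨾ .snd ⨾ .snd))))) ⨾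
  .pair (.pair tt .nil ⨾ .rand) .id ⨾
  .ite .fst .nil (.ite (.snd ⨾ .snd ⨾ .snd ⨾ .fst) .nil (not (.snd ⨾ .fst)))

/-- The solver built from an adversary. -/
def solver (A : Prog AdvOracle) (queries mulG mulG₁ : Prog O) : Prog O :=
  initCode queries ⨾ A.compile (oracleCode mulG mulG₁) ⨾ finishCode

end Prog

/-- The output bit of the solver, given the number of the coins left, whether a coin was wrong, and
the output of the adversary. -/
def finishLaw (n : ℕ) : ℕ → Bool → Bool → PMF Bool
  | 0, bad, out => (PMF.uniformOfFintype (Fin (1 + 1))).map fun i : Fin _ =>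
      decide ((i : ℕ) = 0) && (!bad && !out)
  | c + 1, bad, out => (coinLaw n).bind fun b => finishLaw n c (if b = true then true else bad) out

/-! ### Correctness and running time of the solver -/

namespace BilinearGen

variable {O : Type} {h : O → Val → PMF Val} {queries mulG mulG₁ : Prog O} {B : BilinearGen}
  {pp : B.Param} {k n N l : ℕ} {Q R : Val}

theorem _root_.Sem.loop_step_map {α : Type} {p c : Prog O} {v a b : Val} {n m l : ℕ} {μ : PMF α}
    {f : α → Val} {κ : α → PMF Val} (hc : Sem h c v n (PMF.pure (.cons a b)))
    (hp : Sem h p v m (μ.map f)) (hl : ∀ x ∈ μ.support, Sem h (.loop c p) (f x) l (κ x)) :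
    Sem h (.loop c p) v (n + m + l) (μ.bind κ) := by
  intro t ht
  rw [Prog.exec_loop, ← PMF.pure_bind (Val.cons a b) (fun _ => μ.bind κ)]
  refine (hc t (by omega)).bind fun w hw y _ ⟨t', h1, h2⟩ => ?_
  simp only [PMF.support_pure, Set.mem_singleton_iff] at hw
  subst h1 hw
  refine ((hp t' (by omega)).of_map).bind fun w hw y _ ⟨t'', h1, h3⟩ => ?_
  subst h1
  exact (hl w hw t'' (by omega)).mono fun w _ y _ ⟨t', h1, h2⟩ => ⟨t', h1, by omega⟩

theorem _root_.Val.isCons_ofNat (i : ℕ) : (Val.ofNat i).isCons = !decide (i = 0) := by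
  have h1 : ∀ l : List Bool, (Val.ofBits l).isCons = decide (0 < l.length) := by
    intro l
    rcases l with _ | ⟨a, l⟩ <;> simp [Val.ofBits, Val.isCons]
  have h2 : 0 < i.size ↔ ¬i = 0 := by rw [Nat.size_pos, Nat.pos_iff_ne_zero]
  rw [Val.ofNat, h1, Nat.size_eq_bits_len, decide_eq_decide.2 h2, decide_not]

theorem _root_.Sem.assoc {p q r : Prog O} {v : Val} {m : ℕ} {μ : PMF Val}
    (hs : Sem h (p ⨾ (q ⨾ r)) v m μ) : Sem h (p ⨾ q ⨾ r) v m μ := by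
  intro t ht
  rw [Prog.exec_assoc]
  exact hs t ht

/-- A challenge looks up two identities and uses both, and each of these four actions adds at most
one entry. This is the source of the constant 4 in the bounds for the table. -/
theorem length_oracle (x : B.Challenge pp) {H : ℕ} (hH₁ : ∀ y, (B.encG pp y).length + 2 ≤ H)
    (hH₂ : ∀ y, (B.encG₁ pp y).length + 2 ≤ H) (o : AdvOracle) (v : Val) (s : B.State pp) :
    ∀ y ∈ (x.oracle n o v s).support,
      y.2.tab.length ≤ s.tab.length + 4 ∧ y.2.cnt ≤ s.cnt ∧ y.1.height ≤ H := by
  have hof := Val.height_ofBits_le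
  intro y hy
  cases o with
  | hash =>
    rw [Challenge.oracle, PMF.mem_support_map_iff] at hy
    obtain ⟨z, hz, rfl⟩ := hy
    have h1 := State.length_ensure x v s z hz
    have h2 := hof (B.encG pp z.1.hash)
    have h3 := hH₁ z.1.hash
    simp only
    omega
  | extract =>
    rw [Challenge.oracle, PMF.mem_support_map_iff] at hy
    obtain ⟨z, hz, rfl⟩ := hy
    have h1 := State.length_ensure_use false x v s z hz
    have h2 := hof (B.encG pp z.1.dkey)
    have h3 := hH₁ z.1.dkey
    simp only
    omega
  | challenge =>
    rw [Challenge.oracle, PMF.mem_support_bind_iff] at hy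
    obtain ⟨z, hz, hy⟩ := hy
    rw [PMF.mem_support_map_iff] at hy
    obtain ⟨z', hz', rfl⟩ := hy
    have h1 := State.length_ensure_use true x _ s z hz
    have h1' := State.length_ensure_use true x _ _ z' hz'
    have h2 := hof (B.encG₁ pp z.1.ckey)
    have h3 := hH₂ z.1.ckey
    have h4 := hof (B.encG pp x.gc)
    have h5 := hH₁ x.gc
    simp only [Val.height]
    omega

theorem sem_finish (x : B.Challenge pp) (hR : R.toNat = n + 1) (out : Val) (c : ℕ) (bad : Bool)
    (tab : List (B.Entry pp)) :
    Sem h Prog.finishCode (.cons out (State.enc (x.consts k Q R) ⟨bad, c, tab⟩)) (50 * c + 50)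
      ((finishLaw n c bad out.isCons).map Val.ofBool) := by
  refine Sem.assoc ?_
  -- The loop stops with the counter at 0, and `ν` is the law of the flag and the table at that
  -- moment; only the fair coin is then left to toss.
  suffices h0 : ∃ ν : PMF (Bool × List (B.Entry pp)), Sem h (.loop (.snd ⨾ .snd ⨾ .snd ⨾ .fst)
    (.pair (.snd ⨾ .fst ⨾ .snd ⨾ .snd ⨾ .rand ⨾ .not .snd) .id ⨾
      .pair (.snd ⨾ .fst) (.pair (.snd ⨾ .snd ⨾ .fst) (.pair
        (.ite .fst .tt (.snd ⨾ .snd ⨾ .snd ⨾ .fst))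
        (.pair (.snd ⨾ .snd ⨾ .snd ⨾ .snd ⨾ .fst ⨾ .snd) (.snd ⨾ .snd ⨾ .snd ⨾ .snd ⨾ .snd))))))
    (.cons out (State.enc (x.consts k Q R) ⟨bad, c, tab⟩)) (50 * c + 5)
    (ν.map fun y => .cons out (State.enc (x.consts k Q R) ⟨y.1, 0, y.2⟩)) ∧
    finishLaw n c bad out.isCons = ν.bind fun y => finishLaw n 0 y.1 out.isCons by
    obtain ⟨ν, h1, h2⟩ := h0
    rw [h2, PMF.map_bind]
    refine Sem.mono (n := 50 * c + 5 + 40) (Sem.seq_map h1 fun y _ => ?_) (by omega)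
    rw [finishLaw, PMF.map_comp]
    refine Sem.mono (n := 4 + 1 + 20) ?_ (by omega)
    refine Sem.seq_map_pure ((sem_rand (Q := .cons (.ofBool true) .nil) (Sem.straight' (k := 3)
      rfl rfl rfl) rfl).pair_map_pure Sem.id) fun i _ => ?_
    have h3 := Sem.ite' (h := h) (c := .fst) (n := 1) (k := 14) (w := .ofNat i)
      (v := .cons (.ofNat i) (.cons out (State.enc (x.consts k Q R) ⟨y.1, 0, y.2⟩)))
      (p := .nil) (r := .ite (.snd ⨾ .snd ⨾ .snd ⨾ .fst) .nil (Prog.not (.snd ⨾ .fst)))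
      (f := fun b => PMF.pure (.ofBool (!b && (!y.1 && !out.isCons)))) (Sem.straight' rfl rfl rfl)
      (fun _ => Sem.straight' rfl rfl rfl) fun _ => ?_
    · rw [Val.isCons_ofNat] at h3
      refine (h3.mono (m := 20) (by omega)).congr ?_
      rw [Bool.not_not]
      rfl
    · have h4 := Sem.ite' (h := h) (c := .snd ⨾ .snd ⨾ .snd ⨾ .fst) (n := 4) (k := 6)
        (w := .ofBool y.1)
        (v := .cons (.ofNat i) (.cons out (State.enc (x.consts k Q R) ⟨y.1, 0, y.2⟩)))
        (p := .nil) (r := Prog.not (.snd ⨾ .fst))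
        (f := fun b => PMF.pure (.ofBool (!b && !out.isCons))) (Sem.straight' rfl rfl rfl)
        (fun _ => Sem.straight' rfl rfl rfl) fun _ => ?_
      · rw [Val.isCons_ofBool] at h4
        exact h4.mono (by omega)
      · exact (Sem.not (n := 2) (Sem.straight' rfl rfl rfl)).mono (by omega)
  induction c generalizing bad tab with
  | zero =>
    refine ⟨PMF.pure (bad, tab), ?_, by rw [PMF.pure_bind]⟩
    rw [PMF.pure_map]
    exact (Sem.loop_done (n := 4) (Sem.straight' rfl rfl rfl)).mono (by omega)
  | succ c ih =>
    choose ν h1 h2 using fun b : Bool => ih (if b = true then true else bad) tab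
    refine ⟨(coinLaw n).bind ν, ?_, ?_⟩
    · rw [PMF.map_bind]
      have h3 : Sem h (.pair (.snd ⨾ .fst ⨾ .snd ⨾ .snd ⨾ .rand ⨾ .not .snd) .id ⨾
          .pair (.snd ⨾ .fst) (.pair (.snd ⨾ .snd ⨾ .fst) (.pair
            (.ite .fst .tt (.snd ⨾ .snd ⨾ .snd ⨾ .fst))
            (.pair (.snd ⨾ .snd ⨾ .snd ⨾ .snd ⨾ .fst ⨾ .snd)
              (.snd ⨾ .snd ⨾ .snd ⨾ .snd ⨾ .snd)))))
          (.cons out (State.enc (x.consts k Q R) ⟨bad, c + 1, tab⟩)) 40 ((coinLaw n).map fun b =>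
            .cons out (State.enc (x.consts k Q R) ⟨if b = true then true else bad, c, tab⟩)) := by
        refine Sem.mono (n := 4 + 4 + 1 + 30) ?_ (by omega)
        refine Sem.seq_map_pure ((sem_coin (R := R) (Sem.straight' (k := 4) rfl rfl rfl)
          hR).pair_map_pure Sem.id) fun b _ => ?_
        have h3 := Sem.ite' (h := h) (c := .fst) (n := 1) (k := 4) (w := .ofBool b)
          (v := .cons (.ofBool b) (.cons out (State.enc (x.consts k Q R) ⟨bad, c + 1, tab⟩)))
          (p := .tt) (r := .snd ⨾ .snd ⨾ .snd ⨾ .fst)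
          (f := fun b => PMF.pure (.ofBool (if b = true then true else bad)))
          (Sem.straight' rfl rfl rfl)
          (fun _ => Sem.straight' rfl rfl rfl) fun _ => Sem.straight' rfl rfl rfl
        rw [Val.isCons_ofBool] at h3
        exact ((Sem.straight' (k := 2) (w := out) rfl rfl rfl).pair'
          ((Sem.straight' (k := 3) (w := x.consts k Q R) rfl rfl rfl).pair' (h3.pair'
          ((Sem.straight' (k := 6) (w := .unary c) rfl rfl rfl).pair'
          (Sem.straight' (k := 5) (w := encTable tab) rfl rfl rfl))))).mono (by omega)
      intro t ht
      have h5 : Sem h (Prog.loop (.snd ⨾ .snd ⨾ .snd ⨾ .fst) _)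
          (.cons out (State.enc (x.consts k Q R) ⟨bad, c + 1, tab⟩)) (4 + 40 + (50 * c + 5)) _ :=
        Sem.loop_step_map (a := .ofBool true) (b := .unary c) (Sem.straight' rfl rfl rfl) h3
          fun b _ => h1 b
      exact h5.mono (by omega) t ht
    · rw [finishLaw, PMF.bind_bind]
      congr 1
      funext b
      exact h2 b

/-- Draws start at 0 and `Prog.pow` adds one to the exponent, so the range `q - 2` yields the
exponents `1, …, q - 1`. The range `n + 1` gives the `n + 2` equally likely values behind a coin. -/
theorem sem_init (x : B.Challenge pp) {Tq : ℕ}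
    (hq : Sem h queries (.unary k) Tq (PMF.pure (.unary n)))
    (hl : (Val.ofNat (B.q pp)).toBits.length + 2 ≤ l) :
    ∃ Q R : Val, Q.toNat = B.q pp - 2 ∧ Q.toBits.length ≤ l ∧ R.toNat = n + 1 ∧
      Sem h (Prog.initCode queries) (x.enc k) (Tq + n * (16 * (1 + n) + 30) + 32 * l + 100)
        (PMF.pure (.cons (.cons (B.header k pp) (.ofBits (B.encG pp x.ga)))
          (State.enc (x.consts k Q R) (⟨false, n, []⟩ : B.State pp)))) := by
  have hqp := (B.q_prime pp).out.two_le
  obtain ⟨Q₁, h1, h2, h3⟩ := Sem.decrement (h := h) (Val.ofNat (B.q pp))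
    (by rw [Val.toNat_ofNat]; omega)
  rw [Val.toNat_ofNat] at h2
  obtain ⟨Q, h4, h5, h6⟩ := Sem.decrement (h := h) Q₁ (by omega)
  obtain ⟨R, h7, h8⟩ := Sem.toBinary (h := h) n
  refine ⟨Q, R, by omega, by omega, h8, ?_⟩
  have h9 := ((Sem.id (h := h) (v := x.enc k)).pair' ((Sem.straight' (k := 2) (p := .fst ⨾ .fst)
    rfl rfl rfl).seq' hq)).seq' (((Sem.straight' (k := 5)
    (p := .pair (.fst ⨾ .fst) (.fst ⨾ .snd ⨾ .fst)) rfl rfl rfl)).pair'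
    (((Sem.straight' (k := 1) (p := .fst) rfl rfl rfl).pair'
    ((((Sem.straight' (k := 4) (p := .fst ⨾ .fst ⨾ .snd ⨾ .fst) rfl rfl rfl).seq' h1).seq' h4).pair'
      ((Sem.straight' (k := 1) (p := .snd) rfl rfl rfl).seq' h7))).pair'
      (Sem.straight' (k := 3) (p := .pair .nil (.pair .snd .nil)) rfl rfl rfl)))
  exact h9.mono (by omega)

/-- The output of the solver, if it has enough time. -/
theorem coupled_solver (x : B.Challenge pp) (A : Prog AdvOracle) {T Tq M L H : ℕ}
    (hG : ∀ y z : B.G pp, Sem h mulG (.cons (B.header k pp) (.cons (.ofBits (B.encG pp y))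
      (.ofBits (B.encG pp z)))) N (PMF.pure (.ofBits (B.encG pp (y * z)))))
    (hG₁ : ∀ y z : B.G₁ pp, Sem h mulG₁ (.cons (B.header k pp) (.cons (.ofBits (B.encG₁ pp y))
      (.ofBits (B.encG₁ pp z)))) N (PMF.pure (.ofBits (B.encG₁ pp (y * z)))))
    (hq : Sem h queries (.unary k) Tq (PMF.pure (.unary n)))
    (hl : (Val.ofNat (B.q pp)).toBits.length + 2 ≤ l)
    (hA : ∀ y ∈ ((A.eval (.cons (B.header k pp) (.ofBits (B.encG pp x.ga))) T).run (x.oracle n)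
      (⟨false, n, []⟩ : B.State pp)).support, y.1.isSome = true)
    (hL : 4 * T ≤ L) (hH : H + 2 * T ≤ M)
    (hM : (Val.cons (B.header k pp) (.ofBits (B.encG pp x.ga))).height + 2 * T ≤ M)
    (hH₁ : ∀ y, (B.encG pp y).length + 2 ≤ H) (hH₂ : ∀ y, (B.encG₁ pp y).length + 2 ≤ H) :
    ∀ t, Tq + n * (16 * (1 + n) + 30) + 32 * l + 100 +
      (A.nodes * ((2 * ensureTime N l M L + 300) + 20)) * T + (50 * n + 50) ≤ t →
    PMF.Coupled (fun b z => ∃ t', z = some (.ofBool b, t'))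
      (((A.eval (.cons (B.header k pp) (.ofBits (B.encG pp x.ga))) T).run (x.oracle n)
        (⟨false, n, []⟩ : B.State pp)).bind fun y => finishLaw n y.2.cnt y.2.bad (outBit y.1))
      ((Prog.solver A queries mulG mulG₁).exec h (x.enc k) t) := by
  obtain ⟨Q, R, hQ, hQl, hR, hinit⟩ := sem_init (x := x) hq hl
  have hcode : ∀ (o : AdvOracle) (v : Val) (s : B.State pp) (t : ℕ),
      (s.tab.length + 4 * (t + 1) ≤ L ∧ s.cnt ≤ n) → v.height ≤ M →
      Sem h (Prog.oracleCode mulG mulG₁ o) (.cons v (s.enc (x.consts k Q R)))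
        (2 * ensureTime N l M L + 300)
        ((x.oracle n o v s).map fun y => .cons y.1 (y.2.enc (x.consts k Q R))) ∧
      ∀ y ∈ (x.oracle n o v s).support,
        (y.2.tab.length + 4 * t ≤ L ∧ y.2.cnt ≤ n) ∧ y.1.height ≤ H := by
    intro o v s t hs hv
    refine ⟨sem_oracleCode x hG hG₁ hQ hQl hR o v s hv (by omega), fun y hy => ?_⟩
    obtain ⟨h1, h2, h3⟩ := length_oracle x hH₁ hH₂ o v s y hy
    omega
  -- Each call takes a unit of time and adds at most four entries, so the table length plus four
  -- times the time left never increases.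
  have him := Prog.imitates (h := x.oracle n) (h' := h) (enc := State.enc (x.consts k Q R))
    (Inv := fun t s => s.tab.length + 4 * t ≤ L ∧ s.cnt ≤ n)
    (fun t t' s ht hs => by omega) (fun o v s t => hcode o v s t) A
    (.cons (B.header k pp) (.ofBits (B.encG pp x.ga))) T (⟨false, n, []⟩ : B.State pp)
  have hK := Nat.mul_le_mul_right T (Prog.overhead_le (2 * ensureTime N l M L + 300) A)
  intro t ht
  rw [Prog.solver, Prog.exec_assoc, Prog.exec_seq]
  refine Imitates.sem_then hinit ?_ fun τ hτ => ?_
  · omega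
  rw [Prog.exec_seq]
  refine PMF.Coupled.bind (him τ M ⟨by simpa using hL, le_rfl⟩ hM hH le_rfl (by omega))
    fun y hy z _ hyz => ?_
  -- The adversary halts in time, so the imitation is not vacuous.
  obtain ⟨⟨w, t'⟩, hw⟩ := Option.isSome_iff_exists.1 (hA y hy)
  obtain ⟨w', τ', rfl, d, -, hd, ⟨-, hcnt⟩, -, rfl, hτ'⟩ := hyz w t' hw
  have hd' : d ≤ T := by omega
  have := Nat.mul_le_mul_left (A.overhead (2 * ensureTime N l M L + 300)) hd'
  rw [hw]
  exact ((sem_finish x hR w y.2.cnt y.2.bad y.2.tab τ' (by omega)).of_map).mono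
    fun b _ z _ ⟨t', h1, _⟩ => ⟨t', h1⟩

end BilinearGen

/-! ## Exponents -/

theorem cast_expo {n : ℕ} [Fact n.Prime] (x : (ZMod n)ˣ) : ((expo x : ℕ) : ZMod n) = x :=
  ZMod.natCast_zmod_val _

theorem expo_pos {n : ℕ} [Fact n.Prime] (x : (ZMod n)ˣ) : 0 < expo x :=
  Nat.pos_of_ne_zero fun h => x.ne_zero ((ZMod.val_eq_zero _).1 h)

theorem expo_lt {n : ℕ} [Fact n.Prime] (x : (ZMod n)ˣ) : expo x < n := ZMod.val_lt _

theorem expo_injective {n : ℕ} [Fact n.Prime] : Function.Injective (expo (n := n)) :=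
  fun x y h => Units.ext (by rw [← cast_expo x, h, cast_expo])

/-- In a group of order `n`, exponents count modulo `n`. -/
theorem pow_eq_pow_of_cast {n : ℕ} {M : Type} [Group M] (hM : Nat.card M = n) {i j : ℕ}
    (h : (i : ZMod n) = j) (y : M) : y ^ i = y ^ j := by
  subst hM
  rw [ZMod.natCast_eq_natCast_iff] at h
  rw [← pow_mod_natCard y i, ← pow_mod_natCard y j, h]

theorem orderOf_eq_of_generates {n : ℕ} {M : Type} [Group M] (hM : Nat.card M = n) {y : M}
    (hy : ∀ x, x ∈ Subgroup.zpowers y) : orderOf y = n := by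
  rw [← hM, ← Nat.card_zpowers, (Subgroup.eq_top_iff' _).2 hy, Subgroup.card_top]

theorem pow_inj_cast {n : ℕ} {M : Type} [Group M] (hM : Nat.card M = n) {y : M}
    (hy : ∀ x, x ∈ Subgroup.zpowers y) {i j : ℕ} (h : y ^ i = y ^ j) : (i : ZMod n) = j := by
  rw [ZMod.natCast_eq_natCast_iff, ← orderOf_eq_of_generates hM hy]
  exact pow_eq_pow_iff_modEq.1 h

theorem exists_pow_eq {n : ℕ} (hn : 0 < n) {M : Type} [Group M] (hM : Nat.card M = n) {y : M}
    (hy : ∀ x, x ∈ Subgroup.zpowers y) (x : M) : ∃ i : ℕ, y ^ i = x := by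
  have : Finite M := Nat.finite_of_card_ne_zero (by omega)
  exact mem_powers_iff_mem_zpowers.2 (hy x)

namespace BilinearGen

variable {B : BilinearGen} {pp : B.Param}

/-- `e(g, g)`. -/
def gt (B : BilinearGen) (pp : B.Param) : B.G₁ pp := B.e pp (B.g pp) (B.g pp)

theorem pow_congr_G {i j : ℕ} (h : (i : ZMod (B.q pp)) = j) (y : B.G pp) : y ^ i = y ^ j :=
  pow_eq_pow_of_cast (B.card_G pp) h y

theorem pow_congr_G₁ {i j : ℕ} (h : (i : ZMod (B.q pp)) = j) (y : B.G₁ pp) : y ^ i = y ^ j :=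
  pow_eq_pow_of_cast (B.card_G₁ pp) h y

theorem e_pow_pow (i j : ℕ) : B.e pp (B.g pp ^ i) (B.g pp ^ j) = B.gt pp ^ (i * j) :=
  B.e_bilinear pp i j

theorem ev_unitLaw_equiv (f : ((ZMod (B.q pp))ˣ) ≃ ((ZMod (B.q pp))ˣ))
    (φ : (ZMod (B.q pp))ˣ → ℝ≥0∞) :
    (B.unitLaw pp).ev φ = (B.unitLaw pp).ev fun x => φ (f x) := by
  conv_lhs => rw [unitLaw, ← PMF.uniformOfFintype_map_equiv f]
  rw [PMF.ev_map]
  rfl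

/-- The map `x ↦ expo x - 1` is a bijection of `Z_q^*` with `{0, …, q - 2}`, by injectivity and a
count. -/
theorem ev_uniform_fin (φ : ℕ → ℝ≥0∞) :
    (PMF.uniformOfFintype (Fin (B.q pp - 2 + 1))).ev (fun i => φ i) =
      (B.unitLaw pp).ev fun x => φ (expo x - 1) := by
  have hq := (B.q_prime pp).out.two_le
  let f : (ZMod (B.q pp))ˣ → Fin (B.q pp - 2 + 1) := fun x =>
    ⟨expo x - 1, by have := expo_lt x; have := expo_pos x; omega⟩
  have hf : Function.Bijective f := by
    rw [Fintype.bijective_iff_injective_and_card]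
    refine ⟨fun x y h => expo_injective ?_, ?_⟩
    · have h1 := congrArg Fin.val h
      have h2 := expo_pos x
      have h3 := expo_pos y
      simp only [f] at h1
      omega
    · rw [ZMod.card_units, Fintype.card_fin]
      omega
  rw [← PMF.uniformOfFintype_map_equiv (Equiv.ofBijective f hf), PMF.ev_map]
  rfl

end BilinearGen

/-! ## Independent coins for identities -/

/-- Independent coins for the identities in the list. -/
def coinsLaw (n : ℕ) : List (List Bool) → PMF (List Bool → Bool)
  | [] => PMF.pure fun _ => false
  | id :: l => (coinLaw n).bind fun b => (coinsLaw n l).map fun κ => Function.update κ id b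

theorem coinsLaw_of_notMem {n : ℕ} {l : List (List Bool)} {id : List Bool} (hid : id ∉ l) :
    ∀ κ ∈ (coinsLaw n l).support, κ id = false := by
  induction l with
  | nil =>
    intro κ hκ
    rw [coinsLaw, PMF.support_pure, Set.mem_singleton_iff] at hκ
    rw [hκ]
  | cons i l ih =>
    intro κ hκ
    rw [coinsLaw, PMF.mem_support_bind_iff] at hκ
    obtain ⟨b, -, hκ⟩ := hκ
    rw [PMF.mem_support_map_iff] at hκ
    obtain ⟨κ, hκ, rfl⟩ := hκ
    rw [List.mem_cons, not_or] at hid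
    rw [Function.update_of_ne hid.1]
    exact ih hid.2 κ hκ

theorem ev_coinsLaw_cons (n : ℕ) (id : List Bool) (l : List (List Bool))
    (F : (List Bool → Bool) → ℝ≥0∞) :
    (coinsLaw n (id :: l)).ev F =
      (coinLaw n).ev fun b => (coinsLaw n l).ev fun κ => F (Function.update κ id b) := by
  rw [coinsLaw, PMF.ev_bind]
  simp only [PMF.ev_map]

/-- A coin may be tossed again. -/
theorem ev_coinsLaw_resample {n : ℕ} {l : List (List Bool)} {id : List Bool} (hid : id ∈ l)
    (F : (List Bool → Bool) → ℝ≥0∞) :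
    (coinsLaw n l).ev F =
      (coinLaw n).ev fun b => (coinsLaw n l).ev fun κ => F (Function.update κ id b) := by
  induction l generalizing F with
  | nil => simp at hid
  | cons i l ih =>
    by_cases h : id = i
    · subst h
      -- The coin of `id` at the head of the list is overwritten anyway.
      simp only [ev_coinsLaw_cons, Function.update_idem, PMF.ev_const]
    · rw [ev_coinsLaw_cons]
      simp only [ev_coinsLaw_cons n i l]
      conv_rhs => rw [PMF.ev_comm]
      refine PMF.ev_congr fun b _ => ?_
      rw [ih ((List.mem_cons.1 hid).resolve_left h)]
      refine PMF.ev_congr fun b' _ => PMF.ev_congr fun κ _ => ?_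
      rw [Function.update_comm h]

/-! ### Averages over coins and exponents, and the relation between simulation and game -/

namespace BilinearGen

variable {B : BilinearGen} {pp : B.Param}

/-- The average over `c`, `c'` and the coins of the identities. -/
def avg {Ω : Type} (n : ℕ) (ids : List (List Bool)) (Λ : PMF Ω)
    (F : (List Bool → Bool) → Ω → ℝ≥0∞) : ℝ≥0∞ :=
  Λ.ev fun ω => (coinsLaw n ids).ev fun κ => F κ ω

section avg

variable {Ω α : Type} {n : ℕ} {ids : List (List Bool)} {Λ : PMF Ω}

theorem avg_congr {F F' : (List Bool → Bool) → Ω → ℝ≥0∞} (h : ∀ κ ω, F κ ω = F' κ ω) :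
    avg n ids Λ F = avg n ids Λ F' :=
  PMF.ev_congr fun ω _ => PMF.ev_congr fun κ _ => h κ ω

theorem avg_ev (μ : PMF α) (F : α → (List Bool → Bool) → Ω → ℝ≥0∞) :
    avg n ids Λ (fun κ ω => μ.ev fun a => F a κ ω) = μ.ev fun a => avg n ids Λ (F a) := by
  unfold avg
  rw [PMF.ev_comm μ]
  exact PMF.ev_congr fun ω _ => PMF.ev_comm _ _ _

/-- Deferred decision, reversed: a coin tossed just now may be counted as tossed in advance. -/
theorem avg_cons {id : List Bool} (hid : id ∉ ids)
    (F : Bool → (List Bool → Bool) → Ω → ℝ≥0∞) :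
    avg n ids Λ (fun κ ω => (coinLaw n).ev fun b => F b κ ω) =
      avg n (id :: ids) Λ fun κ ω => F (κ id) (Function.update κ id false) ω := by
  unfold avg
  refine PMF.ev_congr fun ω _ => ?_
  rw [ev_coinsLaw_cons, PMF.ev_comm]
  refine PMF.ev_congr fun b _ => PMF.ev_congr fun κ hκ => ?_
  change F b κ ω = F (Function.update κ id b id)
    (Function.update (Function.update κ id b) id false) ω
  -- Identities outside the list have the default coin `false`, so resetting `id` to `false`
  -- recovers `κ`.
  rw [Function.update_self, Function.update_idem, ← coinsLaw_of_notMem hid κ hκ,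
    Function.update_eq_self]

theorem avg_resample {id : List Bool} (hid : id ∈ ids) (F : (List Bool → Bool) → Ω → ℝ≥0∞) :
    avg n ids Λ F =
      avg n ids Λ fun κ ω => (coinLaw n).ev fun b => F (Function.update κ id b) ω := by
  unfold avg
  refine PMF.ev_congr fun ω _ => ?_
  rw [ev_coinsLaw_resample hid, PMF.ev_comm]

/-- Tossing the coin of `id` again splits off the event that it shows `want`; the other side
contributes nothing. -/
theorem avg_coin {id : List Bool} (hid : id ∈ ids) (want : Bool)
    (F : (List Bool → Bool) → Ω → ℝ≥0∞) (hF : ∀ κ ω, κ id ≠ want → F κ ω = 0) :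
    avg n ids Λ F =
      coinLaw n want * avg n ids Λ fun κ ω => F (Function.update κ id want) ω := by
  rw [avg_resample hid]
  unfold avg
  rw [← PMF.ev_mul_left]
  refine PMF.ev_congr fun ω _ => ?_
  rw [← PMF.ev_mul_left]
  refine PMF.ev_congr fun κ _ => ?_
  change (coinLaw n).ev (fun b => F (Function.update κ id b) ω) = _
  rw [PMF.ev_bool]
  cases want
  · rw [hF (Function.update κ id true) ω (by simp)]
    simp
  · rw [hF (Function.update κ id false) ω (by simp)]
    simp

end avg

/-- The exponents `c` and `c'`. -/
abbrev Exponents (pp : B.Param) : Type := (ZMod (B.q pp))ˣ × (ZMod (B.q pp))ˣ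

/-- The challenge with `Z = e(g, g) ^ (a b c')`. -/
def chal (pp : B.Param) (a b : (ZMod (B.q pp))ˣ) (ω : Exponents pp) :
    B.Challenge pp :=
  ⟨B.g pp ^ expo a, B.g pp ^ expo b, B.g pp ^ expo ω.1, B.gt pp ^ (expo a * expo b * expo ω.2)⟩

/-- The state `s` of the simulation represents the table `t` of the game, where the decryption keys
of the identities in `E` were asked for, the identities in `C` were used in the challenge, `κ` shows
the coins of the identities, and `m` decryption key queries are left. -/
structure Represents (a c : (ZMod (B.q pp))ˣ) (E C : Set (List Bool)) (κ : List Bool → Bool) (m : ℕ)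
    (t : Table (B.G pp)) (s : B.State pp) : Prop where
  bad : s.bad = false
  cnt : s.cnt = m
  find_none : ∀ id, t.lookup id = none → s.find id = none
  find_some : ∀ id h, t.lookup id = some h → ∃ e, s.find id = some e ∧ e.hash = h ∧ e.coin = κ id ∧
    (id ∈ E ∨ id ∉ C ∧ κ id = false → e.dkey = h ^ expo a) ∧
    (id ∈ C ∨ id ∉ E ∧ κ id = true → e.ckey = B.e pp (B.g pp ^ expo a) h ^ expo c)

theorem State.find_push (s : B.State pp) (e : B.Entry pp) (id : List Bool) :
    (s.push e).find id = if e.id.toBits = id then some e else s.find id := by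
  rw [State.find, State.push, List.find?_cons]
  by_cases h : e.id.toBits = id <;> simp [h, State.find]

theorem State.toBits_of_find {s : B.State pp} {e : B.Entry pp} {id : List Bool}
    (h : s.find id = some e) : e.id.toBits = id := by
  have := List.find?_some h
  simpa using this

theorem lookup_cons {t : Table (B.G pp)} {id id' : List Bool} {x : B.G pp} :
    List.lookup id ((id', x) :: t) = if id = id' then some x else t.lookup id := by
  rw [List.lookup_cons]
  by_cases h : id = id'
  · simp [h]
  · rw [if_neg h, beq_false_of_ne h]

/-- The new entry for an identity whose hash value is `g ^ x`. -/
def newEntry (a b : (ZMod (B.q pp))ˣ) (v : Val) (ω : Exponents pp)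
    (β : Bool) (x : (ZMod (B.q pp))ˣ) : B.Entry pp :=
  (chal pp a b ω).entry v β (expo (if β then b⁻¹ * x else x) - 1)

/-- For the coin `true` the exponent `b⁻¹ * x` over the base `g^b` gives `g^x` again: the hash value
does not betray the coin. -/
theorem newEntry_hash (a b : (ZMod (B.q pp))ˣ) (v : Val) (ω : Exponents pp)
    (β : Bool) (x : (ZMod (B.q pp))ˣ) : (newEntry a b v ω β x).hash = B.g pp ^ expo x := by
  simp only [newEntry, Challenge.entry, chal, Nat.sub_add_cancel (expo_pos _)]
  cases β
  · simp
  · simp only [if_true, ← pow_mul]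
    refine pow_congr_G ?_ _
    rw [Nat.cast_mul, cast_expo, cast_expo, cast_expo, ← Units.val_mul, mul_inv_cancel_left]

theorem newEntry_dkey (a b : (ZMod (B.q pp))ˣ) (v : Val) (ω : Exponents pp)
    (x : (ZMod (B.q pp))ˣ) : (newEntry a b v ω false x).dkey = (B.g pp ^ expo x) ^ expo a := by
  simp only [newEntry, Challenge.entry, chal, Nat.sub_add_cancel (expo_pos _)]
  simp only [Bool.false_eq_true, if_false, ← pow_mul]
  rw [mul_comm]

/-- The exponent `b⁻¹ * x` cancels the `b` contained in `Z`, which leaves `e(g,g)^(a x c')`. -/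
theorem newEntry_ckey (a b : (ZMod (B.q pp))ˣ) (v : Val) (ω : Exponents pp)
    (x : (ZMod (B.q pp))ˣ) : (newEntry a b v ω true x).ckey =
      B.e pp (B.g pp ^ expo a) (B.g pp ^ expo x) ^ expo ω.2 := by
  simp only [newEntry, Challenge.entry, chal, Nat.sub_add_cancel (expo_pos _)]
  simp only [if_true]
  rw [e_pow_pow, ← pow_mul, ← pow_mul]
  refine pow_congr_G₁ ?_ _
  simp only [Nat.cast_mul, cast_expo, ← Units.val_mul]
  congr 1
  calc a * b * ω.2 * (b⁻¹ * x) = b * b⁻¹ * (a * x * ω.2) := by ac_rfl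
    _ = _ := by rw [mul_inv_cancel, one_mul]

/-- The old state was reached before the coin of the new identity was tossed; it is therefore the
state for `κ` with that coin reset to its default. -/
theorem Represents.push {a b : (ZMod (B.q pp))ˣ} {ω : Exponents pp}
    {E C : Set (List Bool)} {κ : List Bool → Bool} {m : ℕ} {t : Table (B.G pp)} {s : B.State pp}
    {v : Val} (h : Represents a ω.2 E C (Function.update κ v.toBits false) m t s)
    (hE : v.toBits ∉ E) (hC : v.toBits ∉ C) (x : (ZMod (B.q pp))ˣ) :
    Represents a ω.2 E C κ m ((v.toBits, B.g pp ^ expo x) :: t)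
      (s.push (newEntry a b v ω (κ v.toBits) x)) := by
  have hid : (newEntry a b v ω (κ v.toBits) x).id.toBits = v.toBits := rfl
  refine ⟨h.bad, h.cnt, fun id hi => ?_, fun id y hi => ?_⟩
  · rw [lookup_cons] at hi
    rw [State.find_push, hid]
    split_ifs at hi with h1
    rw [if_neg (Ne.symm h1)]
    exact h.find_none id hi
  · rw [lookup_cons] at hi
    rw [State.find_push, hid]
    split_ifs at hi with h1
    · subst h1
      obtain rfl := Option.some.inj hi
      rw [if_pos rfl]
      refine ⟨_, rfl, newEntry_hash _ _ _ _ _ _, rfl, fun h2 => ?_, fun h2 => ?_⟩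
      · rw [(h2.resolve_left hE).2]
        exact newEntry_dkey _ _ _ _ _
      · rw [(h2.resolve_left hC).2]
        exact newEntry_ckey _ _ _ _ _
    · rw [if_neg (Ne.symm h1)]
      obtain ⟨e, h2, h3, h4, h5⟩ := h.find_some id y hi
      rw [Function.update_of_ne h1] at h4 h5
      exact ⟨e, h2, h3, h4, h5⟩

/-- Before the use, the coin `want` makes the required key correct. Afterwards membership in `E'` or
`C'` records this correctness for either coin, so the recorded coin may be replaced by the fresh `κ
id`. -/
theorem Represents.use {a c : (ZMod (B.q pp))ˣ}
    {E C : Set (List Bool)} {κ : List Bool → Bool} {m : ℕ} {t : Table (B.G pp)} {s : B.State pp}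
    {id : List Bool} {e : B.Entry pp} {want : Bool}
    (h : Represents a c E C (Function.update κ id want) m t s) (he : s.find id = some e)
    {E' C' : Set (List Bool)} (hE : want = false → id ∉ C ∧ E' = insert id E ∧ C' = C)
    (hC : want = true → id ∉ E ∧ E' = E ∧ C' = insert id C) :
    Represents a c E' C' κ m t (s.push { e with coin := κ id }) ∧
      ∀ y, t.lookup id = some y → (want = false → e.dkey = y ^ expo a) ∧
        (want = true → e.ckey = B.e pp (B.g pp ^ expo a) y ^ expo c) := by
  have hid : e.id.toBits = id := State.toBits_of_find he
  have key : ∀ y, t.lookup id = some y → e.hash = y ∧ (want = false → e.dkey = y ^ expo a) ∧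
        (want = true → e.ckey = B.e pp (B.g pp ^ expo a) y ^ expo c) := by
    intro y hy
    obtain ⟨e', h1, h2, h3, h4, h5⟩ := h.find_some id y hy
    obtain rfl := Option.some.inj (he.symm.trans h1)
    rw [Function.update_self] at h4 h5
    exact ⟨h2, fun hw => h4 (Or.inr ⟨(hE hw).1, hw⟩), fun hw => h5 (Or.inr ⟨(hC hw).1, hw⟩)⟩
  refine ⟨⟨h.bad, h.cnt, fun i hi => ?_, fun i y hi => ?_⟩, fun y hy => (key y hy).2⟩
  · have := h.find_none i hi
    rw [State.find_push, if_neg]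
    · exact this
    · rintro rfl
      rw [hid, he] at this
      simp at this
  · rw [State.find_push]
    by_cases h1 : i = id
    · subst h1
      rw [if_pos hid]
      obtain ⟨h2, h3, h4⟩ := key y hi
      refine ⟨_, rfl, h2, rfl, ?_, ?_⟩
      · intro h5
        cases want with
        | false => exact h3 rfl
        | true =>
          -- No identity is both extracted and challenged, so nothing is required of the other key.
          obtain ⟨h6, rfl, rfl⟩ := hC rfl
          simp [h6] at h5
      · intro h5
        cases want with
        | true => exact h4 rfl
        | false =>
          obtain ⟨h6, rfl, rfl⟩ := hE rfl
          simp [h6] at h5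
    · rw [if_neg (by rw [hid]; exact Ne.symm h1)]
      obtain ⟨e', h2, h3, h4, h5⟩ := h.find_some i y hi
      rw [Function.update_of_ne h1] at h4 h5
      refine ⟨e', h2, h3, h4, ?_⟩
      cases want with
      | true =>
        obtain ⟨h6, rfl, rfl⟩ := hC rfl
        simpa [h1] using h5
      | false =>
        obtain ⟨h6, rfl, rfl⟩ := hE rfl
        simpa [h1] using h5

end BilinearGen

/-! ## The analysis of the simulation -/

theorem Comp.run_inv {O α σ : Type} {h : O → Val → σ → PMF (Val × σ)} {Inv : σ → Prop}
    (hInv : ∀ o v s, Inv s → ∀ y ∈ (h o v s).support, Inv y.2) (c : Comp O α) (s : σ) (hs : Inv s) :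
    ∀ y ∈ (c.run h s).support, Inv y.2 := by
  induction c generalizing s with
  | ret a =>
    intro y hy
    rw [run, PMF.support_pure, Set.mem_singleton_iff] at hy
    rw [hy]
    exact hs
  | rand n c ih =>
    intro y hy
    rw [run, PMF.mem_support_bind_iff] at hy
    obtain ⟨i, -, hy⟩ := hy
    exact ih i s hs y hy
  | call o q c ih =>
    intro y hy
    rw [run, PMF.mem_support_bind_iff] at hy
    obtain ⟨z, hz, hy⟩ := hy
    exact ih z.1 z.2 (hInv o q s hs z hz) y hy

namespace BilinearGen

variable {B : BilinearGen} {pp : B.Param}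

theorem bad_ensure (x : B.Challenge pp) (n : ℕ) (v : Val) (s : B.State pp) :
    ∀ y ∈ (x.ensure n v s).support, y.2.bad = s.bad := by
  intro y hy
  rw [Challenge.ensure] at hy
  split at hy
  · rw [PMF.support_pure, Set.mem_singleton_iff] at hy
    rw [hy]
  · rw [PMF.mem_support_bind_iff] at hy
    obtain ⟨b, -, hy⟩ := hy
    rw [PMF.mem_support_map_iff] at hy
    obtain ⟨i, -, rfl⟩ := hy
    rfl

theorem bad_ensure_use (x : B.Challenge pp) (n : ℕ) (want : Bool) (v : Val) (s : B.State pp)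
    (hs : s.bad = true) :
    ∀ y ∈ ((x.ensure n v s).bind (Entry.use n want)).support, y.2.bad = true := by
  intro y hy
  rw [PMF.mem_support_bind_iff] at hy
  obtain ⟨z, hz, hy⟩ := hy
  rw [Entry.use, PMF.mem_support_map_iff] at hy
  obtain ⟨i, -, rfl⟩ := hy
  simp [bad_ensure x n v s z hz, hs]

theorem bad_oracle (x : B.Challenge pp) (n : ℕ) (o : AdvOracle) (v : Val) (s : B.State pp)
    (hs : s.bad = true) : ∀ y ∈ (x.oracle n o v s).support, y.2.bad = true := by
  intro y hy
  cases o with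
  | hash =>
    rw [Challenge.oracle, PMF.mem_support_map_iff] at hy
    obtain ⟨z, hz, rfl⟩ := hy
    exact (bad_ensure x n v s z hz).trans hs
  | extract =>
    rw [Challenge.oracle, PMF.mem_support_map_iff] at hy
    obtain ⟨z, hz, rfl⟩ := hy
    exact bad_ensure_use x n false v s hs z hz
  | challenge =>
    rw [Challenge.oracle, PMF.mem_support_bind_iff] at hy
    obtain ⟨z, hz, hy⟩ := hy
    rw [PMF.mem_support_map_iff] at hy
    obtain ⟨z', hz', rfl⟩ := hy
    exact bad_ensure_use x n true _ _ (bad_ensure_use x n true _ s hs z hz) z' hz'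

theorem _root_.PMF.ev_eq_zero {α : Type} {μ : PMF α} {f : α → ℝ≥0∞}
    (h : ∀ a ∈ μ.support, f a = 0) : μ.ev f = 0 := by
  rw [PMF.ev_congr h, PMF.ev_const]

/-- The weight of the end of a run: `0` after a wrong coin, otherwise the probability that the
coins that are left show `false`, times `φ`. -/
def weight {α : Type} (n : ℕ) (φ : α → ℝ≥0∞) (y : α × B.State pp) : ℝ≥0∞ :=
  if y.2.bad = true then 0 else coinLaw n false ^ y.2.cnt * φ y.1

/-- The flag is never cleared, so the rest of the run counts for nothing. -/
theorem ev_weight_of_bad {α : Type} {n : ℕ} {φ : α → ℝ≥0∞} (x : B.Challenge pp)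
    (c : Comp AdvOracle α) {s : B.State pp} (hs : s.bad = true) :
    (c.run (x.oracle n) s).ev (weight n φ) = 0 :=
  PMF.ev_eq_zero fun y hy => by
    rw [weight, if_pos (Comp.run_inv (Inv := fun s : B.State pp => s.bad = true)
      (fun o v s hs => bad_oracle x n o v s hs) c s hs y hy)]

/-- The identities in the list are those in the table, and comprise those of `E` and of `C`; the
hash values in the table are generators. -/
structure Covers (ids : List (List Bool)) (t : Table (B.G pp)) (E C : Set (List Bool)) : Prop where
  mem_iff : ∀ id, id ∈ ids ↔ t.lookup id ≠ none
  extracted : ∀ id ∈ E, id ∈ ids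
  challenged : ∀ id ∈ C, id ∈ ids
  generator : ∀ id h, t.lookup id = some h → ∃ x : (ZMod (B.q pp))ˣ, h = B.g pp ^ expo x

/-! ### Single actions of the simulation, averaged -/

section steps

variable {a b : (ZMod (B.q pp))ˣ} {Λ : PMF (Exponents pp)} {n m : ℕ}
  {ids : List (List Bool)} {t : Table (B.G pp)} {E C : Set (List Bool)}
  {S : (List Bool → Bool) → Exponents pp → B.State pp}

/-- The law of the hash values. -/
def hashValue (pp : B.Param) : PMF (B.G pp) := (B.unitLaw pp).map fun x => B.g pp ^ expo x

/-- `W` evaluates the rest of the simulation and `R` the rest of the game. A known identity changes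
neither table. For a new one the exponent is substituted so that the hash value is `g^x` for both
sides of the coin; it then has the law of the random oracle, and the coin, still unseen, joins the
averaged ones. -/
theorem ev_ensure (v : Val) (ht : Covers ids t E C)
    (hS : ∀ κ ω, Represents a ω.2 E C κ m t (S κ ω))
    (W : Exponents pp → B.Entry pp → B.State pp → ℝ≥0∞) (w : ℝ≥0∞)
    (R : B.G pp → Table (B.G pp) → ℝ≥0∞)
    (hW : ∀ (ids' : List (List Bool)) (t' : Table (B.G pp))
      (S' : (List Bool → Bool) → Exponents pp → B.State pp)
      (e' : (List Bool → Bool) → Exponents pp → B.Entry pp) (h : B.G pp),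
      Covers ids' t' E C → (∀ κ ω, Represents a ω.2 E C κ m t' (S' κ ω)) →
      t'.lookup v.toBits = some h → (∀ κ ω, (S' κ ω).find v.toBits = some (e' κ ω)) →
      avg n ids' Λ (fun κ ω => W ω (e' κ ω) (S' κ ω)) = w * R h t') :
    avg n ids Λ (fun κ ω => ((chal pp a b ω).ensure n v (S κ ω)).ev fun y => W ω y.1 y.2) =
      w * (lazyHash (hashValue pp) v.toBits t).ev fun y => R y.1 y.2 := by
  rw [lazyHash]
  rcases hv : t.lookup v.toBits with _ | h
  · have hid : v.toBits ∉ ids := fun h => (ht.mem_iff _).1 h hv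
    have hE : v.toBits ∉ E := fun h => hid (ht.extracted _ h)
    have hC : v.toBits ∉ C := fun h => hid (ht.challenged _ h)
    have h1 : ∀ κ ω, ((chal pp a b ω).ensure n v (S κ ω)).ev (fun y => W ω y.1 y.2) =
        (B.unitLaw pp).ev fun x => (coinLaw n).ev fun β =>
          W ω (newEntry a b v ω β x) ((S κ ω).push (newEntry a b v ω β x)) := by
      intro κ ω
      rw [Challenge.ensure, (hS κ ω).find_none _ hv, PMF.ev_bind, PMF.ev_comm]
      refine PMF.ev_congr fun β _ => ?_
      rw [PMF.ev_map]
      rw [ev_uniform_fin (pp := pp) fun i => W ω ((chal pp a b ω).entry v β i)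
        ((S κ ω).push ((chal pp a b ω).entry v β i))]
      -- The substitution depends on the coin: `x` becomes `b⁻¹ * x` if it shows `true`.
      rw [ev_unitLaw_equiv (if β then Equiv.mulLeft b⁻¹ else Equiv.refl _)]
      refine PMF.ev_congr fun x _ => ?_
      cases β <;> rfl
    rw [avg_congr h1, avg_ev, PMF.ev_bind, hashValue, PMF.ev_map, ← PMF.ev_mul_left]
    refine PMF.ev_congr fun x _ => ?_
    rw [PMF.ev_pure, avg_cons hid fun β κ ω =>
      W ω (newEntry a b v ω β x) ((S κ ω).push (newEntry a b v ω β x))]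
    refine hW _ _ _ _ _ ⟨fun id => ?_, fun id h => ?_, fun id h => ?_, fun id y h => ?_⟩
      (fun κ ω => (hS _ ω).push hE hC x) ?_ fun κ ω => ?_
    · rw [List.mem_cons, lookup_cons, ht.mem_iff]
      split_ifs with h <;> simp [h]
    · exact List.mem_cons_of_mem _ (ht.extracted _ h)
    · exact List.mem_cons_of_mem _ (ht.challenged _ h)
    · rw [lookup_cons] at h
      split_ifs at h with h1
      · exact ⟨x, (Option.some.inj h).symm⟩
      · exact ht.generator id y h
    · rw [lookup_cons, if_pos rfl]
    · rw [State.find_push]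
      exact if_pos rfl
  · choose e he _ using fun κ ω => (hS κ ω).find_some _ _ hv
    simp only [PMF.ev_pure]
    rw [← hW ids t S e h ht hS hv he]
    refine avg_congr fun κ ω => ?_
    rw [Challenge.ensure, he κ ω]
    exact PMF.ev_pure _ _

/-- A wrong coin has value 0, and the right one has probability `coinLaw n want`. The coin tossed
after the use takes its place in the average, so all coins are again independent of the state of the
game. The factor is the same for identities that were used before. -/
theorem ev_use {id : List Bool} {h : B.G pp}
    {e : (List Bool → Bool) → Exponents pp → B.Entry pp}
    (ht : Covers ids t E C) (hS : ∀ κ ω, Represents a ω.2 E C κ m t (S κ ω))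
    (hid : t.lookup id = some h) (he : ∀ κ ω, (S κ ω).find id = some (e κ ω)) (want : Bool)
    {E' C' : Set (List Bool)} (hE : want = false → id ∉ C ∧ E' = insert id E ∧ C' = C)
    (hC : want = true → id ∉ E ∧ E' = E ∧ C' = insert id C)
    (W : Exponents pp → B.Entry pp → B.State pp → ℝ≥0∞)
    (hbad : ∀ ω e s, s.bad = true → W ω e s = 0) (r : ℝ≥0∞)
    (hW : ∀ (S' : (List Bool → Bool) → Exponents pp → B.State pp)
      (e' : (List Bool → Bool) → Exponents pp → B.Entry pp),
      Covers ids t E' C' → (∀ κ ω, Represents a ω.2 E' C' κ m t (S' κ ω)) →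
      (want = false → ∀ κ ω, (e' κ ω).dkey = h ^ expo a) →
      (want = true → ∀ κ ω, (e' κ ω).ckey = B.e pp (B.g pp ^ expo a) h ^ expo ω.2) →
      avg n ids Λ (fun κ ω => W ω (e' κ ω) (S' κ ω)) = r) :
    avg n ids Λ (fun κ ω => (Entry.use n want (e κ ω, S κ ω)).ev fun y => W ω y.1 y.2) =
      coinLaw n want * r := by
  have hmem : id ∈ ids := (ht.mem_iff id).2 (by rw [hid]; exact Option.some_ne_none h)
  have hcoin : ∀ κ ω, (e κ ω).coin = κ id := by
    intro κ ω
    obtain ⟨e', h1, -, h2, -⟩ := (hS κ ω).find_some id h hid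
    rw [he κ ω] at h1
    rw [Option.some.inj h1, h2]
  have hnew := fun κ ω => (hS (Function.update κ id want) ω).use (he _ _) hE hC
  rw [avg_coin hmem want]
  · congr 1
    -- The new state for `κ` comes from the old state in which `id` had the right coin; the coin
    -- after the new toss is `κ id`.
    rw [← hW (fun κ ω => (S (Function.update κ id want) ω).push
        { e (Function.update κ id want) ω with coin := κ id })
      (fun κ ω => e (Function.update κ id want) ω) ?_ (fun κ ω => (hnew κ ω).1)
      (fun h1 κ ω => ((hnew κ ω).2 h hid).1 h1) (fun h1 κ ω => ((hnew κ ω).2 h hid).2 h1)]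
    · rw [avg_resample hmem fun κ ω => W ω _ _]
      refine avg_congr fun κ ω => ?_
      rw [Entry.use, PMF.ev_map]
      refine PMF.ev_congr fun β _ => ?_
      rw [hcoin, Function.update_self, if_pos rfl, Function.update_idem, Function.update_self]
      rfl
    · refine ⟨ht.mem_iff, fun i hi => ?_, fun i hi => ?_, ht.generator⟩
      · cases want with
        | false =>
          rw [(hE rfl).2.1] at hi
          exact hi.elim (fun h => h ▸ hmem) (ht.extracted i)
        | true =>
          rw [(hC rfl).2.1] at hi
          exact ht.extracted i hi
      · cases want with
        | false =>
          rw [(hE rfl).2.2] at hi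
          exact ht.challenged i hi
        | true =>
          rw [(hC rfl).2.2] at hi
          exact hi.elim (fun h => h ▸ hmem) (ht.challenged i)
  · intro κ ω h1
    refine PMF.ev_eq_zero fun y hy => hbad _ _ _ ?_
    rw [Entry.use, PMF.mem_support_map_iff] at hy
    obtain ⟨β, -, rfl⟩ := hy
    exact if_neg (by rw [hcoin]; exact h1)

end steps

end BilinearGen

/-! ## The simulation and the game -/

/-- The identities of the decryption key queries. -/
def extracted (log : List (AdvOracle × Val)) : Set (List Bool) :=
  {id | ∃ w, (AdvOracle.extract, w) ∈ log ∧ w.toBits = id}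

/-- The identities of the challenges. -/
def challenged (log : List (AdvOracle × Val)) : Set (List Bool) :=
  {id | ∃ w, (AdvOracle.challenge, w) ∈ log ∧ (w.fst.toBits = id ∨ w.snd.toBits = id)}

def numExtracts (log : List (AdvOracle × Val)) : ℕ := log.countP fun x => x.1 = .extract

section log

variable (log : List (AdvOracle × Val)) (v : Val)

theorem extracted_hash : extracted (log ++ [(.hash, v)]) = extracted log := by
  simp [extracted]

theorem extracted_challenge : extracted (log ++ [(.challenge, v)]) = extracted log := by
  simp [extracted]

theorem extracted_extract :
    extracted (log ++ [(.extract, v)]) = insert v.toBits (extracted log) := by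
  ext id
  simp only [extracted, List.mem_append, List.mem_singleton, Prod.mk.injEq, true_and,
    Set.mem_ofPred_eq, Set.mem_insert_iff]
  constructor
  · rintro ⟨w, h | rfl, rfl⟩
    · exact Or.inr ⟨w, h, rfl⟩
    · exact Or.inl rfl
  · rintro (rfl | ⟨w, h, rfl⟩)
    · exact ⟨v, Or.inr rfl, rfl⟩
    · exact ⟨w, Or.inl h, rfl⟩

theorem challenged_hash : challenged (log ++ [(.hash, v)]) = challenged log := by
  simp [challenged]

theorem challenged_extract : challenged (log ++ [(.extract, v)]) = challenged log := by
  simp [challenged]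

theorem challenged_challenge : challenged (log ++ [(.challenge, v)]) =
    insert v.snd.toBits (insert v.fst.toBits (challenged log)) := by
  ext id
  simp only [challenged, List.mem_append, List.mem_singleton, Prod.mk.injEq, true_and,
    Set.mem_ofPred_eq, Set.mem_insert_iff]
  constructor
  · rintro ⟨w, h | rfl, h'⟩
    · exact Or.inr (Or.inr ⟨w, h, h'⟩)
    · rcases h' with rfl | rfl
      · exact Or.inr (Or.inl rfl)
      · exact Or.inl rfl
  · rintro (rfl | rfl | ⟨w, h, h'⟩)
    · exact ⟨v, Or.inr rfl, Or.inr rfl⟩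
    · exact ⟨v, Or.inr rfl, Or.inl rfl⟩
    · exact ⟨w, Or.inl h, h'⟩

open Classical in
/-- The probability that the coins that are still to be used will show the right sides. -/
def coinFactor (n : ℕ) (log : List (AdvOracle × Val)) : ℝ≥0∞ :=
  coinLaw n false ^ (n - numExtracts log) *
    if ∃ w, (AdvOracle.challenge, w) ∈ log then 1 else coinLaw n true ^ 2

theorem coinFactor_hash (n : ℕ) : coinFactor n (log ++ [(.hash, v)]) = coinFactor n log := by
  have h : (∃ w, (AdvOracle.challenge, w) ∈ log ++ [(.hash, v)]) ↔
      ∃ w, (AdvOracle.challenge, w) ∈ log := by simp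
  have h1 : numExtracts (log ++ [(.hash, v)]) = numExtracts log := by simp [numExtracts]
  rw [coinFactor, coinFactor, h1]
  by_cases hx : ∃ w, (AdvOracle.challenge, w) ∈ log
  · rw [if_pos hx, if_pos (h.2 hx)]
  · rw [if_neg hx, if_neg (mt h.1 hx)]

variable {log v} {n : ℕ} {l : List (AdvOracle × Val)}

/-- The rules hold for a complete log that contains this query: the query itself counts towards the
limit `n`, and any challenge made before it is the unique one. -/
theorem ObeysRules.extract (h : ObeysRules n (log ++ [(.extract, v)] ++ l)) :
    numExtracts log < n ∧ v.toBits ∉ challenged log := by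
  obtain ⟨h1, w, h2, h3⟩ := h
  constructor
  · simp only [List.countP_append] at h1
    have : List.countP (fun x : AdvOracle × Val => decide (x.1 = .extract)) [(.extract, v)] = 1 :=
      rfl
    rw [numExtracts]
    omega
  · rintro ⟨u, hu, h4⟩
    have h5 : (AdvOracle.challenge, u) ∈ [(AdvOracle.challenge, w)] := by
      rw [← h2]
      simp [hu]
    simp only [List.mem_singleton, Prod.mk.injEq, true_and] at h5
    subst h5
    have := h3 v (by simp)
    rcases h4 with h4 | h4
    · exact this.1 h4.symm
    · exact this.2 h4.symm

theorem ObeysRules.challenge (h : ObeysRules n (log ++ [(.challenge, v)] ++ l)) :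
    (¬∃ w, (AdvOracle.challenge, w) ∈ log) ∧ v.fst.toBits ∉ extracted log ∧
      v.snd.toBits ∉ extracted log := by
  obtain ⟨h1, w, h2, h3⟩ := h
  have h5 : (AdvOracle.challenge, v) ∈ [(AdvOracle.challenge, w)] := by
    rw [← h2]
    simp
  simp only [List.mem_singleton, Prod.mk.injEq, true_and] at h5
  subst h5
  refine ⟨?_, ?_, ?_⟩
  · rintro ⟨u, hu⟩
    have h6 := congrArg List.length h2
    simp only [List.filter_append, List.length_append, List.length_singleton] at h6
    have h7 : 0 < (log.filter fun x => decide (x.1 = AdvOracle.challenge)).length :=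
      List.length_pos_of_mem (a := (AdvOracle.challenge, u)) (by simp [hu])
    have h8 : (List.filter (fun x : AdvOracle × Val => decide (x.1 = .challenge))
      [(.challenge, v)]).length = 1 := rfl
    omega
  · rintro ⟨u, hu, h4⟩
    exact (h3 u (by simp [hu])).1 h4
  · rintro ⟨u, hu, h4⟩
    exact (h3 u (by simp [hu])).2 h4

theorem coinFactor_extract (h : numExtracts log < n) :
    coinFactor n log = coinLaw n false * coinFactor n (log ++ [(.extract, v)]) := by
  have h1 : numExtracts (log ++ [(.extract, v)]) = numExtracts log + 1 := by
    simp [numExtracts]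
  have h2 : n - numExtracts log = n - (numExtracts log + 1) + 1 := by omega
  have h3 : (∃ w, (AdvOracle.challenge, w) ∈ log ++ [(.extract, v)]) ↔
      ∃ w, (AdvOracle.challenge, w) ∈ log := by simp
  rw [coinFactor, coinFactor, h1, h2, pow_succ]
  by_cases hx : ∃ w, (AdvOracle.challenge, w) ∈ log
  · rw [if_pos hx, if_pos (h3.2 hx)]
    ring
  · rw [if_neg hx, if_neg (mt h3.1 hx)]
    ring

theorem coinFactor_challenge (h : ¬∃ w, (AdvOracle.challenge, w) ∈ log) :
    coinFactor n log =
      coinLaw n true * (coinLaw n true * coinFactor n (log ++ [(.challenge, v)])) := by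
  have h1 : numExtracts (log ++ [(.challenge, v)]) = numExtracts log := by
    simp [numExtracts]
  have h3 : ∃ w, (AdvOracle.challenge, w) ∈ log ++ [(.challenge, v)] := ⟨v, by simp⟩
  rw [coinFactor, coinFactor, h1, if_neg h, if_pos h3]
  ring

end log

/-! ### The averaged simulation is the game -/

namespace BilinearGen

variable {B : BilinearGen} {pp : B.Param}

/-- The law of `(c, c')` under which the challenge belongs to the challenge bit `d`. -/
def keyLaw (pp : B.Param) (d : Bool) : PMF (Exponents pp) :=
  if d then (B.unitLaw pp).bind fun c => (B.unitLaw pp).map fun c' => (c, c')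
  else (B.unitLaw pp).map fun c => (c, c)

/-- For bit 0, `c = c'` plays the role of `r₀`, and `r₁` does not matter. For bit 1, the bijective
substitution `c' = x₁ x₀⁻¹ r₁` turns `e(P, h₀)^c'` into `e(P, h₁)^r₁`; it needs that the hash values
are generators, but not that they differ. -/
theorem ev_keyLaw (a : (ZMod (B.q pp))ˣ) (d : Bool) {h₀ h₁ : B.G pp}
    (hh₀ : ∃ x : (ZMod (B.q pp))ˣ, h₀ = B.g pp ^ expo x)
    (hh₁ : ∃ x : (ZMod (B.q pp))ˣ, h₁ = B.g pp ^ expo x) (ψ : B.G₁ pp → B.G pp → ℝ≥0∞) :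
    (keyLaw pp d).ev (fun ω => ψ (B.e pp (B.g pp ^ expo a) h₀ ^ expo ω.2) (B.g pp ^ expo ω.1)) =
      (B.unitLaw pp).ev fun r₀ => (B.unitLaw pp).ev fun r₁ =>
        ψ (if d then B.e pp (B.g pp ^ expo a) h₁ ^ expo r₁
          else B.e pp (B.g pp ^ expo a) h₀ ^ expo r₀) (B.g pp ^ expo r₀) := by
  obtain ⟨x₀, rfl⟩ := hh₀
  obtain ⟨x₁, rfl⟩ := hh₁
  cases d with
  | false =>
    simp only [keyLaw, Bool.false_eq_true, if_false, PMF.ev_map, PMF.ev_const]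
  | true =>
    simp only [keyLaw, if_true, PMF.ev_bind, PMF.ev_map]
    refine PMF.ev_congr fun r₀ _ => ?_
    rw [ev_unitLaw_equiv (Equiv.mulLeft (x₁ * x₀⁻¹))]
    refine PMF.ev_congr fun r₁ _ => ?_
    congr 1
    rw [e_pow_pow, e_pow_pow, ← pow_mul, ← pow_mul, Equiv.coe_mulLeft]
    refine pow_congr_G₁ ?_ _
    simp only [Nat.cast_mul, cast_expo, ← Units.val_mul]
    congr 1
    calc a * x₀ * (x₁ * x₀⁻¹ * r₁) = x₀ * x₀⁻¹ * (a * x₁ * r₁) := by ac_rfl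
      _ = _ := by rw [mul_inv_cancel, one_mul]

theorem exists_answer (pk : PubKey B) (o : AdvOracle) (v : Val) :
    ∃ y, (roIBKEM B).Answer pk o v y := by
  cases o with
  | hash =>
    exact ⟨_, B.g pk.pp ^ expo (1 : (ZMod (B.q pk.pp))ˣ), (PMF.mem_support_map_iff _ _ _).2
      ⟨1, PMF.mem_support_uniformOfFintype _, rfl⟩, rfl⟩
  | extract => exact ⟨_, (1 : B.G pk.pp), rfl⟩
  | challenge => exact ⟨_, (1 : B.G₁ pk.pp), (1 : B.G pk.pp), rfl⟩

/-- The simulation, averaged over the coins, behaves as the game. -/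
theorem avg_run {α : Type} {n : ℕ} (a b : (ZMod (B.q pp))ˣ) (d : Bool) (φ : α → ℝ≥0∞)
    {post : List (AdvOracle × Val) → α → Prop} (hpost : ∀ log y, post log y → ObeysRules n log)
    (c : Comp AdvOracle α) (log : List (AdvOracle × Val))
    (hc : c.Always ((roIBKEM B).Answer ⟨pp, B.g pp ^ expo a⟩) post log)
    {Λ : PMF (Exponents pp)} (hΛ : Λ = keyLaw pp d ∨ ∃ w, (AdvOracle.challenge, w) ∈ log)
    {ids : List (List Bool)} {t : Table (B.G pp)}
    {S : (List Bool → Bool) → Exponents pp → B.State pp}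
    (ht : Covers ids t (extracted log) (challenged log))
    (hS : ∀ κ ω, Represents a ω.2 (extracted log) (challenged log) κ (n - numExtracts log) t
      (S κ ω)) :
    avg n ids Λ (fun κ ω => (c.run ((chal pp a b ω).oracle n) (S κ ω)).ev (weight n φ)) =
      coinFactor n log *
        (c.run ((roIBKEM B).challenger ⟨pp, B.g pp ^ expo a⟩ a d) t).ev fun y => φ y.1 := by
  -- `Λ` must vary: before the challenge `(c, c')` is averaged, since the state is represented for
  -- each of its values; the challenge reveals it, and from then on it is a point mass.
  induction c generalizing log Λ ids t S with
  | ret y =>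
    -- A complete run contains a challenge, so only the coins of the decryption key queries not made
    -- are still to be tossed.
    have hlog : ∃ w, (AdvOracle.challenge, w) ∈ log := by
      obtain ⟨-, w, h, -⟩ := hpost log y hc
      have h1 : (AdvOracle.challenge, w) ∈ log.filter fun x => decide (x.1 = .challenge) := by
        rw [h]
        simp
      exact ⟨w, (List.mem_filter.1 h1).1⟩
    simp only [Comp.run, PMF.ev_pure]
    rw [coinFactor, if_pos hlog, mul_one]
    have h1 : ∀ κ ω, weight n φ (y, S κ ω) = coinLaw n false ^ (n - numExtracts log) * φ y := by
      intro κ ω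
      rw [weight, (hS κ ω).bad, if_neg Bool.false_ne_true, (hS κ ω).cnt]
    rw [avg_congr h1, avg]
    simp only [PMF.ev_const]
  | rand N c ih =>
    simp only [Comp.run, PMF.ev_bind]
    rw [avg_ev, ← PMF.ev_mul_left]
    exact PMF.ev_congr fun i _ => ih i log (hc i) hΛ ht hS
  | call o v c ih =>
    cases o with
    | hash =>
      simp only [Comp.run, PMF.ev_bind, Challenge.oracle, IBKEM.challenger, PMF.ev_map]
      refine ev_ensure v ht hS (fun ω e s => ((c (.ofBits (B.encG pp e.hash))).run
        ((chal pp a b ω).oracle n) s).ev (weight n φ)) _ (fun h t' =>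
          ((c (.ofBits (B.encG pp h))).run ((roIBKEM B).challenger ⟨pp, B.g pp ^ expo a⟩ a d)
            t').ev fun y => φ y.1) ?_
      intro ids' t' S' e' h ht' hS' hid he'
      obtain ⟨x, hx⟩ := ht'.generator _ _ hid
      have h1 : ∀ κ ω, (e' κ ω).hash = h := by
        intro κ ω
        obtain ⟨e, h1, h2, -⟩ := (hS' κ ω).find_some _ _ hid
        rw [he' κ ω] at h1
        rw [Option.some.inj h1, h2]
      simp only [h1]
      rw [← coinFactor_hash log v]
      rw [← extracted_hash log v, ← challenged_hash log v] at ht' hS'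
      refine ih _ _ (hc _ ⟨h, (PMF.mem_support_map_iff _ _ _).2
        ⟨x, PMF.mem_support_uniformOfFintype _, hx.symm⟩, rfl⟩) ?_ ht' ?_
      · exact hΛ.imp_right fun ⟨w, hw⟩ => ⟨w, by simp [hw]⟩
      · simpa [numExtracts] using hS'
    | extract =>
      -- Some continuation completes the run, and its log obeys the rules; hence a query is left,
      -- and `v` is not a challenge identity.
      obtain ⟨l, y, hl⟩ := Comp.exists_post_of_always (exists_answer _) _ _
        (hc _ (exists_answer _ .extract v).choose_spec)
      obtain ⟨hn, hch⟩ := (hpost _ _ hl).extract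
      simp only [Comp.run, PMF.ev_bind, Challenge.oracle, IBKEM.challenger, PMF.ev_map]
      have hR : ∀ Φ : B.G pp × Table (B.G pp) → ℝ≥0∞,
          (((roIBKEM B).extract ⟨pp, B.g pp ^ expo a⟩ a v.toBits).run
            ((roIBKEM B).hashLaw ⟨pp, B.g pp ^ expo a⟩) t).ev Φ =
          (lazyHash (hashValue pp) v.toBits t).ev fun y => Φ (y.1 ^ expo a, y.2) := by
        intro Φ
        simp only [roIBKEM, ROM.run, PMF.ev_bind, PMF.ev_pure]
        rfl
      refine Eq.trans ?_ (congrArg _ (hR _).symm)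
      refine ev_ensure v ht hS (fun ω e s => (Entry.use n false (e, s)).ev fun y =>
        ((c (.ofBits (B.encG pp y.1.dkey))).run ((chal pp a b ω).oracle n)
          { y.2 with cnt := y.2.cnt - 1 }).ev (weight n φ)) _ (fun h t' =>
          ((c (.ofBits (B.encG pp (h ^ expo a)))).run
            ((roIBKEM B).challenger ⟨pp, B.g pp ^ expo a⟩ a d) t').ev fun y => φ y.1) ?_
      intro ids' t' S' e' h ht' hS' hid he'
      rw [coinFactor_extract (v := v) hn, mul_assoc]
      refine ev_use ht' hS' hid he' false (fun _ => ⟨hch, rfl, rfl⟩) (fun h => by simp at h)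
        (fun ω e s => ((c (.ofBits (B.encG pp e.dkey))).run ((chal pp a b ω).oracle n)
          { s with cnt := s.cnt - 1 }).ev (weight n φ))
        (fun ω e s hs => ev_weight_of_bad _ _ hs) _ ?_
      intro S'' e'' ht'' hS'' hd _
      simp only [hd rfl]
      rw [← extracted_extract log v, ← challenged_extract log v] at ht'' hS''
      refine ih _ _ (hc _ ⟨h ^ expo a, rfl⟩) ?_ ht'' fun κ ω => ?_
      · exact hΛ.imp_right fun ⟨w, hw⟩ => ⟨w, by simp [hw]⟩
      · have h3 := hS'' κ ω
        refine ⟨h3.bad, ?_, h3.find_none, h3.find_some⟩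
        have h4 := h3.cnt
        simp only [h4, numExtracts, List.countP_append]
        rfl
    | challenge =>
      obtain ⟨l, y, hl⟩ := Comp.exists_post_of_always (exists_answer _) _ _
        (hc _ (exists_answer _ .challenge v).choose_spec)
      obtain ⟨hlog, hfst, hsnd⟩ := (hpost _ _ hl).challenge
      obtain rfl := hΛ.resolve_right hlog
      let R : B.G pp → B.G pp → Table (B.G pp) → ℝ≥0∞ := fun h₀ h₁ t' =>
        (B.unitLaw pp).ev fun r₀ => (B.unitLaw pp).ev fun r₁ =>
          ((c (.cons (.ofBits (B.encG₁ pp (if d then B.e pp (B.g pp ^ expo a) h₁ ^ expo r₁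
            else B.e pp (B.g pp ^ expo a) h₀ ^ expo r₀))) (.ofBits (B.encG pp (B.g pp ^ expo r₀))))
            ).run ((roIBKEM B).challenger ⟨pp, B.g pp ^ expo a⟩ a d) t').ev fun y => φ y.1
      -- The game draws `r₀` and `r₁` before the hash values, the simulation has them in the
      -- challenge from the start; independent draws commute.
      have hR : ((Comp.call .challenge v c).run
            ((roIBKEM B).challenger ⟨pp, B.g pp ^ expo a⟩ a d) t).ev (fun y => φ y.1) =
          (lazyHash (hashValue pp) v.fst.toBits t).ev fun y₀ =>
            (lazyHash (hashValue pp) v.snd.toBits y₀.2).ev fun y₁ => R y₀.1 y₁.1 y₁.2 := by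
        simp only [Comp.run, PMF.ev_bind, IBKEM.challenger, PMF.ev_map, roIBKEM, ROM.run,
          PMF.ev_pure]
        conv_lhs =>
          enter [2, r₀]
          rw [PMF.ev_comm]
        rw [PMF.ev_comm]
        refine PMF.ev_congr fun y₀ _ => ?_
        conv_lhs =>
          enter [2, r₀]
          rw [PMF.ev_comm]
        rw [PMF.ev_comm]
        rfl
      rw [hR]
      let F : Exponents pp → B.G₁ pp → B.State pp → ℝ≥0∞ := fun ω K s =>
        ((chal pp a b ω).ensure n v.snd s).ev fun y => (Entry.use n true y).ev fun y₁ =>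
          ((c (.cons (.ofBits (B.encG₁ pp K)) (.ofBits (B.encG pp (B.g pp ^ expo ω.1))))).run
            ((chal pp a b ω).oracle n) y₁.2).ev (weight n φ)
      have hF : ∀ κ ω, ((Comp.call .challenge v c).run ((chal pp a b ω).oracle n) (S κ ω)).ev
          (weight n φ) = ((chal pp a b ω).ensure n v.fst (S κ ω)).ev fun y =>
            (Entry.use n true (y.1, y.2)).ev fun y₀ => F ω y₀.1.ckey y₀.2 := by
        intro κ ω
        simp only [Comp.run, PMF.ev_bind, Challenge.oracle, PMF.ev_map, F]
        rfl
      have hFbad : ∀ ω K s, s.bad = true → F ω K s = 0 := by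
        intro ω K s hs
        simp only [F]
        rw [← PMF.ev_bind]
        exact PMF.ev_eq_zero fun y hy =>
          ev_weight_of_bad _ _ (bad_ensure_use (chal pp a b ω) n true v.snd s hs y hy)
      rw [avg_congr hF]
      refine ev_ensure v.fst ht hS (fun ω e s => (Entry.use n true (e, s)).ev fun y₀ =>
        F ω y₀.1.ckey y₀.2) _ (fun h₀ t₀ => (lazyHash (hashValue pp) v.snd.toBits t₀).ev
          fun y₁ => R h₀ y₁.1 y₁.2) ?_
      intro ids₀ t₀ S₀ e₀ h₀ ht₀ hS₀ hid₀ he₀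
      rw [coinFactor_challenge (v := v) hlog, mul_assoc]
      refine ev_use ht₀ hS₀ hid₀ he₀ true (fun h => by simp at h) (fun _ => ⟨hfst, rfl, rfl⟩)
        (fun ω e s => F ω e.ckey s) (fun ω e s hs => hFbad ω _ s hs) _ ?_
      intro S₀' e₀' ht₀' hS₀' _ hc₀
      simp only [hc₀ rfl]
      have hgen₀ := ht₀.generator _ _ hid₀
      clear hR hF hFbad hS hid₀ he₀ hS₀ ht₀
      refine ev_ensure v.snd ht₀' hS₀' (fun ω e s => (Entry.use n true (e, s)).ev fun y₁ =>
          ((c (.cons (.ofBits (B.encG₁ pp (B.e pp (B.g pp ^ expo a) h₀ ^ expo ω.2)))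
            (.ofBits (B.encG pp (B.g pp ^ expo ω.1))))).run
            ((chal pp a b ω).oracle n) y₁.2).ev (weight n φ)) _ (R h₀) ?_
      intro ids₁ t₁ S₁ e₁ h₁ ht₁ hS₁ hid₁ he₁
      rw [mul_assoc]
      refine ev_use ht₁ hS₁ hid₁ he₁ true (fun h => by simp at h) (fun _ => ⟨hsnd, rfl, rfl⟩)
        (fun ω e s => ((c (.cons (.ofBits (B.encG₁ pp (B.e pp (B.g pp ^ expo a) h₀ ^ expo ω.2)))
            (.ofBits (B.encG pp (B.g pp ^ expo ω.1))))).run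
            ((chal pp a b ω).oracle n) s).ev (weight n φ))
        (fun ω e s hs => ev_weight_of_bad _ _ hs) _ ?_
      -- The stored challenge key of the second identity is not needed; its coin only contributes a
      -- factor.
      intro S₁' e₁' ht₁' hS₁' _ _
      have hgen₁ := ht₁.generator _ _ hid₁
      rw [← extracted_challenge log v, ← challenged_challenge log v] at ht₁' hS₁'
      have hnum : numExtracts (log ++ [(.challenge, v)]) = numExtracts log := by
        simp [numExtracts]
      -- The induction hypothesis is applied for each fixed `(c, c')`, and only then is the average
      -- over it identified with the challenge of the game.
      have h2 : ∀ ω : Exponents pp, (coinsLaw n ids₁).ev (fun κ =>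
          ((c (.cons (.ofBits (B.encG₁ pp (B.e pp (B.g pp ^ expo a) h₀ ^ expo ω.2)))
            (.ofBits (B.encG pp (B.g pp ^ expo ω.1))))).run
            ((chal pp a b ω).oracle n) (S₁' κ ω)).ev (weight n φ)) =
          coinFactor n (log ++ [(.challenge, v)]) *
          ((c (.cons (.ofBits (B.encG₁ pp (B.e pp (B.g pp ^ expo a) h₀ ^ expo ω.2)))
            (.ofBits (B.encG pp (B.g pp ^ expo ω.1))))).run
            ((roIBKEM B).challenger ⟨pp, B.g pp ^ expo a⟩ a d) t₁).ev fun y => φ y.1 := by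
        intro ω
        have h3 := ih _ (log ++ [(.challenge, v)])
          (hc _ ⟨B.e pp (B.g pp ^ expo a) h₀ ^ expo ω.2, B.g pp ^ expo ω.1, rfl⟩)
          (Λ := PMF.pure ω) (Or.inr ⟨v, by simp⟩) ht₁' (by rw [hnum]; exact hS₁')
        rw [avg, PMF.ev_pure] at h3
        exact h3
      rw [avg]
      simp only [h2]
      rw [PMF.ev_mul_left, ev_keyLaw a d hgen₀ hgen₁ fun K C =>
        ((c (.cons (.ofBits (B.encG₁ pp K)) (.ofBits (B.encG pp C)))).run
            ((roIBKEM B).challenger ⟨pp, B.g pp ^ expo a⟩ a d) t₁).ev fun y => φ y.1]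

end BilinearGen

/-! ## The advantage of the solver -/

theorem coinLaw_true (n : ℕ) : coinLaw n true = 2 / ((n : ℝ≥0∞) + 2) := by
  rw [coinLaw, PMF.map_true_eq_ev, PMF.ev, tsum_fintype, Fin.sum_univ_succ, Fin.sum_univ_succ,
    Finset.sum_eq_zero]
  · simp only [PMF.uniformOfFintype_apply, Fintype.card_fin]
    have h : ((n + 1 + 1 : ℕ) : ℝ≥0∞) = (n : ℝ≥0∞) + 2 := by
      push_cast
      rw [add_assoc, one_add_one_eq_two]
    rw [h]
    simp only [Fin.val_zero, Fin.val_succ]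
    norm_num
    rw [← two_mul, div_eq_mul_inv]
  · intro i _
    simp [Fin.val_succ]

theorem toReal_coinLaw_true (n : ℕ) : (coinLaw n true).toReal = 2 / ((n : ℝ) + 2) := by
  rw [coinLaw_true, ENNReal.toReal_div, ENNReal.toReal_add (by simp) (by simp)]
  simp

theorem PMF.bind_apply_eq_ev {α β : Type} (μ : PMF α) (f : α → PMF β) (b : β) :
    μ.bind f b = μ.ev fun a => f a b := PMF.bind_apply μ f b

theorem PMF.toReal_bool (μ : PMF Bool) : (μ false).toReal = 1 - (μ true).toReal := by
  have h := μ.ev_const 1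
  rw [ev_bool, mul_one, mul_one] at h
  rw [← ENNReal.toReal_one, ← h, ENNReal.toReal_add (μ.apply_ne_top _) (μ.apply_ne_top _)]
  ring

theorem toReal_coinLaw (n : ℕ) :
    (coinLaw n false ^ n * coinLaw n true ^ 2).toReal = lossFactor n := by
  rw [ENNReal.toReal_mul, ENNReal.toReal_pow, ENNReal.toReal_pow, PMF.toReal_bool,
    toReal_coinLaw_true, lossFactor]

theorem PMF.ev_uniform_bool (φ : Bool → ℝ≥0∞) :
    (PMF.uniformOfFintype Bool).ev φ = 2⁻¹ * (φ true + φ false) := by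
  rw [ev_bool, uniformOfFintype_apply, uniformOfFintype_apply, mul_add]
  simp

/-- The fair coin contributes `1/2`, and each coin left contributes the probability of `false`; a
run with a wrong coin never outputs 1. -/
theorem finishLaw_true (n c : ℕ) (bad out : Bool) : finishLaw n c bad out true =
    2⁻¹ * if bad = true then 0 else coinLaw n false ^ c * if out = true then 0 else 1 := by
  induction c generalizing bad with
  | zero =>
    rw [finishLaw, PMF.map_true_eq_ev, PMF.ev, tsum_fintype, Fin.sum_univ_succ, Fin.sum_univ_succ]
    cases bad <;> cases out <;> simp
  | succ c ih =>
    rw [finishLaw, PMF.apply_eq_ev, PMF.ev_bind]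
    simp only [← PMF.apply_eq_ev]
    rw [PMF.ev_bool, ih, ih]
    cases bad
    · simp only [if_true, Bool.false_eq_true, if_false, mul_zero, zero_add, pow_succ]
      ring
    · simp

namespace BilinearGen

variable {B : BilinearGen} {pp : B.Param}

/-- The law of the output of the simulation. -/
def simLaw (A : Prog AdvOracle) (t n k : ℕ) (x : B.Challenge pp) : PMF Bool :=
  ((A.eval (.cons (B.header k pp) (.ofBits (B.encG pp x.ga))) t).run (x.oracle n)
    (⟨false, n, []⟩ : B.State pp)).bind fun y => finishLaw n y.2.cnt y.2.bad (outBit y.1)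

/-- The probability that the adversary outputs `b` when the challenge bit is `d`. -/
def outProb (A : Prog AdvOracle) (t k : ℕ) (a : (ZMod (B.q pp))ˣ) (d b : Bool) : ℝ≥0∞ :=
  ((A.eval ((roIBKEM B).encPK k ⟨pp, B.g pp ^ expo a⟩) t).run
    ((roIBKEM B).challenger ⟨pp, B.g pp ^ expo a⟩ a d) []).ev fun y =>
      if outBit y.1 = b then 1 else 0

/-- At the start the log is empty, so the coin factor is the whole product of `n` coins `false` and
two coins `true`. -/
theorem ev_simLaw (A : Prog AdvOracle) (t n k : ℕ) (a b : (ZMod (B.q pp))ˣ) (d : Bool)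
    (hA : (A.eval ((roIBKEM B).encPK k ⟨pp, B.g pp ^ expo a⟩) t).Always
      ((roIBKEM B).Answer ⟨pp, B.g pp ^ expo a⟩)
      (fun log y => y.isSome = true ∧ ObeysRules n log) []) :
    (keyLaw pp d).ev (fun ω => simLaw A t n k (chal pp a b ω) true) =
      2⁻¹ * (coinLaw n false ^ n * coinLaw n true ^ 2) * outProb A t k a d false := by
  have h1 : ∀ ω, simLaw A t n k (chal pp a b ω) true =
      2⁻¹ * ((A.eval (.cons (B.header k pp) (.ofBits (B.encG pp (B.g pp ^ expo a)))) t).run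
        ((chal pp a b ω).oracle n) (⟨false, n, []⟩ : B.State pp)).ev
        (weight n fun z => if outBit z = false then 1 else 0) := by
    intro ω
    rw [simLaw, PMF.apply_eq_ev, PMF.ev_bind, ← PMF.ev_mul_left]
    refine PMF.ev_congr fun y _ => ?_
    rw [← PMF.apply_eq_ev, finishLaw_true, weight]
    cases y.2.bad <;> cases outBit y.1 <;> simp
  have h2 := avg_run (n := n) a b d (fun z => if outBit z = false then 1 else 0)
    (fun log y h => h.2) _ [] hA (Or.inl rfl) (ids := []) (t := [])
    (S := fun _ _ => (⟨false, n, []⟩ : B.State pp))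
    ⟨by simp, by simp [extracted], by simp [challenged], by simp⟩
    (fun κ ω => ⟨rfl, rfl, fun _ _ => rfl, by simp⟩)
  rw [avg] at h2
  simp only [coinsLaw, PMF.ev_pure] at h2
  simp only [h1]
  rw [PMF.ev_mul_left, mul_assoc]
  refine congrArg (2⁻¹ * ·) (h2.trans ?_)
  rw [coinFactor, if_neg (by simp)]
  rfl

theorem outProb_add (A : Prog AdvOracle) (t k : ℕ) (a : (ZMod (B.q pp))ˣ) (d : Bool) :
    outProb A t k a d true + outProb A t k a d false = 1 := by
  rw [outProb, outProb, ← PMF.ev_add]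
  refine Eq.trans (PMF.ev_congr fun y _ => ?_) (PMF.ev_const _ 1)
  cases outBit y.1 <;> simp

/-- `outProb`, averaged over the master keys. -/
def meanOutProb (B : BilinearGen) (A : Prog AdvOracle) (t k : ℕ) (d b : Bool) : ℝ≥0∞ :=
  (B.gen k).ev fun pp => (B.unitLaw pp).ev fun a => outProb A t k a d b

theorem meanOutProb_add (A : Prog AdvOracle) (t k : ℕ) (d : Bool) :
    B.meanOutProb A t k d true + B.meanOutProb A t k d false = 1 := by
  simp only [meanOutProb, ← PMF.ev_add, outProb_add, PMF.ev_const]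

theorem ev_setup (k : ℕ) (Φ : (Σ pk : PubKey B, (ZMod (B.q pk.pp))ˣ) → ℝ≥0∞) :
    PMF.ev (α := Σ pk : PubKey B, (ZMod (B.q pk.pp))ˣ) ((roIBKEM B).setup k) Φ =
      (B.gen k).ev fun pp => (B.unitLaw pp).ev fun a => Φ ⟨⟨pp, B.g pp ^ expo a⟩, a⟩ := by
  have h : (roIBKEM B).setup k = (B.gen k).bind fun pp => (B.unitLaw pp).map fun s =>
    (⟨⟨pp, B.g pp ^ expo s⟩, s⟩ : Σ pk : PubKey B, (ZMod (B.q pk.pp))ˣ) := rfl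
  rw [h, PMF.ev_bind]
  refine PMF.ev_congr fun pp _ => ?_
  rw [PMF.ev_map]

theorem game_true (A : Prog AdvOracle) (T : Polynomial ℕ) (k : ℕ) :
    (roIBKEM B).game A T k true = 2⁻¹ * (B.meanOutProb A (T.eval k) k true true +
      B.meanOutProb A (T.eval k) k false false) := by
  have h1 : (roIBKEM B).game A T k true = (B.gen k).ev fun pp => (B.unitLaw pp).ev fun a =>
      2⁻¹ * (outProb A (T.eval k) k a true true + outProb A (T.eval k) k a false false) := by
    rw [IBKEM.game, PMF.bind_apply_eq_ev]
    refine (ev_setup k _).trans ?_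
    refine PMF.ev_congr fun pp _ => PMF.ev_congr fun a _ => ?_
    rw [PMF.bind_apply_eq_ev, PMF.ev_uniform_bool, PMF.map_true_eq_ev, PMF.map_true_eq_ev]
    simp only [decide_eq_true_eq]
    rfl
  rw [h1]
  simp only [PMF.ev_mul_left, PMF.ev_add, meanOutProb]

theorem toReal_meanOutProb (A : Prog AdvOracle) (t k : ℕ) (d : Bool) :
    (B.meanOutProb A t k d true).toReal = 1 - (B.meanOutProb A t k d false).toReal := by
  have h := B.meanOutProb_add A t k d
  have h1 : B.meanOutProb A t k d true ≠ ∞ :=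
    ne_top_of_le_ne_top ENNReal.one_ne_top (h ▸ le_self_add)
  have h2 : B.meanOutProb A t k d false ≠ ∞ :=
    ne_top_of_le_ne_top ENNReal.one_ne_top (h ▸ le_add_self)
  rw [← ENNReal.toReal_one, ← h, ENNReal.toReal_add h1 h2]
  ring

/-- Output 1 under bit 1 is complementary to output 0 under bit 1, so the constant `1/2` cancels.
The remaining factor `2⁻¹` matches the last fair coin of the solver. -/
theorem advantage_eq (A : Prog AdvOracle) (T : Polynomial ℕ) (k : ℕ) :
    (roIBKEM B).advantage A T k = 2⁻¹ * ((B.meanOutProb A (T.eval k) k false false).toReal -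
      (B.meanOutProb A (T.eval k) k true false).toReal) := by
  have h1 : ∀ d, B.meanOutProb A (T.eval k) k d d ≠ ∞ := fun d =>
    ne_top_of_le_ne_top ENNReal.one_ne_top (by
      rw [← B.meanOutProb_add A (T.eval k) k d]
      cases d
      · exact le_add_self
      · exact le_self_add)
  rw [IBKEM.advantage, game_true, ENNReal.toReal_mul, ENNReal.toReal_add (h1 _) (h1 _),
    toReal_meanOutProb, ENNReal.toReal_inv]
  simp only [ENNReal.toReal_ofNat]
  ring

/-- The advantage of a program that carries out the simulation. -/
theorem dbdhAdvantage_eq {A : Prog AdvOracle} {T : Polynomial ℕ} {qp : ℕ → ℕ}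
    (hA : (roIBKEM B).IsPPTAdversary A T qp) {D : Prog Empty} {T' : Polynomial ℕ} {k : ℕ}
    (hD : ∀ pp ∈ (B.gen k).support, ∀ (a b : (ZMod (B.q pp))ˣ) (ω : Exponents pp),
      outputLaw D ((chal pp a b ω).enc k) (T'.eval k) =
        simLaw A (T.eval k) (qp k) k (chal pp a b ω)) :
    B.dbdhAdvantage D T' k = lossFactor (qp k) * (roIBKEM B).advantage A T k := by
  have hA' : ∀ pp ∈ (B.gen k).support, ∀ a : (ZMod (B.q pp))ˣ,
      (A.eval ((roIBKEM B).encPK k ⟨pp, B.g pp ^ expo a⟩) (T.eval k)).Always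
        ((roIBKEM B).Answer ⟨pp, B.g pp ^ expo a⟩)
        (fun log y => y.isSome = true ∧ ObeysRules (qp k) log) [] := by
    intro pp hpp a
    refine hA k ⟨⟨pp, B.g pp ^ expo a⟩, a⟩ ?_
    refine (PMF.mem_support_bind_iff _ _ _).2 ⟨pp, hpp, (PMF.mem_support_map_iff _ _ _).2
      ⟨a, PMF.mem_support_uniformOfFintype _, rfl⟩⟩
  have key : ∀ d, ((B.gen k).ev fun pp => (B.unitLaw pp).ev fun a => (B.unitLaw pp).ev fun b =>
      (keyLaw pp d).ev fun ω => outputLaw D ((chal pp a b ω).enc k) (T'.eval k) true) =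
      2⁻¹ * (coinLaw (qp k) false ^ (qp k) * coinLaw (qp k) true ^ 2) *
        B.meanOutProb A (T.eval k) k d false := by
    intro d
    rw [meanOutProb, ← PMF.ev_mul_left]
    refine PMF.ev_congr fun pp hpp => ?_
    rw [← PMF.ev_mul_left]
    refine PMF.ev_congr fun a _ => ?_
    rw [← PMF.ev_const (B.unitLaw pp) (2⁻¹ * _ * outProb A (T.eval k) k a d false)]
    refine PMF.ev_congr fun b _ => ?_
    simp only [hD pp hpp]
    exact ev_simLaw A _ _ _ a b d (hA' pp hpp a)
  have hreal : B.dbdhReal D T' k true = 2⁻¹ * (coinLaw (qp k) false ^ (qp k) *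
      coinLaw (qp k) true ^ 2) * B.meanOutProb A (T.eval k) k false false := by
    rw [← key, dbdhReal]
    simp only [PMF.bind_apply_eq_ev, keyLaw, Bool.false_eq_true, if_false, PMF.ev_map]
    rfl
  have hrandom : B.dbdhRandom D T' k true = 2⁻¹ * (coinLaw (qp k) false ^ (qp k) *
      coinLaw (qp k) true ^ 2) * B.meanOutProb A (T.eval k) k true false := by
    rw [← key, dbdhRandom]
    simp only [PMF.bind_apply_eq_ev, PMF.ev_bind, keyLaw, if_true, PMF.ev_map]
    refine PMF.ev_congr fun pp _ => PMF.ev_congr fun a _ => PMF.ev_congr fun b _ =>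
      PMF.ev_congr fun c _ => ?_
    -- The uniform exponent `y` is written as `a b c'` with `c'` uniform, which brings the random
    -- instance into the form of `chal`.
    rw [ev_unitLaw_equiv (Equiv.mulLeft (a * b))]
    refine PMF.ev_congr fun c' _ => ?_
    have h : B.e pp (B.g pp) (B.g pp) ^ expo (a * b * c') =
        B.gt pp ^ (expo a * expo b * expo c') := by
      refine pow_congr_G₁ ?_ _
      simp only [Nat.cast_mul, cast_expo, Units.val_mul]
    rw [Equiv.coe_mulLeft, h]
    rfl
  have hr := toReal_coinLaw (qp k)
  generalize coinLaw (qp k) false ^ (qp k) * coinLaw (qp k) true ^ 2 = r at *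
  rw [dbdhAdvantage, hreal, hrandom, advantage_eq, ← hr]
  simp only [ENNReal.toReal_mul]
  simp only [ENNReal.toReal_inv, ENNReal.toReal_ofNat]
  ring

end BilinearGen

/-! ## Polynomial bounds -/

/-- `f` is bounded by a polynomial. -/
def PolyBounded (f : ℕ → ℕ) : Prop := ∃ P : Polynomial ℕ, ∀ k, f k ≤ P.eval k

namespace PolyBounded

variable {f g : ℕ → ℕ}

theorem mono (hg : PolyBounded g) (h : ∀ k, f k ≤ g k) : PolyBounded f :=
  hg.imp fun _ hP k => (h k).trans (hP k)

theorem eval (P : Polynomial ℕ) : PolyBounded fun k => P.eval k := ⟨P, fun _ => le_rfl⟩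

theorem const (n : ℕ) : PolyBounded fun _ => n := ⟨.C n, fun k => by simp⟩

theorem id : PolyBounded fun k => k := ⟨.X, fun k => by simp⟩

theorem add (hf : PolyBounded f) (hg : PolyBounded g) : PolyBounded fun k => f k + g k := by
  obtain ⟨P, hP⟩ := hf
  obtain ⟨Q, hQ⟩ := hg
  exact ⟨P + Q, fun k => by rw [Polynomial.eval_add]; exact add_le_add (hP k) (hQ k)⟩

theorem mul (hf : PolyBounded f) (hg : PolyBounded g) : PolyBounded fun k => f k * g k := by
  obtain ⟨P, hP⟩ := hf
  obtain ⟨Q, hQ⟩ := hg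
  exact ⟨P * Q, fun k => by rw [Polynomial.eval_mul]; exact Nat.mul_le_mul (hP k) (hQ k)⟩

end PolyBounded

theorem PMF.Coupled.exists_right {α β : Type} {R : α → β → Prop} {μ : PMF α} {ν : PMF β}
    (h : PMF.Coupled R μ ν) {a : α} (ha : a ∈ μ.support) : ∃ b ∈ ν.support, R a b := by
  obtain ⟨π, rfl, rfl, hR⟩ := h
  obtain ⟨x, hx, rfl⟩ := (mem_support_map_iff _ _ _).1 ha
  exact ⟨x.2, (mem_support_map_iff _ _ _).2 ⟨x, hx, rfl⟩, hR x hx⟩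

theorem PMF.Coupled.map_eq {α β : Type} {μ : PMF α} {ν : PMF β} {f : β → α}
    (h : PMF.Coupled (fun a b => f b = a) μ ν) : ν.map f = μ := by
  obtain ⟨π, rfl, rfl, hR⟩ := h
  rw [map_comp]
  exact bind_congr_support _ fun x hx => congrArg PMF.pure (hR x hx)

/-- A program makes its input grow by at most its running time, up to a constant factor. -/
theorem Prog.Computes.height_le {p : Prog Empty} {v w : Val} {t : ℕ} (hp : p.Computes v w t) :
    w.height ≤ v.height + 2 * t := by
  let h : Empty → Val → Unit → PMF (Val × Unit) := fun o => o.elim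
  obtain ⟨y, hy⟩ := ((p.eval v t).run h ()).support_nonempty
  obtain ⟨-, t', h1⟩ := Comp.post_of_always (Inv := fun _ => True) (fun o => o.elim) [] _ hp ()
    trivial y hy
  -- Here the imitation serves only for its bound on the height of the output; without oracles the
  -- state is trivial.
  have h2 := Prog.imitates (h := h) (h' := fun o : Empty => o.elim) (code := fun o => o.elim)
    (Inv := fun _ _ => True) (enc := fun _ => .nil) (N := 0) (H := 0) (M := v.height + 2 * t)
    (fun _ _ _ _ _ => trivial) (fun o => o.elim) p v t () _ _ trivial le_rfl (by omega) le_rfl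
    le_rfl
  obtain ⟨z, -, hz⟩ := h2.exists_right hy
  obtain ⟨-, -, -, d, -, -, -, h3, -⟩ := hz w t' h1
  omega

/-- A unary number is a tree at least as high as it is large, so its value is bounded by the time
spent on computing it. -/
theorem PolyBounded.of_unaryPolyTime {f : ℕ → ℕ} (hf : UnaryPolyTime f) : PolyBounded f := by
  obtain ⟨p, T, hp⟩ := hf
  refine ((id.add (const 1)).add ((const 2).mul (eval T))).mono fun k => ?_
  have h1 := (hp k).height_le
  have h2 := Val.length_toBits_le (Val.unary (f k))
  have h3 := Val.height_ofBits_le (List.replicate k true)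
  rw [Val.unary, Val.toBits_ofBits, List.length_replicate] at h2
  rw [List.length_replicate] at h3
  rw [Val.unary, Val.unary] at h1
  omega

/-! ### Admissible simulated answers, and the time bound of the solver -/

namespace BilinearGen

variable {B : BilinearGen} {pp : B.Param}

/-- Every hash value in the table of the state is a generator. -/
def State.Generators (s : B.State pp) : Prop :=
  ∀ e ∈ s.tab, ∃ x : (ZMod (B.q pp))ˣ, B.g pp ^ expo x = e.hash

theorem exists_expo_eq {i : ℕ} (hi : 0 < i) (hi' : i < B.q pp) :
    ∃ x : (ZMod (B.q pp))ˣ, expo x = i := by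
  have h : (i : ZMod (B.q pp)) ≠ 0 := by
    rw [Ne, ZMod.natCast_eq_zero_iff]
    exact Nat.not_dvd_of_pos_of_lt hi hi'
  exact ⟨Units.mk0 _ h, ZMod.val_cast_of_lt hi'⟩

/-- The promises of the adversary presuppose that hash answers are some `g^x` with `x` in `Z_q^*`.
The simulated ones are: the drawn exponents are not 0, and `b` is invertible. -/
theorem generators_ensure (a b : (ZMod (B.q pp))ˣ) (ω : Exponents pp) (n : ℕ) (v : Val)
    (s : B.State pp) (hs : s.Generators) : ∀ y ∈ ((chal pp a b ω).ensure n v s).support,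
      y.2.Generators ∧ ∃ x : (ZMod (B.q pp))ˣ, B.g pp ^ expo x = y.1.hash := by
  intro y hy
  rw [Challenge.ensure] at hy
  rcases hf : s.find v.toBits with _ | e
  · rw [hf] at hy
    simp only [PMF.mem_support_bind_iff, PMF.mem_support_map_iff] at hy
    obtain ⟨β, -, i, -, rfl⟩ := hy
    have hq := (B.q_prime pp).out.two_le
    obtain ⟨x, hx⟩ := exists_expo_eq (pp := pp) (Nat.succ_pos i) (by have := i.isLt; omega)
    have h1 : ∃ x : (ZMod (B.q pp))ˣ,
        B.g pp ^ expo x = ((chal pp a b ω).entry v β i).hash := by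
      cases β
      · exact ⟨x, by rw [hx]; rfl⟩
      · refine ⟨b * x, ?_⟩
        simp only [Challenge.entry, chal, if_true]
        rw [← Nat.succ_eq_add_one, ← hx, ← pow_mul]
        exact pow_congr_G (by simp only [Nat.cast_mul, cast_expo, Units.val_mul]) _
    refine ⟨fun e he => ?_, h1⟩
    rcases List.mem_cons.1 he with rfl | he
    · exact h1
    · exact hs e he
  · rw [hf] at hy
    simp only [PMF.support_pure, Set.mem_singleton_iff] at hy
    subst hy
    exact ⟨hs, hs e (List.mem_of_find?_eq_some hf)⟩

theorem generators_ensure_use (a b : (ZMod (B.q pp))ˣ) (ω : Exponents pp) (n : ℕ) (want : Bool)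
    (v : Val) (s : B.State pp) (hs : s.Generators) :
    ∀ y ∈ (((chal pp a b ω).ensure n v s).bind (Entry.use n want)).support, y.2.Generators := by
  intro y hy
  rw [PMF.mem_support_bind_iff] at hy
  obtain ⟨z, hz, hy⟩ := hy
  rw [Entry.use, PMF.mem_support_map_iff] at hy
  obtain ⟨β, -, rfl⟩ := hy
  obtain ⟨h1, h2⟩ := generators_ensure a b ω n v s hs z hz
  intro e he
  rcases List.mem_cons.1 he with rfl | he
  · exact h2
  · exact h1 e he

/-- The answers of the simulated oracles have the right form. -/
theorem answer_oracle (a b : (ZMod (B.q pp))ˣ) (ω : Exponents pp) (n : ℕ) (P : B.G pp)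
    (o : AdvOracle) (v : Val) (s : B.State pp) (hs : s.Generators) :
    ∀ y ∈ ((chal pp a b ω).oracle n o v s).support,
      (roIBKEM B).Answer ⟨pp, P⟩ o v y.1 ∧ y.2.Generators := by
  intro y hy
  cases o with
  | hash =>
    rw [Challenge.oracle, PMF.mem_support_map_iff] at hy
    obtain ⟨z, hz, rfl⟩ := hy
    obtain ⟨h1, x, hx⟩ := generators_ensure a b ω n v s hs z hz
    exact ⟨⟨z.1.hash, (PMF.mem_support_map_iff _ _ _).2
      ⟨x, PMF.mem_support_uniformOfFintype _, hx⟩, rfl⟩, h1⟩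
  | extract =>
    rw [Challenge.oracle, PMF.mem_support_map_iff] at hy
    obtain ⟨z, hz, rfl⟩ := hy
    exact ⟨⟨z.1.dkey, rfl⟩, generators_ensure_use a b ω n false v s hs z hz⟩
  | challenge =>
    rw [Challenge.oracle, PMF.mem_support_bind_iff] at hy
    obtain ⟨z, hz, hy⟩ := hy
    rw [PMF.mem_support_map_iff] at hy
    obtain ⟨z', hz', rfl⟩ := hy
    exact ⟨⟨z.1.ckey, (chal pp a b ω).gc, rfl⟩, generators_ensure_use a b ω n true _ _
      (generators_ensure_use a b ω n true _ s hs z hz) z' hz'⟩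

theorem outputLaw_eq (D : Prog Empty) (v : Val) (t : ℕ) :
    outputLaw D v t = (D.exec (fun o => o.elim) v t).map outBit := by
  rw [outputLaw, Prog.exec, ← Comp.run_map_fst (h := fun o => o.elim) (fun o => o.elim),
    PMF.map_comp]
  rfl

theorem setup_support {k : ℕ} (hpp : pp ∈ (B.gen k).support) (a : (ZMod (B.q pp))ˣ) :
    (⟨⟨pp, B.g pp ^ expo a⟩, a⟩ : Σ pk : PubKey B, (ZMod (B.q pk.pp))ˣ) ∈
      ((roIBKEM B).setup k).support :=
  (PMF.mem_support_bind_iff _ _ _).2 ⟨pp, hpp, (PMF.mem_support_map_iff _ _ _).2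
      ⟨a, PMF.mem_support_uniformOfFintype _, rfl⟩⟩

/-- The solver carries out the simulation in polynomial time. -/
theorem exists_simulation (hB : B.Efficient) {A : Prog AdvOracle} {T : Polynomial ℕ} {qp : ℕ → ℕ}
    (hqp : UnaryPolyTime qp) (hA : (roIBKEM B).IsPPTAdversary A T qp) :
    ∃ (D : Prog Empty) (T' : Polynomial ℕ), ∀ k, ∀ pp ∈ (B.gen k).support,
      ∀ (a b : (ZMod (B.q pp))ˣ) (ω : Exponents pp),
      PMF.Coupled (fun b z => ∃ t', z = some (.ofBool b, t'))
        (simLaw A (T.eval k) (qp k) k (chal pp a b ω))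
        (D.exec (fun o => o.elim) ((chal pp a b ω).enc k) (T'.eval k)) := by
  obtain ⟨T₀, hsize⟩ := hB.size
  obtain ⟨mulG, TG, hG⟩ := hB.mul_G
  obtain ⟨mulG₁, TG₁, hG₁⟩ := hB.mul_G₁
  have hbound := PolyBounded.of_unaryPolyTime hqp
  obtain ⟨queries, Tq, hq⟩ := hqp
  let N : ℕ → ℕ := fun k => TG.eval k + TG₁.eval k
  -- The order has at most `T₀ + 1` binary digits, and each of the two decrements is allowed one
  -- more.
  let l : ℕ → ℕ := fun k => T₀.eval k + 3
  let L : ℕ → ℕ := fun k => 4 * T.eval k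
  let H : ℕ → ℕ := fun k => T₀.eval k + 2
  -- The first summand bounds the height of the public key, made of `1^k`, the order, the
  -- description and two group elements; the rest is the potential of the running time.
  let M : ℕ → ℕ := fun k => (k + 4 * T₀.eval k + 20) + 2 * T.eval k
  obtain ⟨T', hT'⟩ : PolyBounded fun k => Tq.eval k + qp k * (16 * (1 + qp k) + 30) + 32 * l k +
      100 + (A.nodes * ((2 * ensureTime (N k) (l k) (M k) (L k) + 300) + 20)) * T.eval k +
        (50 * qp k + 50) := by
    simp only [ensureTime, N, l, L, M]
    repeat' first
      | exact PolyBounded.eval _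
      | exact hbound
      | exact PolyBounded.const _
      | exact PolyBounded.id
      | apply PolyBounded.add
      | apply PolyBounded.mul
  refine ⟨Prog.solver A queries mulG mulG₁, T', fun k pp hpp a b ω => ?_⟩
  obtain ⟨hq2, hdesc, hencG, hencG₁⟩ := hsize k pp hpp
  have hbits : (Val.ofNat (B.q pp)).toBits.length ≤ T₀.eval k + 1 := by
    rw [Val.ofNat, Val.toBits_ofBits]
    refine Val.length_bits_le (hq2.trans_lt ?_)
    exact Nat.pow_lt_pow_right one_lt_two (Nat.lt_succ_self _)
  refine coupled_solver (n := qp k) (N := N k) (l := l k) (L := L k) (H := H k) (M := M k)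
    (Tq := Tq.eval k) (chal pp a b ω) A ?_ ?_ ?_ ?_ ?_ le_rfl ?_ ?_ ?_ ?_ _ (hT' k)
  · exact fun y z => ((Sem.of_computes (hG k pp hpp y z) _).mono (Nat.le_add_right _ _))
  · exact fun y z => ((Sem.of_computes (hG₁ k pp hpp y z) _).mono (Nat.le_add_left _ _))
  · exact Sem.of_computes (hq k) _
  · simp only [l]
    omega
  · intro y hy
    -- The adversary halts in time for all answers of the right form, hence also when it faces the
    -- simulation instead of the game.
    obtain ⟨-, h1, -⟩ := Comp.post_of_always (Inv := State.Generators)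
      (fun o v s hs => answer_oracle a b ω (qp k) (B.g pp ^ expo a) o v s hs) [] _
      (hA k _ (setup_support hpp a)) _ (by simp [State.Generators]) y hy
    exact h1
  · simp only [H, M]
    omega
  · have h1 := Val.height_ofBits_le (List.replicate k true)
    have h2 := Val.height_ofBits_le (B.q pp).bits
    have h3 := Val.height_ofBits_le (B.desc pp)
    have h4 := Val.height_ofBits_le (B.encG pp (B.g pp))
    have h5 := Val.height_ofBits_le (B.encG pp (chal pp a b ω).ga)
    have h6 := hencG (B.g pp)
    have h7 := hencG (chal pp a b ω).ga
    rw [Val.ofNat, Val.toBits_ofBits] at hbits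
    rw [List.length_replicate] at h1
    simp only [M, Val.height, header, Val.unary, Val.ofNat]
    omega
  · exact fun y => Nat.add_le_add_right (hencG y) 2
  · exact fun y => Nat.add_le_add_right (hencG₁ y) 2

theorem exists_solver (hB : B.Efficient) {A : Prog AdvOracle} {T : Polynomial ℕ} {qp : ℕ → ℕ}
    (hqp : UnaryPolyTime qp) (hA : (roIBKEM B).IsPPTAdversary A T qp) :
    ∃ (D : Prog Empty) (T' : Polynomial ℕ), B.IsPPTSolver D T' ∧
      ∀ k, B.dbdhAdvantage D T' k = lossFactor (qp k) * (roIBKEM B).advantage A T k := by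
  obtain ⟨D, T', hD⟩ := exists_simulation hB hqp hA
  refine ⟨D, T', fun k pp hpp a b c y => ?_, fun k => dbdhAdvantage_eq hA
    fun pp hpp a b ω => ?_⟩
  · have h1 : (chal pp a b (c, a⁻¹ * b⁻¹ * y)).enc k =
        B.dbdhInput k pp a b c (B.e pp (B.g pp) (B.g pp) ^ expo y) := by
      have h2 : B.gt pp ^ (expo a * expo b * expo (a⁻¹ * b⁻¹ * y)) = B.gt pp ^ expo y := by
        refine pow_congr_G₁ ?_ _
        simp only [Nat.cast_mul, cast_expo, ← Units.val_mul]
        congr 1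
        calc a * b * (a⁻¹ * b⁻¹ * y) = a * a⁻¹ * (b * b⁻¹) * y := by ac_rfl
          _ = y := by simp
      simp only [Challenge.enc, chal, h2]
      rfl
    rw [← h1]
    refine Comp.always_of_law (h := fun o => o.elim) (fun o => o.elim) [] _ fun z hz => ?_
    obtain ⟨β, -, t', rfl⟩ := (hD k pp hpp a b (c, a⁻¹ * b⁻¹ * y)).exists_left hz
    rfl
  · rw [outputLaw_eq]
    refine PMF.Coupled.map_eq ((hD k pp hpp a b ω).mono fun β _ z _ ⟨t', h⟩ => ?_)
    rw [h]
    exact Val.isCons_ofBool β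

end BilinearGen

/-! ## Consistency and malleability -/

namespace BilinearGen

variable {B : BilinearGen} {pp : B.Param}

/-- `e(P, H(ID))^r`. -/
def fim (B : BilinearGen) (pk : PubKey B) (id : List Bool) (r : (ZMod (B.q pk.pp))ˣ) :
    ROM (B.G pk.pp) (B.G₁ pk.pp) :=
  .hash id fun h => .ret (B.e pk.pp pk.P h ^ expo r)

/-- Bilinearity is postulated for powers of `g` only; this suffices since `h` is such a power, and
both sides are `e(g,g)` to the same product of exponents. -/
theorem e_decaps (s r : ℕ) (h : B.G pp) :
    B.e pp (B.g pp ^ r) (h ^ s) = B.e pp (B.g pp ^ s) h ^ r := by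
  obtain ⟨i, rfl⟩ := exists_pow_eq (B.q_prime pp).out.pos (B.card_G pp) (B.g_generates pp) h
  rw [← pow_mul, e_pow_pow, e_pow_pow, ← pow_mul]
  ring_nf

theorem mem_setup {k : ℕ} {x : Σ pk : PubKey B, (ZMod (B.q pk.pp))ˣ}
    (hx : x ∈ ((roIBKEM B).setup k).support) :
    x.1.pp ∈ (B.gen k).support ∧ x.1.P = B.g x.1.pp ^ expo x.2 := by
  obtain ⟨pp, hpp, hx⟩ := (PMF.mem_support_bind_iff _ _ _).1 hx
  obtain ⟨s, -, rfl⟩ := (PMF.mem_support_map_iff _ _ _).1 hx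
  exact ⟨hpp, rfl⟩

theorem malleable_fim (B : BilinearGen) : (roIBKEM B).Malleable B.fim := by
  rintro k ⟨⟨pp, P⟩, s⟩ hx H id id' r
  have h : P = B.g pp ^ expo (n := B.q pp) s := (mem_setup hx).2
  have h' := e_decaps (pp := pp) (expo (n := B.q pp) s) (expo (n := B.q pp) r) (H id')
  rw [← h] at h'
  exact congrArg some h'

theorem consistent (B : BilinearGen) : (roIBKEM B).Consistent := by
  rintro k ⟨⟨pp, P⟩, s⟩ hx H id r
  exact malleable_fim B k _ hx H id id r

theorem _root_.Polynomial.eval_nat_mono (P : Polynomial ℕ) {i j : ℕ} (h : i ≤ j) :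
    P.eval i ≤ P.eval j := by
  rw [Polynomial.eval_eq_sum, Polynomial.eval_eq_sum]
  exact Finset.sum_le_sum fun n _ => Nat.mul_le_mul_left _ (Nat.pow_le_pow_left h n)

/-- The program for `fim`. -/
def fimCode (pairing mulG₁ : Prog Empty) : Prog Unit :=
  .pair (.fst ⨾ .fst) (.pair
    (.pair (.fst ⨾ .fst) (.pair (.fst ⨾ .snd) (.snd ⨾ .fst ⨾ .call ())) ⨾ pairing.lift)
    (.snd ⨾ .snd ⨾ Prog.carry false)) ⨾ Prog.pow mulG₁.lift

theorem sem_fimCode {h : Unit → Val → PMF Val} {h' : Empty → Val → PMF Val}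
    {pairing mulG₁ : Prog Empty} {k N l : ℕ} {P y : B.G pp} {idv : Val}
    (hG₁ : ∀ x y : B.G₁ pp, Sem h' mulG₁ (.cons (B.header k pp) (.cons (.ofBits (B.encG₁ pp x))
      (.ofBits (B.encG₁ pp y)))) N (PMF.pure (.ofBits (B.encG₁ pp (x * y)))))
    (hpairing : Sem h' pairing (.cons (B.header k pp) (.cons (.ofBits (B.encG pp P))
      (.ofBits (B.encG pp y)))) N (PMF.pure (.ofBits (B.encG₁ pp (B.e pp P y)))))
    (hy : h () idv = PMF.pure (.ofBits (B.encG pp y))) (r : (ZMod (B.q pp))ˣ)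
    (hl : (expo r).bits.length ≤ l) :
    Sem h (fimCode pairing mulG₁) (.cons (.cons (B.header k pp) (.ofBits (B.encG pp P)))
      (.cons idv (.ofBits (expo r).bits))) (N + 16 * l + 40 + (2 * N + 50) * (l + 2))
      (PMF.pure (.ofBits (B.encG₁ pp (B.e pp P y ^ expo r)))) := by
  -- `Prog.pow` raises to one more than the given number, so `r` is decremented beforehand.
  obtain ⟨w, h1, h2, h3⟩ := Sem.decrement (h := h) (Val.ofNat (expo r))
    (by rw [Val.toNat_ofNat]; exact expo_pos r)
  rw [Val.toNat_ofNat] at h2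
  rw [Val.ofNat, Val.toBits_ofBits] at h1 h3
  have h4 := Sem.pow (h := h) (fun x : B.G₁ pp => Val.ofBits (B.encG₁ pp x)) (B.header k pp)
    mulG₁.lift N (fun x y => (hG₁ x y).lift) (B.e pp P y) w
  rw [h2] at h4
  have h5 : Sem h (.call () : Prog Unit) idv 1 (PMF.pure (.ofBits (B.encG pp y))) :=
    (Sem.call ()).congr hy
  have h6 := ((Sem.straight' (k := 2) (p := .fst ⨾ .fst) rfl rfl rfl).pair'
    ((((Sem.straight' (k := 2) (p := .fst ⨾ .fst) rfl rfl rfl).pair'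
      ((Sem.straight' (k := 2) (p := .fst ⨾ .snd) rfl rfl rfl).pair'
      ((Sem.straight' (k := 2) (p := .snd ⨾ .fst) rfl rfl rfl).seq' h5))).seq' hpairing.lift).pair'
    ((Sem.straight' (k := 2) (p := .snd ⨾ .snd) (v := .cons (.cons (B.header k pp)
      (.ofBits (B.encG pp P))) (.cons idv (.ofBits (expo r).bits))) rfl rfl rfl).seq' h1))).seq' h4
  refine h6.mono ?_
  have h7 := Nat.mul_le_mul_left (2 * N + 50) (show w.toBits.length + 1 ≤ l + 2 by omega)
  omega

theorem efficientFIM_fim (hB : B.Efficient) : (roIBKEM B).EfficientFIM B.fim := by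
  obtain ⟨T₀, hsize⟩ := hB.size
  obtain ⟨mulG₁, TG₁, hG₁⟩ := hB.mul_G₁
  obtain ⟨pairing, Te, he⟩ := hB.pairing
  obtain ⟨T, hT⟩ : PolyBounded fun k => (TG₁.eval k + Te.eval k) + 16 * (T₀.eval k + 1) + 40 +
      (2 * (TG₁.eval k + Te.eval k) + 50) * (T₀.eval k + 1 + 2) := by
    repeat' first
      | exact PolyBounded.eval _
      | exact PolyBounded.const _
      | apply PolyBounded.add
      | apply PolyBounded.mul
  refine ⟨fimCode pairing mulG₁, T, ?_⟩
  rintro k ⟨⟨pp, P⟩, s⟩ hx H id r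
  have hpp : pp ∈ (B.gen k).support := (mem_setup hx).1
  refine Comp.always_of_law
    (h := fun _ v => PMF.pure (Val.ofBits (B.encG pp (H v.toBits)))) (fun _ v a ha => ?_) [] _
    fun a ha => ?_
  · rw [PMF.support_pure]
    exact ha
  · have hr : (expo r).bits.length ≤ T₀.eval k + 1 :=
      (Val.length_bits_le ((expo_lt r).trans_le (hsize k pp hpp).1)).trans (Nat.le_succ _)
    have h1 := sem_fimCode (h := fun _ v => PMF.pure (Val.ofBits (B.encG pp (H v.toBits))))
      (h' := fun o => o.elim) (N := TG₁.eval k + Te.eval k) (P := P) (y := H id) (idv := .ofBits id)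
      (fun x y => (Sem.of_computes (hG₁ k pp hpp x y) _).mono (Nat.le_add_right _ _))
      ((Sem.of_computes (he k pp hpp P (H id)) _).mono (Nat.le_add_left _ _))
      (by rw [Val.toBits_ofBits]) r hr _
      -- The time does not depend on the length of the identity, since a call of the hash oracle
      -- costs one unit.
      ((hT k).trans (T.eval_nat_mono (Nat.le_add_right k id.length)))
    obtain ⟨w, hw, t', rfl, -⟩ := h1.exists_left ha
    rw [PMF.support_pure, Set.mem_singleton_iff] at hw
    exact ⟨t', by rw [hw]; rfl⟩

/-! ## Collisions -/

/-- The probability is `1/(q-1)`, and `q ≤ 2(q-1)` for `q ≥ 2`. -/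
theorem ev_unitLaw_eq_le (c : (ZMod (B.q pp))ˣ) :
    ((B.unitLaw pp).ev fun x => if x = c then 1 else 0) ≤ 2 * (B.q pp : ℝ≥0∞)⁻¹ := by
  have hq := (B.q_prime pp).out.two_le
  rw [← PMF.apply_eq_ev, unitLaw, PMF.uniformOfFintype_apply, ZMod.card_units, ← div_eq_mul_inv,
    ENNReal.le_div_iff_mul_le (Or.inl (by simp; omega)) (Or.inl (by simp)), mul_comm,
    ← div_eq_mul_inv]
  refine ENNReal.div_le_of_le_mul ?_
  exact_mod_cast (by omega : B.q pp ≤ 2 * (B.q pp - 1))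

theorem gt_pow_injective {i j : ℕ} (h : B.gt pp ^ i = B.gt pp ^ j) : (i : ZMod (B.q pp)) = j :=
  pow_inj_cast (B.card_G₁ pp) (B.e_generates pp) h

-- With one identity the two values are powers of the same generator, so different exponents cannot
-- collide. With two, the second hash value is fresh and must hit one prescribed value.
open Classical in
theorem collision_le (a : (ZMod (B.q pp))ˣ) (id id' : List Bool) (r r' : (ZMod (B.q pp))ˣ) :
    ((B.fim ⟨pp, B.g pp ^ expo a⟩ id r).run (hashValue pp) []).ev (fun y =>
      ((B.fim ⟨pp, B.g pp ^ expo a⟩ id' r').run (hashValue pp) y.2).ev fun y' =>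
        if (id ≠ id' ∨ r ≠ r') ∧ y.1 = y'.1 then 1 else 0) ≤ 2 * (B.q pp : ℝ≥0∞)⁻¹ := by
  have h1 : lazyHash (hashValue pp) id [] =
      (hashValue pp).bind fun h => PMF.pure (h, [(id, h)]) := rfl
  simp only [fim, ROM.run, h1, PMF.ev_bind, PMF.ev_pure]
  rw [hashValue, PMF.ev_map, ← hashValue]
  rw [← PMF.ev_const (B.unitLaw pp) (2 * _)]
  refine PMF.ev_mono fun x _ => ?_
  by_cases hid : id' = id
  · subst hid
    have h2 : lazyHash (hashValue pp) id' [(id', B.g pp ^ expo x)] =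
        PMF.pure (B.g pp ^ expo x, [(id', B.g pp ^ expo x)]) := by
      simp [lazyHash]
    rw [h2, PMF.ev_pure, if_neg]
    · exact zero_le
    · rintro ⟨h3, h4⟩
      refine h3.resolve_left (fun h => h rfl) ?_
      simp only [e_pow_pow, ← pow_mul] at h4
      have h5 := gt_pow_injective h4
      simp only [Nat.cast_mul, cast_expo, ← Units.val_mul] at h5
      exact mul_left_cancel (Units.ext h5)
  · have h2 : lazyHash (hashValue pp) id' [(id, B.g pp ^ expo x)] = (hashValue pp).bind fun h =>
        PMF.pure (h, [(id', h), (id, B.g pp ^ expo x)]) := by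
      rw [lazyHash, lookup_cons, if_neg hid]
      rfl
    rw [h2, PMF.ev_bind]
    simp only [PMF.ev_pure]
    rw [hashValue, PMF.ev_map]
    -- A collision means `a x r = a x' r'`, that is, `x' = x r r'⁻¹`.
    refine le_trans (PMF.ev_mono fun x' _ => ?_) (ev_unitLaw_eq_le (x * r * r'⁻¹))
    split_ifs with h3 h4 h4
    · exact le_rfl
    · refine absurd ?_ h4
      have h4 := h3.2
      simp only [e_pow_pow, ← pow_mul] at h4
      have h5 := gt_pow_injective h4
      simp only [Nat.cast_mul, cast_expo, ← Units.val_mul] at h5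
      have h6 : a * (x * r) = a * (x' * r') := by
        rw [← mul_assoc, ← mul_assoc]
        exact Units.ext h5
      rw [mul_left_cancel h6, mul_inv_cancel_right]
    · exact zero_le
    · exact le_rfl

theorem _root_.ite_decide_congr {p q : Prop} {_ : Decidable p} {_ : Decidable q} (h : p ↔ q) :
    (if decide p = true then (1 : ℝ≥0∞) else 0) = if q then 1 else 0 :=
  if_congr (decide_eq_true_iff.trans h) rfl rfl

theorem collisionFree_fim (h : B.LargeOrder) : (roIBKEM B).CollisionFree B.fim := by
  refine ⟨fun k => 2 * (∑' pp, B.gen k pp * (B.q pp : ℝ≥0∞)⁻¹).toReal, h.const_mul 2,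
    fun k id id' r r' => ?_⟩
  have h1 : (roIBKEM B).collisionLaw B.fim id id' r r' k true ≤
      2 * (B.gen k).ev fun pp => (B.q pp : ℝ≥0∞)⁻¹ := by
    refine (PMF.bind_apply_eq_ev _ _ _).trans_le ?_
    refine (ev_setup k _).trans_le ?_
    rw [← PMF.ev_mul_left]
    refine PMF.ev_mono fun pp _ => ?_
    rw [← PMF.ev_const (B.unitLaw pp) (2 * _)]
    refine PMF.ev_mono fun a _ => ?_
    rw [PMF.bind_apply_eq_ev]
    refine le_trans (le_of_eq ?_) (collision_le a (id ⟨pp, B.g pp ^ expo a⟩)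
      (id' ⟨pp, B.g pp ^ expo a⟩) (r ⟨pp, B.g pp ^ expo a⟩) (r' ⟨pp, B.g pp ^ expo a⟩))
    refine PMF.ev_congr fun y _ => ?_
    rw [PMF.map_true_eq_ev]
    refine PMF.ev_congr fun y' _ => ?_
    exact ite_decide_congr Iff.rfl
  have h2 : (B.gen k).ev (fun pp => (B.q pp : ℝ≥0∞)⁻¹) ≤ 1 := by
    refine (PMF.ev_mono fun pp _ => ?_).trans (PMF.ev_const (B.gen k) 1).le
    rw [ENNReal.inv_le_one]
    exact_mod_cast (B.q_prime pp).out.one_le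
  refine (ENNReal.toReal_mono ?_ h1).trans_eq ?_
  · exact ENNReal.mul_ne_top (by simp) (ne_top_of_le_ne_top ENNReal.one_ne_top h2)
  · rw [ENNReal.toReal_mul]
    rfl

end BilinearGen

/-! ## The loss factor -/

/-- For `n > 0`, `1 - 2/(n+2)` is the inverse of `1 + 2/n`. The quotient of the two sides is
therefore `(1 + 2/n)^(-n) (1 + 2/n)^(-2) e^2`, which tends to `e^(-2) e^2 = 1`. -/
theorem lossFactor_isEquivalent : Asymptotics.IsEquivalent Filter.atTop lossFactor
    (fun n : ℕ => 4 / (Real.exp 1 * (n : ℝ)) ^ 2) := by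
  refine Asymptotics.isEquivalent_of_tendsto_one ?_
  have h1 : Filter.Tendsto (fun n : ℕ => (1 + 2 / (n : ℝ)) ^ n) Filter.atTop
      (nhds (Real.exp 2)) := Real.tendsto_one_add_div_pow_exp 2
  have h2 : Filter.Tendsto (fun n : ℕ => 1 + 2 / (n : ℝ)) Filter.atTop (nhds (1 + 0)) :=
    tendsto_const_nhds.add (tendsto_const_div_atTop_nhds_zero_nat 2)
  have h3 := ((h1.inv₀ (Real.exp_pos 2).ne').mul ((h2.inv₀ (by norm_num)).pow 2)).mul_const
    (Real.exp 1 ^ 2)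
  have h4 : (Real.exp 2)⁻¹ * (1 + 0 : ℝ)⁻¹ ^ 2 * Real.exp 1 ^ 2 = 1 := by
    rw [← Real.exp_nat_mul]
    norm_num
  rw [h4] at h3
  refine h3.congr' ?_
  filter_upwards [Filter.eventually_gt_atTop 0] with n hn
  have hn' : (n : ℝ) ≠ 0 := by positivity
  have hn2 : (n : ℝ) + 2 ≠ 0 := by positivity
  have h5 : 1 - 2 / ((n : ℝ) + 2) = (1 + 2 / (n : ℝ))⁻¹ := by
    field_simp
    ring
  have h6 : (1 + 2 / (n : ℝ))⁻¹ ^ 2 = n ^ 2 / ((n : ℝ) + 2) ^ 2 := by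
    rw [← div_pow]
    field_simp
  rw [Pi.div_apply, lossFactor, h5, h6, inv_pow]
  have := Real.exp_pos 1
  field_simp
  ring

end

theorem theorem6 (B : BilinearGen) (hB : B.Efficient) :
    (∀ (pp : B.Param) (P : B.G pp) (H : List Bool → B.G pp) (id : List Bool)
      (r : (ZMod (B.q pp))ˣ),
      ((roIBKEM B).encaps ⟨pp, P⟩ id r).eval H =
        (B.e pp P (H id) ^ expo r, B.g pp ^ expo r)) ∧
    (roIBKEM B).Consistent ∧
    (B.LargeOrder → (roIBKEM B).IsCollisionFreeFIM) ∧
    (∀ (A : Prog AdvOracle) (T : Polynomial ℕ) (qp : ℕ → ℕ),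
      UnaryPolyTime qp → (roIBKEM B).IsPPTAdversary A T qp →
      ∃ (D : Prog Empty) (T' : Polynomial ℕ), B.IsPPTSolver D T' ∧
        ∀ k, B.dbdhAdvantage D T' k = lossFactor (qp k) * (roIBKEM B).advantage A T k) ∧
    Asymptotics.IsEquivalent Filter.atTop lossFactor
      (fun n : ℕ => 4 / (Real.exp 1 * (n : ℝ)) ^ 2) := by
  exact ⟨fun _ _ _ _ _ => rfl, BilinearGen.consistent B,
    fun h => ⟨B.fim, BilinearGen.efficientFIM_fim hB, BilinearGen.malleable_fim B,
      BilinearGen.collisionFree_fim h⟩,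
    fun _ _ _ hqp hA => BilinearGen.exists_solver hB hqp hA, lossFactor_isEquivalent⟩
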